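/- **Setting.** Let $V$ be a finite vertex set and let $m$ arcs (loops and parallel arcs allowed) be added one at a time to the initially arcless graph on $V$. The *graph of strong components* has a vertex for each strong component and, for each arc $(v,w)$, an arc $(c(v),c(w))$, where $c(x)$ is the component of $x$. Components are stored as the trees of a disjoint-set forest of parent pointers, and each is identified with the root of its tree. $find$ follows the parent pointers to the root and performs path compression; a $link$ of two roots makes either one the parent of the other (any choice is allowed, so linking by rank or size and naive linking are all included). For every representative we keep the set of arcs out of its component and the set of arcs into it, and we keep a total order of the representatives, initially arbitrary. **Extended search.** To add $(v,w)$, insert it into the arc sets of $c(v)$ and $c(w)$. If $c(v)>c(w)$ in the current order, search: $c(w)$ is *forward* and $c(v)$ is *backward*. Traversing an untraversed arc out of a forward vertex makes its head forward, and traversing an untraversed arc into a backward vertex makes its tail backward. A vertex may become both. A loop (an arc whose ends have the same $find$) that is about to be traversed is instead deleted from the arc set ("put aside"). The search may stop with a vertex $s$ when all arcs out of forward vertices less than $s$ and all arcs into backward vertices greater than $s$ have been traversed. Let $X$ be the set of forward vertices less than $s$ and $Y$ the set of backward vertices greater than $s$. "Topological order" of a set below refers to the subgraph formed by the traversed arcs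 and the new arc on $X\cup Y\cup\{s\}$. * If no vertex is both forward and backward, take topological orders $O_X$, $O_Y$ of $X$ and $Y$, delete $X\cup Y$ from the order, and reinsert $O_Y$ followed by $O_X$ just after $s$ (allowed if $s$ is not forward) or just before $s$ (allowed if $s$ is not backward). * Otherwise let $Z$ be the strong component of $c(v)$ in this subgraph. Link the vertices of $Z$ into one vertex $x$ and unite their arc sets. Delete $X\cup Y$ from the order. Replace $s$ by $x$ if $s\in Z$; otherwise insert $x$ just after $s$ if $s$ is not forward, and just before $s$ if it is. Reinsert $Y\setminus Z$ just before $x$ and $X\setminus Z$ just after $x$, each in a topological order. **Compatible search with a soft threshold.** This version keeps sets $A,B$ (near and far forward candidates), $C,D$ (near and far backward candidates), $X,Y$ (scanned vertices), and thresholds $l,h,s$. Initially $A=\{c(w)\}$, $C=\{c(v)\}$, the other sets are empty, $l=c(w)$, $h=c(v)$, and $s$ is any vertex with $l\le s\le h$. Until $A\cup B=\emptyset$ or $C\cup D=\emptyset$, do the following; a case is applied only if no case with a smaller number applies. * 1f: if $A=\emptyset$, move $B$ to $A$, set $l=s$, choose $t\in A$ and set $s=\min\{t,h\}$. 1b: if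 $C=\emptyset$, move $D$ to $C$, set $h=s$, choose $t\in C$ and set $s=\max\{t,l\}$. * In the other cases choose $u\in A$ and $z\in C$. 2f: if $u\ge h$, delete $u$ from $A$. 2b: if $z\le l$, delete $z$ from $C$. * 3f: if $\max\{z,s\}\le u$, move $u$ from $A$ to $B$. 3b: if $z\le\min\{u,s\}$, move $z$ from $C$ to $D$. * 4f: if all arcs out of $u$ are traversed, move $u$ from $A$ to $X$. 4b: if all arcs into $z$ are traversed, move $z$ from $C$ to $Y$. * 5: take an untraversed arc out of $u$ and an untraversed arc into $z$. If one is a loop, put it aside; otherwise traverse both, adding the newly forward vertex, if any, to $A$ and the newly backward vertex, if any, to $C$. At the end set $s=h$ if $A\cup B=\emptyset$ and $s=l$ otherwise, remove from $X$ the vertices that are not less than $s$ and from $Y$ those that are not greater than $s$, and proceed as above. **Time.** Each step of the search, and each arc insertion, takes one unit. Each $find$ takes one unit plus one per pointer followed; there are two $find$s per arc added and two per arc examined in a search. Choosing a new soft threshold from $g$ vertices in Case 1 takes $g$ additional units. The processing after a search takes one unit plus one per forward vertex, backward vertex, arc traversed, and vertex linked. (So an operation on the dynamic ordered list, a link, and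 a catenation of arc lists take $O(1)$ time, selection takes linear time, and static topological ordering and strong components take linear time in the traversed subgraph.) The initialization is not counted. **Theorem.** 1. The general extended search (with untraversed arcs traversed in any order and any permitted stopping vertex $s$) always terminates and never gets stuck. After each arc addition the sets of the disjoint-set forest are exactly the strong components of the current graph, the order contains each component exactly once and is a topological order of the graph of strong components (ignoring loops), and the arc sets contain, under the right components, all arcs that are not loops. At the end of each search, some vertex is both forward and backward if and only if the new arc creates a cycle, and then the vertex set of the new component is a subset of $X\cup Y\cup\{s\}$. 2. The same holds for compatible search with a soft threshold, for every way of choosing the soft thresholds and of making the other choices. 3. For every $\epsilon>0$ there is a constant $K$, depending only on $\epsilon$, such that if each threshold $t$ chosen in Case 1 is an $\epsilon$-approximate median of the set of $g$ vertices from which it is chosen (at least $\epsilon g$ of them are $\le t$ and at least $\epsilon g$ are $\ge t$), then the total time of compatible search for $m$ arc additions is at most $m\cdot K m^{1/2}$. That is, the amortized time per arc addition is $O(m^{1/2})$ in the worst case. 4. There is an absolute constant $K$ such that if each threshold $t$ chosen in Case 1 is instead drawn uniformly at random from the set, then for every fixed sequence of $m$ arcs, and every way of making the other choices (which may depend on the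 history), the expected total time is at most $m\cdot K m^{1/2}$. -/

import Mathlib

open scoped ENNReal

universe u

namespace StrongMaintenance

noncomputable section

open Classical Relation

/-! ### Disjoint sets: a forest of parent pointers, with path compression -/

section DisjointSets

variable {V : Type u} [Fintype V]

/-- The root of the tree that contains `x`: the result of `find x`.
A tree has at most `Fintype.card V` vertices, so this many pointer steps reach its root. -/
def rep (p : V → V) (x : V) : V := p^[Fintype.card V] x

/-- The number of parent pointers between `x` and its root. -/
def depth (p : V → V) (x : V) : ℕ := sInf {k | p^[k] x = rep p x}

/-- Path compression: after `find x`, each vertex on the find path points to the root. -/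
def compress (p : V → V) (x : V) : V → V :=
  fun y => if ∃ k, p^[k] x = y then rep p x else p y

/-- Perform the finds in the given list one after the other. The result is the new forest and
the total time; a find takes one unit plus one unit per pointer that it follows. -/
def finds : (V → V) → List V → (V → V) × ℕ
  | p, [] => (p, 0)
  | p, x :: xs =>
    let r := finds (compress p x) xs
    (r.1, (depth p x + 1) + r.2)

/-- `LinkAll p Z p' r`: starting from the forest `p`, the representatives in `Z` are combined
into one set by links, in any order. A link of `x` and `y` makes either one the parent of the
other, without restriction (this includes linking by rank and linking by size).
The result is the forest `p'`, in which `r` represents the new set. -/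
inductive LinkAll : (V → V) → Finset V → (V → V) → V → Prop
  | done (p : V → V) (x : V) : LinkAll p {x} p x
  | link (p : V → V) (Z : Finset V) (x y : V) (p' : V → V) (r : V)
      (hx : x ∈ Z) (hy : y ∈ Z) (hxy : x ≠ y)
      (rest : LinkAll (Function.update p y x) (Z.erase y) p' r) : LinkAll p Z p' r

end DisjointSets

/-! ### The data that is maintained -/

/-- The arcs are numbered by `Fin m`. A parent forest represents the components, each component
being identified with its representative; each representative has a set of outgoing and a set of
incoming arcs; `order` lists the representatives in the current vertex order. -/
structure Data (V : Type u) (m : ℕ) where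
  parent : V → V
  out : V → Finset (Fin m)
  inc : V → Finset (Fin m)
  order : List V

section Basic

variable {V : Type u} [Fintype V] {m : ℕ}

/-- `x < y` in the current vertex order. -/
def Data.lt (d : Data V m) (x y : V) : Prop := d.order.idxOf x < d.order.idxOf y

/-- `x ≤ y` in the current vertex order. -/
def Data.le (d : Data V m) (x y : V) : Prop := d.order.idxOf x ≤ d.order.idxOf y

/-- The component in which arc `e` starts. -/
def Data.tail (a : Fin m → V × V) (d : Data V m) (e : Fin m) : V := rep d.parent (a e).1

/-- The component in which arc `e` ends. -/
def Data.head (a : Fin m → V × V) (d : Data V m) (e : Fin m) : V := rep d.parent (a e).2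

/-- Arc `e` is a loop of the graph of strong components. -/
def Data.IsLoop (a : Fin m → V × V) (d : Data V m) (e : Fin m) : Prop := d.tail a e = d.head a e

/-- The two original end vertices of each arc in a list: the finds needed to examine the arcs. -/
def ends (a : Fin m → V × V) (es : List (Fin m)) : List V :=
  es.flatMap fun e => [(a e).1, (a e).2]

/-- The data after the finds for the arcs `es`. -/
def Data.examine (a : Fin m → V × V) (d : Data V m) (es : List (Fin m)) : Data V m :=
  { d with parent := (finds d.parent (ends a es)).1 }

/-- The time for the finds for the arcs `es`. -/
def Data.examineCost (a : Fin m → V × V) (d : Data V m) (es : List (Fin m)) : ℕ :=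
  (finds d.parent (ends a es)).2

/-- Put arc `e` aside: delete it from the outgoing arcs of `u`. -/
def Data.dropOut (d : Data V m) (u : V) (e : Fin m) : Data V m :=
  { d with out := Function.update d.out u ((d.out u).erase e) }

/-- Put arc `e` aside: delete it from the incoming arcs of `z`. -/
def Data.dropInc (d : Data V m) (z : V) (e : Fin m) : Data V m :=
  { d with inc := Function.update d.inc z ((d.inc z).erase e) }

/-- Find the components of the ends of the new arc `i` and insert it into their arc sets. -/
def Data.addArc (a : Fin m → V × V) (d : Data V m) (i : Fin m) : Data V m where
  parent := (finds d.parent (ends a [i])).1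
  out := Function.update d.out (d.tail a i) (insert i (d.out (d.tail a i)))
  inc := Function.update d.inc (d.head a i) (insert i (d.inc (d.head a i)))
  order := d.order

/-- Initially all components are single vertices, in an arbitrary order, and there are no arcs. -/
def Data.empty (o : List V) : Data V m where
  parent := id
  out := fun _ => ∅
  inc := fun _ => ∅
  order := o

/-- There is a path from `x` to `y` in the graph that consists of the first `k` arcs. -/
def Reach (a : Fin m → V × V) (k : ℕ) : V → V → Prop :=
  ReflTransGen fun x y => ∃ j : Fin m, j.val < k ∧ a j = (x, y)

/-- After `k` arc additions the data is correct. -/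
structure Correct (a : Fin m → V × V) (k : ℕ) (d : Data V m) : Prop where
  /-- `find` ends at a root of the forest -/
  root : ∀ x, d.parent (rep d.parent x) = rep d.parent x
  /-- the sets of the forest are the strong components -/
  component : ∀ x y, rep d.parent x = rep d.parent y ↔ Reach a k x y ∧ Reach a k y x
  /-- the order contains each component once -/
  nodup : d.order.Nodup
  mem_order : ∀ x, x ∈ d.order ↔ d.parent x = x
  /-- it is a topological order of the graph of strong components, ignoring loops -/
  topological : ∀ j : Fin m, j.val < k → ¬ d.IsLoop a j → d.lt (d.tail a j) (d.head a j)
  /-- the arc sets represent the graph of strong components; only loops are put aside -/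
  of_mem_out : ∀ x, d.parent x = x → ∀ j ∈ d.out x, j.val < k ∧ d.tail a j = x
  of_mem_inc : ∀ x, d.parent x = x → ∀ j ∈ d.inc x, j.val < k ∧ d.head a j = x
  mem_out : ∀ j : Fin m, j.val < k → ¬ d.IsLoop a j → j ∈ d.out (d.tail a j)
  mem_inc : ∀ j : Fin m, j.val < k → ¬ d.IsLoop a j → j ∈ d.inc (d.head a j)

end Basic

/-! ### Bidirectional search and the change of the order after it -/

/-- The forward vertices, the backward vertices, and the arcs traversed forward and backward. -/
structure Search (V : Type u) (m : ℕ) where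
  F : Finset V
  R : Finset V
  trF : Finset (Fin m)
  trB : Finset (Fin m)

section Rebuilding

variable {V : Type u} [Fintype V] {m : ℕ}

/-- The search for the new arc `(v, w)` starts forward from `w` and backward from `v`. -/
def Search.start (v w : V) : Search V m := ⟨{w}, {v}, ∅, ∅⟩

/-- The forward vertices less than `s` are forward scanned, and the backward vertices greater
than `s` are backward scanned. -/
def Search.Stop (d : Data V m) (S : Search V m) (s : V) : Prop :=
  s ∈ d.order ∧ (∀ x ∈ S.F, d.lt x s → d.out x ⊆ S.trF) ∧ (∀ y ∈ S.R, d.lt s y → d.inc y ⊆ S.trB)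

/-- The arcs of the subgraph with vertex set `X ∪ Y ∪ {s}` whose arcs are the traversed arcs and
the new arc `i`. -/
def Search.Sub (a : Fin m → V × V) (i : Fin m) (d : Data V m) (S : Search V m)
    (X Y : Finset V) (s : V) (x y : V) : Prop :=
  x ∈ insert s (X ∪ Y) ∧ y ∈ insert s (X ∪ Y) ∧
    ∃ e ∈ insert i (S.trF ∪ S.trB), d.tail a e = x ∧ d.head a e = y

/-- The strong component of this subgraph that contains the tail of the new arc. -/
def Search.newComponent (a : Fin m → V × V) (i : Fin m) (d : Data V m) (S : Search V m)
    (X Y : Finset V) (s : V) : Finset V :=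
  (insert s (X ∪ Y)).filter fun z =>
    ReflTransGen (S.Sub a i d X Y s) (d.tail a i) z ∧ ReflTransGen (S.Sub a i d X Y s) z (d.tail a i)

/-- `L` is a topological order of the subgraph with arcs `E` that is induced by `T`. -/
def IsTopOrder (E : V → V → Prop) (T : Finset V) (L : List V) : Prop :=
  L.Nodup ∧ L.toFinset = T ∧ ∀ x ∈ T, ∀ y ∈ T, E x y → L.idxOf x < L.idxOf y

/-- The change of the data after a search has stopped with threshold `s`, where `X` is the set of
forward vertices less than `s` and `Y` the set of backward vertices greater than `s`. The last
argument is the number of vertices that are combined by links. If no vertex is both forward and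
backward, the vertices in `X ∪ Y` are reinserted just after or just before `s`. Otherwise the
new component is contracted. -/
inductive Rebuild (a : Fin m → V × V) (i : Fin m) (d : Data V m) (S : Search V m)
    (X Y : Finset V) (s : V) : Data V m → ℕ → Prop
  | after (hFR : Disjoint S.F S.R) (hs : s ∉ S.F) (OX OY P Q : List V)
      (hX : IsTopOrder (S.Sub a i d X Y s) X OX) (hY : IsTopOrder (S.Sub a i d X Y s) Y OY)
      (hPQ : d.order.filter (fun x => x ∉ X ∪ Y) = P ++ s :: Q) :
      Rebuild a i d S X Y s { d with order := P ++ s :: (OY ++ OX ++ Q) } 0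
  | before (hFR : Disjoint S.F S.R) (hs : s ∉ S.R) (OX OY P Q : List V)
      (hX : IsTopOrder (S.Sub a i d X Y s) X OX) (hY : IsTopOrder (S.Sub a i d X Y s) Y OY)
      (hPQ : d.order.filter (fun x => x ∉ X ∪ Y) = P ++ s :: Q) :
      Rebuild a i d S X Y s { d with order := P ++ (OY ++ OX ++ s :: Q) } 0
  | contract (hFR : ¬ Disjoint S.F S.R) (Z : Finset V) (hZ : Z = S.newComponent a i d X Y s)
      (p' : V → V) (r : V) (hlink : LinkAll d.parent Z p' r) (OX OY P Q : List V)
      (hX : IsTopOrder (S.Sub a i d X Y s) (X \ Z) OX)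
      (hY : IsTopOrder (S.Sub a i d X Y s) (Y \ Z) OY)
      (hPQ : d.order.filter (fun x => x ∉ X ∪ Y) = P ++ s :: Q) :
      Rebuild a i d S X Y s
        { parent := p'
          out := Function.update d.out r (Z.biUnion d.out)
          inc := Function.update d.inc r (Z.biUnion d.inc)
          order :=
            if s ∈ Z then P ++ (OY ++ r :: OX) ++ Q
            else if s ∉ S.F then P ++ s :: (OY ++ r :: OX) ++ Q
            else P ++ (OY ++ r :: OX) ++ s :: Q }
        Z.card

/-- The time for finding the new component, ordering `X` and `Y`, and reinserting: linear in the
number of vertices reached, arcs traversed and vertices combined. -/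
def Search.rebuildCost (S : Search V m) (links : ℕ) : ℕ :=
  1 + S.F.card + S.R.card + S.trF.card + S.trB.card + links

/-- At the end of the search for arc `i`, which leads from `v` to `w`: some vertex is both forward
and backward if and only if the addition of the arc creates a cycle, and in this case the vertex
set of the new component is contained in `X ∪ Y ∪ {s}`. -/
def Detects (a : Fin m → V × V) (i : Fin m) (d : Data V m) (S : Search V m)
    (X Y : Finset V) (s : V) : Prop :=
  ((∃ x, x ∈ S.F ∧ x ∈ S.R) ↔ Reach a i.val (a i).2 (a i).1) ∧
  (Reach a i.val (a i).2 (a i).1 → ∀ z, d.parent z = z →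
    Reach a (i.val + 1) (a i).1 z → Reach a (i.val + 1) z (a i).1 → z ∈ insert s (X ∪ Y))

end Rebuilding

/-! ### Configurations of the algorithm -/

/-- `done` arcs have been added completely. If a search is in progress, it belongs to the arc with
number `done`. `cost` is the time spent so far. -/
structure Config (V : Type u) (m : ℕ) (σ : Type u) where
  done : ℕ
  data : Data V m
  search : Option σ
  cost : ℕ

section Algorithms

variable {V : Type u} [Fintype V] {m : ℕ} {σ : Type u}

def Config.empty (o : List V) : Config V m σ := ⟨0, Data.empty o, none, 0⟩

/-- The first part of the addition of the next arc: insert it, and start a search if the component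
of its tail is greater than the component of its head. -/
inductive Begin (a : Fin m → V × V) (start : Data V m → V → V → σ → Prop) :
    Config V m σ → Config V m σ → Prop
  | quiet (c : Config V m σ) (i : Fin m) (hc : c.search = none) (hi : i.val = c.done)
      (h : ¬ c.data.lt (c.data.head a i) (c.data.tail a i)) :
      Begin a start c
        ⟨c.done + 1, c.data.addArc a i, none, c.cost + 1 + c.data.examineCost a [i]⟩
  | search (c : Config V m σ) (i : Fin m) (T : σ) (hc : c.search = none) (hi : i.val = c.done)
      (h : c.data.lt (c.data.head a i) (c.data.tail a i))
      (hT : start c.data (c.data.tail a i) (c.data.head a i) T) :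
      Begin a start c
        ⟨c.done, c.data.addArc a i, some T, c.cost + 1 + c.data.examineCost a [i]⟩

/-- The algorithm with step relation `step` always finishes, is never stuck before all `m` arcs are
added, and its data is correct after each arc addition, whatever choices it makes. -/
structure Maintains (a : Fin m → V × V) (step : Config V m σ → Config V m σ → Prop)
    (c₀ : Config V m σ) : Prop where
  terminates : Acc (fun c' c => step c c') c₀
  progress : ∀ c, ReflTransGen step c₀ c → (c.search.isSome ∨ c.done < m) → ∃ c', step c c'
  bounded : ∀ c, ReflTransGen step c₀ c → c.done ≤ m
  correct : ∀ c, ReflTransGen step c₀ c → c.search = none → Correct a c.done c.data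

/-! ### The general method -/

/-- One step of the general method. Vertices may become both forward and backward. -/
inductive GeneralStep (a : Fin m → V × V) :
    Config V m (Search V m) → Config V m (Search V m) → Prop
  | start (c c' : Config V m (Search V m))
      (h : Begin a (fun _ v w S => S = Search.start v w) c c') : GeneralStep a c c'
  | forward (c : Config V m (Search V m)) (S : Search V m) (u : V) (e : Fin m)
      (hc : c.search = some S) (hu : u ∈ S.F) (he : e ∈ c.data.out u) (he' : e ∉ S.trF)
      (hl : ¬ c.data.IsLoop a e) :
      GeneralStep a c
        ⟨c.done, c.data.examine a [e],
          some { S with F := insert (c.data.head a e) S.F, trF := insert e S.trF },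
          c.cost + 1 + c.data.examineCost a [e]⟩
  | backward (c : Config V m (Search V m)) (S : Search V m) (z : V) (e : Fin m)
      (hc : c.search = some S) (hz : z ∈ S.R) (he : e ∈ c.data.inc z) (he' : e ∉ S.trB)
      (hl : ¬ c.data.IsLoop a e) :
      GeneralStep a c
        ⟨c.done, c.data.examine a [e],
          some { S with R := insert (c.data.tail a e) S.R, trB := insert e S.trB },
          c.cost + 1 + c.data.examineCost a [e]⟩
  | asideF (c : Config V m (Search V m)) (S : Search V m) (u : V) (e : Fin m)
      (hc : c.search = some S) (hu : u ∈ S.F) (he : e ∈ c.data.out u) (he' : e ∉ S.trF)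
      (hl : c.data.IsLoop a e) :
      GeneralStep a c
        ⟨c.done, (c.data.examine a [e]).dropOut u e, some S,
          c.cost + 1 + c.data.examineCost a [e]⟩
  | asideB (c : Config V m (Search V m)) (S : Search V m) (z : V) (e : Fin m)
      (hc : c.search = some S) (hz : z ∈ S.R) (he : e ∈ c.data.inc z) (he' : e ∉ S.trB)
      (hl : c.data.IsLoop a e) :
      GeneralStep a c
        ⟨c.done, (c.data.examine a [e]).dropInc z e, some S,
          c.cost + 1 + c.data.examineCost a [e]⟩
  | finish (c : Config V m (Search V m)) (S : Search V m) (i : Fin m) (s : V)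
      (hc : c.search = some S) (hi : i.val = c.done) (hs : S.Stop c.data s)
      (d' : Data V m) (links : ℕ)
      (h : Rebuild a i c.data S (S.F.filter fun x => c.data.lt x s)
        (S.R.filter fun y => c.data.lt s y) s d' links) :
      GeneralStep a c ⟨c.done + 1, d', none, c.cost + S.rebuildCost links⟩

/-! ### Compatible search with a soft threshold -/

/-- `A` and `B` are the near and the far forward candidates, `C` and `D` the near and the far
backward candidates, `X` and `Y` the scanned vertices, `l` and `h` the hard thresholds, and `s` is
the soft threshold. -/
structure Soft (V : Type u) (m : ℕ) extends Search V m where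
  A : Finset V
  B : Finset V
  C : Finset V
  D : Finset V
  X : Finset V
  Y : Finset V
  l : V
  h : V
  s : V

/-- The search for a new arc starts at `v` and `w`, with any soft threshold between `w` and `v`. -/
def Soft.Start (d : Data V m) (v w : V) (T : Soft V m) : Prop :=
  ∃ s ∈ d.order, d.le w s ∧ d.le s v ∧
    T = { Search.start v w with
          A := {w}, B := ∅, C := {v}, D := ∅, X := ∅, Y := ∅, l := w, h := v, s := s }

/-- The search ends when there are no forward or no backward candidates. -/
def Soft.Stop (T : Soft V m) : Prop := T.A ∪ T.B = ∅ ∨ T.C ∪ T.D = ∅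

/-- The final threshold. -/
def Soft.final (T : Soft V m) : V := if T.A ∪ T.B = ∅ then T.h else T.l

/-- The final value of `X`. -/
def Soft.finalX (d : Data V m) (T : Soft V m) : Finset V := T.X.filter fun x => d.lt x T.final

/-- The final value of `Y`. -/
def Soft.finalY (d : Data V m) (T : Soft V m) : Finset V := T.Y.filter fun y => d.lt T.final y

/-- Cases 1, 2 and 3 do not apply to `u` and `z`: a compatible pair. -/
def Soft.Pair (d : Data V m) (T : Soft V m) (u z : V) : Prop :=
  u ∈ T.A ∧ z ∈ T.C ∧ d.lt u T.h ∧ d.lt T.l z ∧ d.lt u z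

/-- Replace the state of the search, at a cost of `k`. -/
def Config.set (c : Config V m σ) (T : σ) (k : ℕ) : Config V m σ :=
  { c with search := some T, cost := c.cost + k }

/-- The near forward candidates are used up, but the search goes on. -/
def CanRefillF (c : Config V m (Soft V m)) (T : Soft V m) : Prop :=
  c.search = some T ∧ ¬ T.Stop ∧ T.A = ∅ ∧ T.B.Nonempty

/-- The near backward candidates are used up, but the search goes on. -/
def CanRefillB (c : Config V m (Soft V m)) (T : Soft V m) : Prop :=
  c.search = some T ∧ ¬ T.Stop ∧ T.C = ∅ ∧ T.D.Nonempty

/-- Case 1f, where `t` is the vertex chosen for the new soft threshold. Choosing `t` takes time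
linear in the number of vertices from which it is chosen. -/
def refillF (c : Config V m (Soft V m)) (T : Soft V m) (t : V) : Config V m (Soft V m) :=
  c.set { T with A := T.B, B := ∅, l := T.s, s := if c.data.le t T.h then t else T.h }
    (1 + T.B.card)

/-- Case 1b, where `t` is the vertex chosen for the new soft threshold. -/
def refillB (c : Config V m (Soft V m)) (T : Soft V m) (t : V) : Config V m (Soft V m) :=
  c.set { T with C := T.D, D := ∅, h := T.s, s := if c.data.le T.l t then t else T.l }
    (1 + T.D.card)

/-- The steps of the algorithm other than Cases 1f and 1b. The cases are tried in the order of
their numbers: a case applies only if no case with a smaller number does. -/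
inductive PlainStep (a : Fin m → V × V) :
    Config V m (Soft V m) → Config V m (Soft V m) → Prop
  | start (c c' : Config V m (Soft V m)) (h : Begin a Soft.Start c c') : PlainStep a c c'
  | case2f (c : Config V m (Soft V m)) (T : Soft V m) (u z : V) (hc : c.search = some T)
      (hu : u ∈ T.A) (hz : z ∈ T.C) (h : c.data.le T.h u) :
      PlainStep a c (c.set { T with A := T.A.erase u } 1)
  | case2b (c : Config V m (Soft V m)) (T : Soft V m) (u z : V) (hc : c.search = some T)
      (hu : u ∈ T.A) (hz : z ∈ T.C) (h : c.data.le z T.l) :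
      PlainStep a c (c.set { T with C := T.C.erase z } 1)
  | case3f (c : Config V m (Soft V m)) (T : Soft V m) (u z : V) (hc : c.search = some T)
      (hu : u ∈ T.A) (hz : z ∈ T.C) (huh : c.data.lt u T.h) (hlz : c.data.lt T.l z)
      (hzu : c.data.le z u) (hsu : c.data.le T.s u) :
      PlainStep a c (c.set { T with A := T.A.erase u, B := insert u T.B } 1)
  | case3b (c : Config V m (Soft V m)) (T : Soft V m) (u z : V) (hc : c.search = some T)
      (hu : u ∈ T.A) (hz : z ∈ T.C) (huh : c.data.lt u T.h) (hlz : c.data.lt T.l z)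
      (hzu : c.data.le z u) (hzs : c.data.le z T.s) :
      PlainStep a c (c.set { T with C := T.C.erase z, D := insert z T.D } 1)
  | case4f (c : Config V m (Soft V m)) (T : Soft V m) (u z : V) (hc : c.search = some T)
      (huz : T.Pair c.data u z) (h : c.data.out u ⊆ T.trF) :
      PlainStep a c (c.set { T with A := T.A.erase u, X := insert u T.X } 1)
  | case4b (c : Config V m (Soft V m)) (T : Soft V m) (u z : V) (hc : c.search = some T)
      (huz : T.Pair c.data u z) (h : c.data.inc z ⊆ T.trB) :
      PlainStep a c (c.set { T with C := T.C.erase z, Y := insert z T.Y } 1)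
  /-- a loop is put aside instead of being traversed -/
  | asideF (c : Config V m (Soft V m)) (T : Soft V m) (u z : V) (e : Fin m)
      (hc : c.search = some T) (huz : T.Pair c.data u z) (hz : ¬ c.data.inc z ⊆ T.trB)
      (he : e ∈ c.data.out u) (he' : e ∉ T.trF) (hl : c.data.IsLoop a e) :
      PlainStep a c
        ⟨c.done, (c.data.examine a [e]).dropOut u e, some T,
          c.cost + 1 + c.data.examineCost a [e]⟩
  | asideB (c : Config V m (Soft V m)) (T : Soft V m) (u z : V) (e : Fin m)
      (hc : c.search = some T) (huz : T.Pair c.data u z) (hu : ¬ c.data.out u ⊆ T.trF)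
      (he : e ∈ c.data.inc z) (he' : e ∉ T.trB) (hl : c.data.IsLoop a e) :
      PlainStep a c
        ⟨c.done, (c.data.examine a [e]).dropInc z e, some T,
          c.cost + 1 + c.data.examineCost a [e]⟩
  /-- traverse `e = (u, x)` forward and `e' = (y, z)` backward -/
  | case5 (c : Config V m (Soft V m)) (T : Soft V m) (u z : V) (e e' : Fin m) (x y : V)
      (hc : c.search = some T) (huz : T.Pair c.data u z)
      (he : e ∈ c.data.out u) (heT : e ∉ T.trF) (hle : ¬ c.data.IsLoop a e)
      (he' : e' ∈ c.data.inc z) (heT' : e' ∉ T.trB) (hle' : ¬ c.data.IsLoop a e')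
      (hx : x = c.data.head a e) (hy : y = c.data.tail a e') :
      PlainStep a c
        ⟨c.done, c.data.examine a [e, e'],
          some { T with
            F := insert x T.F
            R := insert y T.R
            trF := insert e T.trF
            trB := insert e' T.trB
            A := if x ∈ T.F then T.A else insert x T.A
            C := if y ∈ T.R then T.C else insert y T.C },
          c.cost + 1 + c.data.examineCost a [e, e']⟩
  | finish (c : Config V m (Soft V m)) (T : Soft V m) (i : Fin m)
      (hc : c.search = some T) (hi : i.val = c.done) (hs : T.Stop)
      (d' : Data V m) (links : ℕ)
      (h : Rebuild a i c.data T.toSearch (T.finalX c.data) (T.finalY c.data) T.final d' links) :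
      PlainStep a c ⟨c.done + 1, d', none, c.cost + T.toSearch.rebuildCost links⟩

/-- One step of the algorithm, where each new soft threshold is chosen according to a rule:
`rule o S t` means that `t` may be chosen from the set `S` of vertices ordered by `o`. -/
inductive SoftStep (a : Fin m → V × V) (rule : List V → Finset V → V → Prop) :
    Config V m (Soft V m) → Config V m (Soft V m) → Prop
  | plain (c c' : Config V m (Soft V m)) (h : PlainStep a c c') : SoftStep a rule c c'
  | case1f (c : Config V m (Soft V m)) (T : Soft V m) (t : V) (h : CanRefillF c T)
      (ht : t ∈ T.B) (hr : rule c.data.order T.B t) : SoftStep a rule c (refillF c T t)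
  | case1b (c : Config V m (Soft V m)) (T : Soft V m) (t : V) (h : CanRefillB c T)
      (ht : t ∈ T.D) (hr : rule c.data.order T.D t) : SoftStep a rule c (refillB c T t)

/-- `t` is an `ε`-approximate median of `S`: at least `ε |S|` elements of `S` are at most `t`, and at
least `ε |S|` elements of `S` are at least `t`. -/
def IsApproxMedian (ε : ℝ) (o : List V) (S : Finset V) (t : V) : Prop :=
  t ∈ S ∧ ε * S.card ≤ (S.filter fun x => o.idxOf x ≤ o.idxOf t).card ∧
    ε * S.card ≤ (S.filter fun x => o.idxOf t ≤ o.idxOf x).card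

/-! ### Random soft thresholds -/

/-- The possible distributions of the next configuration if each new soft threshold is drawn
uniformly at random; all other choices are arbitrary. -/
inductive Draw (a : Fin m → V × V) (c : Config V m (Soft V m)) :
    PMF (Config V m (Soft V m)) → Prop
  | halt (h : ∀ c', ¬ SoftStep a (fun _ _ _ => True) c c') : Draw a c (PMF.pure c)
  | plain (c' : Config V m (Soft V m)) (h : PlainStep a c c') : Draw a c (PMF.pure c')
  | case1f (T : Soft V m) (h : CanRefillF c T) :
      Draw a c ((PMF.uniformOfFinset T.B h.2.2.2).map (refillF c T))
  | case1b (T : Soft V m) (h : CanRefillB c T) :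
      Draw a c ((PMF.uniformOfFinset T.D h.2.2.2).map (refillB c T))

/-- The distribution of the current configuration and the list of the previous ones after a number
of steps, if the next configuration is distributed according to `K`, which may depend on the whole
history. -/
def history (K : Config V m (Soft V m) → List (Config V m (Soft V m)) → PMF (Config V m (Soft V m)))
    (c₀ : Config V m (Soft V m)) : ℕ → PMF (Config V m (Soft V m) × List (Config V m (Soft V m)))
  | 0 => PMF.pure (c₀, [])
  | n + 1 => (history K c₀ n).bind fun H => (K H.1 H.2).map fun c' => (c', H.1 :: H.2)

/-- The expected time spent in the first `n` steps. -/
def expectedCost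
    (K : Config V m (Soft V m) → List (Config V m (Soft V m)) → PMF (Config V m (Soft V m)))
    (c₀ : Config V m (Soft V m)) (n : ℕ) : ℝ≥0∞ :=
  ∑' H, history K c₀ n H * (H.1.cost : ℝ≥0∞)

end Algorithms

end

end StrongMaintenance

/-! Correctness. The order is topological, so positions never decrease along a path. When a search
stops at `s`, every forward vertex below `s` and every backward vertex above `s` has been scanned.
Hence a vertex on an old path from the head of the new arc to its tail is forward if it lies below
`s` and backward if it lies above (`Searching.mem_of_between`). If such a path runs from below `s`
to above `s`, it contains an arc across `s`; its tail is forward, and its head is backward and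
scanned, so its tail is also backward (`Searching.exists_both`). All non-loop arcs of such paths are
traversed, so the component found in the traversed subgraph is the true new component `Z`
(`Searching.mem_newComponent`). The new order is a concatenation of blocks. It is topological
because arcs into `Y` come from backward vertices, arcs out of `X` lead to forward vertices, and a
vertex of both kinds lies in `Z` (`Blocks.pair`, `Searching.rebuild_correct`).

Time. All costs are charged to `Config.potential`, which contains the time already spent and four
reserves.

Traversed arcs: a compatible search that traverses `k` arcs forward also traverses `k` arcs
backward, in pairs with tail of the first below head of the second. Of the `k ^ 2` combinations at
least half have this property too, and each becomes a newly related pair or a newly internal pair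
(`SoftSearching.sq_card_le`). As `pairCount` never exceeds `2 * m ^ 2`, the squares of the search
sizes sum to `O(m ^ 2)`, and by Cauchy-Schwarz the sizes sum to `O(m ^ (3/2))`. The inequality
between the arithmetic and the geometric mean makes this a potential that is linear in `k`
(`SoftSearching.arcPotential_le`).

Finds: links are arbitrary, so finds are paid by the sum of the logarithms of all subtree sizes,
multiplied by a factor of order `m ^ (1/4)`. With this factor a find has constant amortized time
(`Forest.depth_compress_le`), while all links together raise the potential by `O(m ^ (3/2))`.

Loops: an arc is put aside at most twice, once from each kind of arc set (`liveCount`).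

Soft thresholds: a new candidate adds at most 2 to `candPotential`, the moves between the sets add
nothing, and a refill from `g` vertices releases `g` minus the larger of the numbers of these
vertices before and after the chosen threshold (`candPotential_refill`). This is at least `ε * g`
for an approximate median and at least `g / 6` on average for a random choice (`sum_rank_le`).

No step raises the total potential, in expectation in the random case. Since each step costs at
least one unit, the time bound also gives termination for arbitrary thresholds. -/

namespace StrongMaintenance

noncomputable section

open Classical Relation

set_option linter.unusedSectionVars false

/-! ### Disjoint-set forests: roots, path compression and links. -/

section Forests

variable {V : Type u} [Fintype V]

/-- Every vertex reaches a root. -/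
def Forest (p : V → V) : Prop := ∀ x, p (rep p x) = rep p x

theorem iterate_add_eq_of_fixed {p : V → V} {x : V} {k : ℕ} (h : p (p^[k] x) = p^[k] x) (j : ℕ) :
    p^[j + k] x = p^[k] x := by
  rw [Function.iterate_add_apply]
  exact Function.iterate_fixed h j

/-- The vertices up to the first fixed point on a pointer path are distinct, so by pigeonhole the
`Fintype.card V` steps of `rep` are enough to get there. -/
theorem rep_eq_of_iterate {p : V → V} {x : V} {k : ℕ} (h : p (p^[k] x) = p^[k] x) :
    rep p x = p^[k] x := by
  have hex : ∃ k, p (p^[k] x) = p^[k] x := ⟨k, h⟩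
  have hn := Nat.find_spec hex
  set n := Nat.find hex with hn'
  have hinj : Set.InjOn (fun j => p^[j] x) (Finset.range (n + 1) : Set ℕ) := by
    have key : ∀ i j, i < j → j ≤ n → p^[i] x ≠ p^[j] x := by
      intro i j hij hj heq
      have h1 : p^[n - j + i] x = p^[n - j + j] x := by
        rw [Function.iterate_add_apply, heq, ← Function.iterate_add_apply]
      rw [Nat.sub_add_cancel hj] at h1
      -- A repetition at `i < j` would reach the fixed point already after `n - j + i < n` steps.
      exact Nat.find_min hex (m := n - j + i) (by omega) (by rw [h1]; exact hn)
    intro i hi j hj hij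
    simp only [Finset.coe_range, Set.mem_Iio] at hi hj
    rcases lt_trichotomy i j with h | h | h
    · exact absurd hij (key i j h (by omega))
    · exact h
    · exact absurd hij.symm (key j i h (by omega))
  have hcard : n + 1 ≤ Fintype.card V := by
    have := Finset.card_le_card_of_injOn (s := Finset.range (n + 1)) (t := Finset.univ)
      (fun j => p^[j] x) (by simp) hinj
    simpa using this
  have hk : n ≤ k := Nat.find_le h
  have e1 := iterate_add_eq_of_fixed hn (Fintype.card V - n)
  have e2 := iterate_add_eq_of_fixed hn (k - n)
  rw [Nat.sub_add_cancel (by omega)] at e1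
  rw [Nat.sub_add_cancel hk] at e2
  rw [rep, e1, e2]

theorem forest_iff {p : V → V} : Forest p ↔ ∀ x, ∃ k, p (p^[k] x) = p^[k] x :=
  ⟨fun h x => ⟨Fintype.card V, h x⟩, fun h x => by
    obtain ⟨k, hk⟩ := h x
    rw [rep_eq_of_iterate hk, hk]⟩

theorem rep_of_fixed {p : V → V} {x : V} (h : p x = x) : rep p x = x :=
  Function.iterate_fixed h _

theorem Forest.rep_apply {p : V → V} (hp : Forest p) (x : V) : rep p (p x) = rep p x := by
  have := hp x
  rw [rep, ← Function.iterate_succ_apply, Function.iterate_succ_apply']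
  exact this

theorem Forest.rep_iterate {p : V → V} (hp : Forest p) (x : V) (k : ℕ) :
    rep p (p^[k] x) = rep p x := by
  induction k with
  | zero => rfl
  | succ k ih => rw [Function.iterate_succ_apply', hp.rep_apply, ih]

theorem Forest.rep_rep {p : V → V} (hp : Forest p) (x : V) : rep p (rep p x) = rep p x :=
  rep_of_fixed (hp x)

theorem Forest.rep_eq_self {p : V → V} (hp : Forest p) {x : V} : rep p x = x ↔ p x = x :=
  ⟨fun h => by have := hp x; rwa [h] at this, rep_of_fixed⟩

/-- A function that is constant along the pointers and fixes the roots is `rep`. -/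
theorem Forest.rep_eq {p : V → V} (hp : Forest p) (f : V → V) (hf : ∀ x, f (p x) = f x)
    (hr : ∀ x, p x = x → f x = x) (x : V) : rep p x = f x := by
  have h : ∀ k, f (p^[k] x) = f x := by
    intro k
    induction k with
    | zero => rfl
    | succ k ih => rw [Function.iterate_succ_apply', hf, ih]
  rw [← hr _ (hp x)]
  exact h _

theorem iterate_depth (p : V → V) (x : V) : p^[depth p x] x = rep p x :=
  Nat.sInf_mem (s := {k | p^[k] x = rep p x}) ⟨Fintype.card V, rfl⟩

theorem iterate_ne_of_lt_depth {p : V → V} {x : V} {j : ℕ} (h : j < depth p x) :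
    p^[j] x ≠ rep p x := fun h' => Nat.notMem_of_lt_sInf h h'

theorem iterate_injOn_depth (p : V → V) (x : V) :
    Set.InjOn (fun j => p^[j] x) {j | j ≤ depth p x} := by
  have key : ∀ i j, i < j → j ≤ depth p x → p^[i] x ≠ p^[j] x := by
    intro i j hij hj heq
    have h1 : p^[depth p x - j + i] x = p^[depth p x - j + j] x := by
      rw [Function.iterate_add_apply, heq, ← Function.iterate_add_apply]
    rw [Nat.sub_add_cancel hj, iterate_depth] at h1
    exact iterate_ne_of_lt_depth (by omega) h1
  intro i hi j hj hij
  rcases lt_trichotomy i j with h | h | h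
  · exact absurd hij (key i j h hj)
  · exact h
  · exact absurd hij.symm (key j i h hi)

theorem compress_of_path {p : V → V} {x y : V} (h : ∃ k, p^[k] x = y) :
    compress p x y = rep p x := if_pos h

theorem compress_rep (p : V → V) (x : V) : compress p x (rep p x) = rep p x :=
  compress_of_path ⟨_, rfl⟩

theorem Forest.compress {p : V → V} (hp : Forest p) (x : V) : Forest (compress p x) := by
  rw [forest_iff]
  intro y
  obtain ⟨n, hn⟩ := forest_iff.1 hp y
  induction n generalizing y with
  | zero =>
    refine ⟨0, ?_⟩
    simp only [Function.iterate_zero, id] at hn ⊢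
    by_cases h : ∃ k, p^[k] x = y
    · rw [compress_of_path h]
      obtain ⟨k, rfl⟩ := h
      exact rep_eq_of_iterate hn
    · rw [StrongMaintenance.compress, if_neg h, hn]
  | succ n ih =>
    by_cases h : ∃ k, p^[k] x = y
    · refine ⟨1, ?_⟩
      simp only [Function.iterate_one]
      rw [compress_of_path h, compress_rep]
    · obtain ⟨k, hk⟩ := ih (p y) (by simpa only [Function.iterate_succ_apply] using hn)
      have e : StrongMaintenance.compress p x y = p y := if_neg h
      refine ⟨k + 1, ?_⟩
      rw [Function.iterate_succ_apply, e, hk]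

theorem Forest.rep_compress {p : V → V} (hp : Forest p) (x : V) :
    rep (StrongMaintenance.compress p x) = rep p := by
  funext y
  refine (hp.compress x).rep_eq (rep p) (fun z => ?_) (fun z hz => ?_) y
  · by_cases h : ∃ k, p^[k] x = z
    · rw [compress_of_path h, hp.rep_rep]
      obtain ⟨k, rfl⟩ := h
      rw [hp.rep_iterate]
    · rw [StrongMaintenance.compress, if_neg h, hp.rep_apply]
  · by_cases h : ∃ k, p^[k] x = z
    · rw [compress_of_path h] at hz
      rw [← hz, hp.rep_rep]
    · rw [StrongMaintenance.compress, if_neg h] at hz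
      exact rep_of_fixed hz

theorem Forest.finds {p : V → V} (hp : Forest p) (xs : List V) :
    Forest (finds p xs).1 ∧ rep (finds p xs).1 = rep p := by
  induction xs generalizing p with
  | nil => exact ⟨hp, rfl⟩
  | cons x xs ih =>
    obtain ⟨h1, h2⟩ := ih (hp.compress x)
    exact ⟨h1, h2.trans (hp.rep_compress x)⟩

theorem Forest.link {p : V → V} (hp : Forest p) {x y : V} (hx : p x = x) (hy : p y = y)
    (hxy : x ≠ y) : Forest (Function.update p y x) ∧
      ∀ z, rep (Function.update p y x) z = if rep p z = y then x else rep p z := by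
  have hx' : Function.update p y x x = x := by rw [Function.update_of_ne hxy, hx]
  have hF : Forest (Function.update p y x) := by
    rw [forest_iff]
    intro z
    obtain ⟨n, hn⟩ := forest_iff.1 hp z
    induction n generalizing z with
    | zero =>
      by_cases hz : z = y
      · subst hz
        exact ⟨1, by simp [hx']⟩
      · refine ⟨0, ?_⟩
        simp only [Function.iterate_zero, id] at hn ⊢
        rw [Function.update_of_ne hz, hn]
    | succ n ih =>
      by_cases hz : z = y
      · subst hz
        exact ⟨1, by simp [hx']⟩
      · obtain ⟨k, hk⟩ := ih (p z) (by simpa only [Function.iterate_succ_apply] using hn)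
        refine ⟨k + 1, ?_⟩
        rw [Function.iterate_succ_apply, Function.update_of_ne hz, hk]
  refine ⟨hF, hF.rep_eq _ (fun z => ?_) (fun z hz => ?_)⟩
  · by_cases hz : z = y
    · subst hz
      simp [rep_of_fixed hx, rep_of_fixed hy, hxy]
    · rw [Function.update_of_ne hz, hp.rep_apply]
  · by_cases h : z = y
    · subst h
      simp [hxy] at hz
    · rw [Function.update_of_ne h] at hz
      rw [rep_of_fixed hz, if_neg h]

theorem LinkAll.spec {p p' : V → V} {Z : Finset V} {r : V} (h : LinkAll p Z p' r) (hp : Forest p)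
    (hZ : ∀ z ∈ Z, p z = z) : Forest p' ∧ r ∈ Z ∧
      ∀ x, rep p' x = if rep p x ∈ Z then r else rep p x := by
  induction h with
  | done p x =>
    refine ⟨hp, by simp, fun y => ?_⟩
    by_cases hy : rep p y = x <;> simp [hy]
  | link p Z x y p' r hx hy hxy rest ih =>
    obtain ⟨hF, hrep⟩ := hp.link (hZ x hx) (hZ y hy) hxy
    obtain ⟨h1, h2, h3⟩ := ih hF fun z hz => by
      rw [Function.update_of_ne (Finset.ne_of_mem_erase hz), hZ z (Finset.mem_of_mem_erase hz)]
    refine ⟨h1, Finset.mem_of_mem_erase h2, fun z => ?_⟩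
    rw [h3, hrep]
    by_cases hz : rep p z = y
    · simp [hz, hx, hy, hxy]
    · simp [hz]

theorem LinkAll.exists (p : V → V) {Z : Finset V} (hZ : Z.Nonempty) : ∃ p' r, LinkAll p Z p' r := by
  induction hn : Z.card using Nat.strong_induction_on generalizing p Z with
  | _ n ih =>
    obtain ⟨x, hx⟩ := hZ
    by_cases h : ∃ y ∈ Z, x ≠ y
    · obtain ⟨y, hy, hxy⟩ := h
      obtain ⟨p', r, h⟩ := ih (Z.erase y).card (by rw [← hn]; exact Finset.card_erase_lt_of_mem hy)
        (Function.update p y x) ⟨x, by simp [hx, hxy]⟩ rfl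
      exact ⟨p', r, .link p Z x y p' r hx hy hxy h⟩
    · push Not at h
      have : Z = {x} := by
        ext z
        simp only [Finset.mem_singleton]
        exact ⟨fun hz => (h z hz).symm, fun hz => hz ▸ hx⟩
      exact ⟨p, x, this ▸ .done p x⟩

/-! ### The amortized time of finds with path compression and arbitrary links -/

/-- The vertices in the subtree of `x`. -/
def subtree (p : V → V) (x : V) : Finset V := Finset.univ.filter fun y => ∃ k, p^[k] y = x

theorem mem_subtree {p : V → V} {x y : V} : y ∈ subtree p x ↔ ∃ k, p^[k] y = x := by
  simp [subtree]

theorem self_mem_subtree (p : V → V) (x : V) : x ∈ subtree p x := mem_subtree.2 ⟨0, rfl⟩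

theorem subtree_card_pos (p : V → V) (x : V) : 0 < (subtree p x).card :=
  Finset.card_pos.2 ⟨x, self_mem_subtree p x⟩

/-- The logarithmic potential of a forest. -/
def logSize (p : V → V) : ℝ := ∑ x, Real.log (subtree p x).card

theorem logSize_nonneg (p : V → V) : 0 ≤ logSize p :=
  Finset.sum_nonneg fun x _ => Real.log_nonneg (by exact_mod_cast subtree_card_pos p x)

theorem logSize_id : logSize (id : V → V) = 0 := by
  refine Finset.sum_eq_zero fun x _ => ?_
  have : subtree (id : V → V) x = {x} := by ext y; simp [mem_subtree]
  simp [this]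

/-- Going around the cycle `Fintype.card V` times takes at least `Fintype.card V` steps and so ends
at the root, but it also ends at `x`. -/
theorem iterate_eq_rep_of_periodic {p : V → V} (hp : Forest p) {x : V} {k : ℕ}
    (h : p^[k + 1] x = x) : x = rep p x := by
  have h1 : ∀ n, p^[(k + 1) * n] x = x := fun n => by
    rw [Function.iterate_mul]; exact Function.iterate_fixed h n
  have h2 := iterate_add_eq_of_fixed (k := Fintype.card V) (hp x) (k * Fintype.card V)
  rw [show k * Fintype.card V + Fintype.card V = (k + 1) * Fintype.card V by ring, h1] at h2
  exact h2

/-- Each new pointer is a shortcut along old pointers, so compression creates no descendants. This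
makes every term of `logSize` nonincreasing. -/
theorem Forest.subtree_compress_subset {p : V → V} (hp : Forest p) (x y : V) :
    subtree (StrongMaintenance.compress p x) y ⊆ subtree p y := by
  intro z hz
  obtain ⟨k, hk⟩ := mem_subtree.1 hz
  rw [mem_subtree]
  induction k generalizing z with
  | zero => exact ⟨0, hk⟩
  | succ k ih =>
    rw [Function.iterate_succ_apply] at hk
    obtain ⟨j, hj⟩ := ih (mem_subtree.2 ⟨k, hk⟩) hk
    have : ∃ i, StrongMaintenance.compress p x z = p^[i] z := by
      by_cases h : ∃ k, p^[k] x = z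
      · refine ⟨Fintype.card V, ?_⟩
        rw [compress_of_path h]
        obtain ⟨i, rfl⟩ := h
        exact (hp.rep_iterate x i).symm
      · exact ⟨1, if_neg h⟩
    obtain ⟨i, hi⟩ := this
    exact ⟨j + i, by rw [Function.iterate_add_apply, ← hi, hj]⟩

/-- A vertex on the find path other than `x` and the root loses the whole old subtree of its
predecessor on the path. Inside that subtree a new pointer either stays there or jumps to the root,
so it never meets the next path vertex. -/
theorem Forest.disjoint_subtree_compress {p : V → V} (hp : Forest p) {x : V} {j : ℕ}
    (hj : j + 1 < depth p x) :
    Disjoint (subtree (StrongMaintenance.compress p x) (p^[j + 1] x)) (subtree p (p^[j] x)) := by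
  rw [Finset.disjoint_left]
  intro z hz hz'
  obtain ⟨k, hk⟩ := mem_subtree.1 hz
  have hne : p^[j + 1] x ∉ subtree p (p^[j] x) := by
    intro h
    obtain ⟨i, hi⟩ := mem_subtree.1 h
    rw [Function.iterate_succ_apply', ← Function.iterate_succ_apply] at hi
    have := iterate_eq_rep_of_periodic hp hi
    rw [hp.rep_iterate] at this
    exact iterate_ne_of_lt_depth (by omega) this
  have key : ∀ k, ((StrongMaintenance.compress p x)^[k] z ∈ subtree p (p^[j] x)) ∨
      (StrongMaintenance.compress p x)^[k] z = rep p x := by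
    intro k
    induction k with
    | zero => exact .inl hz'
    | succ k ih =>
      rw [Function.iterate_succ_apply']
      rcases ih with ih | ih
      · set w := (StrongMaintenance.compress p x)^[k] z
        by_cases h : ∃ k, p^[k] x = w
        · exact .inr (compress_of_path h)
        · left
          rw [StrongMaintenance.compress, if_neg h, mem_subtree]
          obtain ⟨i, hi⟩ := mem_subtree.1 ih
          cases i with
          | zero => exact absurd ⟨j, hi.symm⟩ h
          | succ i => exact ⟨i, by rwa [Function.iterate_succ_apply] at hi⟩
      · right
        rw [ih, compress_rep]
  rcases key k with h | h
  · exact hne (hk ▸ h)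
  · exact iterate_ne_of_lt_depth hj (hk ▸ h)

theorem subtree_subset_iterate (p : V → V) (x : V) (j : ℕ) :
    subtree p (p^[j] x) ⊆ subtree p (p^[j + 1] x) := by
  intro z hz
  obtain ⟨k, hk⟩ := mem_subtree.1 hz
  exact mem_subtree.2 ⟨k + 1, by rw [Function.iterate_succ_apply', hk, Function.iterate_succ_apply']⟩

/-- Here `a` and `b` are the old subtree sizes of consecutive vertices on a find path and `c` is the
new size of the later one. If the sizes grow by a factor of at least `k`, the second term is at
least 1. Otherwise `a / b > 1 / k`, and the later vertex loses at least this fraction of its size,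
so the first term is at least 1. -/
theorem one_le_log_step {k a b c : ℝ} (hk : 1 < k) (ha : 0 < a) (hc : 0 < c) (hab : c + a ≤ b) :
    1 ≤ k * (Real.log b - Real.log c) + (Real.log b - Real.log a) / Real.log k := by
  have hb : 0 < b := by linarith
  have hlk := Real.log_pos hk
  have h1 : 0 ≤ Real.log b - Real.log c := sub_nonneg.2 (Real.log_le_log hc (by linarith))
  have h2 : 0 ≤ Real.log b - Real.log a := sub_nonneg.2 (Real.log_le_log ha (by linarith))
  by_cases h : k * a ≤ b
  · have : Real.log k ≤ Real.log b - Real.log a := by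
      rw [← Real.log_div hb.ne' ha.ne']
      exact Real.log_le_log (by linarith) (by rw [le_div_iff₀ ha]; exact h)
    have h3 : 1 ≤ (Real.log b - Real.log a) / Real.log k := by rwa [one_le_div hlk]
    have h4 : 0 ≤ k * (Real.log b - Real.log c) := mul_nonneg (by linarith) h1
    linarith
  · push Not at h
    have h5 : a / b ≤ Real.log b - Real.log c := by
      have := Real.log_le_sub_one_of_pos (div_pos hc hb)
      rw [Real.log_div hc.ne' hb.ne'] at this
      have h6 : c / b + a / b ≤ 1 := by rw [← add_div, div_le_one hb]; exact hab
      linarith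
    have h7 : 1 ≤ k * (a / b) := by
      rw [← mul_div_assoc, one_le_div hb]; exact h.le
    have h8 : k * (a / b) ≤ k * (Real.log b - Real.log c) :=
      mul_le_mul_of_nonneg_left h5 (by linarith)
    have h9 := div_nonneg h2 hlk.le
    linarith

theorem Forest.logSize_compress_le {p : V → V} (hp : Forest p) (x : V) (T : Finset V) :
    logSize (StrongMaintenance.compress p x) + ∑ y ∈ T, (Real.log (subtree p y).card -
      Real.log (subtree (StrongMaintenance.compress p x) y).card) ≤ logSize p := by
  have h : ∑ y ∈ T, (Real.log (subtree p y).card -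
      Real.log (subtree (StrongMaintenance.compress p x) y).card) ≤ ∑ y, (Real.log (subtree p y).card -
      Real.log (subtree (StrongMaintenance.compress p x) y).card) := by
    refine Finset.sum_le_sum_of_subset_of_nonneg (Finset.subset_univ _) fun y _ _ => ?_
    exact sub_nonneg.2 (Real.log_le_log (by exact_mod_cast subtree_card_pos _ y)
      (by exact_mod_cast Finset.card_le_card (hp.subtree_compress_subset x y)))
  simp only [Finset.sum_sub_distrib] at h ⊢
  rw [logSize, logSize]
  linarith

/-- Each inner vertex of the find path pays for one pointer by `one_le_log_step`. The second terms
of that lemma telescope to at most `log N / log k ≤ 4`. The rest of the constant 6 is one unit for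
the remaining pointer and one for the find itself. -/
theorem Forest.depth_compress_le {p : V → V} (hp : Forest p) (x : V) {k N : ℝ} (hk : 1 < k)
    (hN : ∀ y, ((subtree p y).card : ℝ) ≤ N) (hkN : Real.log N ≤ 4 * Real.log k) :
    ((depth p x + 1 : ℕ) : ℝ) + k * logSize (StrongMaintenance.compress p x) ≤
      6 + k * logSize p := by
  set p' := StrongMaintenance.compress p x with hp'
  set d := depth p x with hd
  set g : ℕ → ℝ := fun j => Real.log (subtree p (p^[j] x)).card with hg
  have hlk := Real.log_pos hk
  have h1 : ∀ j ∈ Finset.range (d - 1), (1 : ℝ) ≤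
      k * (g (j + 1) - Real.log (subtree p' (p^[j + 1] x)).card)
        + (g (j + 1) - g j) / Real.log k := by
    intro j hj
    have hj' : j + 1 < d := by have := Finset.mem_range.1 hj; omega
    refine one_le_log_step hk (by exact_mod_cast subtree_card_pos _ _)
      (by exact_mod_cast subtree_card_pos _ _) ?_
    have := Finset.card_union_of_disjoint (hp.disjoint_subtree_compress hj')
    have h2 := Finset.card_le_card (Finset.union_subset
      (hp.subtree_compress_subset x (p^[j + 1] x)) (subtree_subset_iterate p x j))
    rw [this] at h2
    exact_mod_cast h2
  have h2 := Finset.sum_le_sum h1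
  rw [Finset.sum_add_distrib, ← Finset.sum_div, Finset.sum_range_sub, ← Finset.mul_sum] at h2
  simp only [Finset.sum_const, Finset.card_range, nsmul_eq_mul, mul_one] at h2
  have h3 : (g (d - 1) - g 0) / Real.log k ≤ 4 := by
    rw [div_le_iff₀ hlk]
    have e1 : g (d - 1) ≤ Real.log N :=
      Real.log_le_log (by exact_mod_cast subtree_card_pos _ _) (hN _)
    have e2 : 0 ≤ g 0 := Real.log_nonneg (by exact_mod_cast subtree_card_pos _ _)
    linarith
  have h4 := hp.logSize_compress_le x ((Finset.range (d - 1)).image fun j => p^[j + 1] x)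
  rw [Finset.sum_image] at h4
  · have h5 : k * (logSize p' + ∑ j ∈ Finset.range (d - 1),
        (g (j + 1) - Real.log (subtree p' (p^[j + 1] x)).card)) ≤ k * logSize p :=
      mul_le_mul_of_nonneg_left h4 (by linarith)
    have h6 : (d : ℝ) ≤ ((d - 1 : ℕ) : ℝ) + 1 := by
      have : d ≤ (d - 1) + 1 := by omega
      exact_mod_cast this
    push_cast
    linarith
  · intro i hi j hj hij
    have hi' := Finset.mem_range.1 hi
    have hj' := Finset.mem_range.1 hj
    have := iterate_injOn_depth p x (x₁ := i + 1) (x₂ := j + 1) (by simp; omega) (by simp; omega) hij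
    omega

theorem Forest.finds_le {p : V → V} (hp : Forest p) (xs : List V) {k N : ℝ} (hk : 1 < k)
    (hN : ∀ y, ((subtree p y).card : ℝ) ≤ N) (hkN : Real.log N ≤ 4 * Real.log k) :
    ((StrongMaintenance.finds p xs).2 : ℝ) + k * logSize (StrongMaintenance.finds p xs).1 ≤
      6 * xs.length + k * logSize p := by
  induction xs generalizing p with
  | nil => simp [StrongMaintenance.finds]
  | cons x xs ih =>
    have h1 := hp.depth_compress_le x hk hN hkN
    have h2 := ih (hp.compress x) fun y => le_trans
      (by exact_mod_cast Finset.card_le_card (hp.subtree_compress_subset x y)) (hN y)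
    simp only [StrongMaintenance.finds, List.length_cons]
    push_cast at h1 ⊢
    linarith

theorem Forest.subtree_link_subset {p : V → V} {x y z : V} (hx : p x = x)
    (hxy : x ≠ y) (hz : z ≠ x) : subtree (Function.update p y x) z ⊆ subtree p z := by
  intro v hv
  obtain ⟨k, hk⟩ := mem_subtree.1 hv
  rw [mem_subtree]
  induction k generalizing v with
  | zero => exact ⟨0, hk⟩
  | succ k ih =>
    rw [Function.iterate_succ_apply] at hk
    by_cases h : v = y
    · subst h
      rw [Function.update_self, Function.iterate_fixed
        (show Function.update p v x x = x by rw [Function.update_of_ne hxy, hx])] at hk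
      exact absurd hk.symm hz
    · rw [Function.update_of_ne h] at hk
      obtain ⟨j, hj⟩ := ih (mem_subtree.2 ⟨k, hk⟩) hk
      exact ⟨j + 1, by rwa [Function.iterate_succ_apply]⟩

theorem Forest.subtree_subset {p : V → V} (hp : Forest p) (x : V) :
    subtree p x ⊆ Finset.univ.filter fun y => rep p y = rep p x := by
  intro y hy
  obtain ⟨k, rfl⟩ := mem_subtree.1 hy
  simp [hp.rep_iterate]

/-- Only the subtree of the new root `x` grows, and it stays within the union of the two sets. -/
theorem Forest.logSize_link {p : V → V} (hp : Forest p) {x y : V} (hx : p x = x) (hy : p y = y)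
    (hxy : x ≠ y) {N : ℝ}
    (hN : ((Finset.univ.filter fun z => rep p z = x ∨ rep p z = y).card : ℝ) ≤ N) :
    logSize (Function.update p y x) ≤ logSize p + Real.log N := by
  obtain ⟨hF, hrep⟩ := hp.link hx hy hxy
  rw [logSize, logSize, ← Finset.add_sum_erase _ _ (Finset.mem_univ x),
    ← Finset.add_sum_erase _ (fun z => Real.log (subtree p z).card) (Finset.mem_univ x)]
  have h1 : Real.log (subtree (Function.update p y x) x).card ≤ Real.log N := by
    refine Real.log_le_log (by exact_mod_cast subtree_card_pos _ _) (le_trans ?_ hN)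
    norm_cast
    refine Finset.card_le_card ((hF.subtree_subset x).trans fun z hz => ?_)
    simp only [Finset.mem_filter, Finset.mem_univ, true_and, hrep, rep_of_fixed hx,
      if_neg hxy] at hz ⊢
    by_cases h : rep p z = y
    · exact .inr h
    · rw [if_neg h] at hz; exact .inl hz
  have h2 : ∑ z ∈ Finset.univ.erase x, Real.log (subtree (Function.update p y x) z).card ≤
      ∑ z ∈ Finset.univ.erase x, Real.log (subtree p z).card := by
    refine Finset.sum_le_sum fun z hz => Real.log_le_log (by exact_mod_cast subtree_card_pos _ _) ?_
    exact_mod_cast Finset.card_le_card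
      (Forest.subtree_link_subset hx hxy (Finset.ne_of_mem_erase hz))
  have h3 : 0 ≤ Real.log (subtree p x).card :=
    Real.log_nonneg (by exact_mod_cast subtree_card_pos p x)
  linarith

/-- Combining `Z` takes `Z.card - 1` links. The term `Real.log N` on the left stands for the missing
one. -/
theorem LinkAll.logSize_le {p p' : V → V} {Z : Finset V} {r : V} (h : LinkAll p Z p' r)
    (hp : Forest p) (hZ : ∀ z ∈ Z, p z = z) {N : ℝ}
    (hN : ((Finset.univ.filter fun x => rep p x ∈ Z).card : ℝ) ≤ N) :
    logSize p' + Real.log N ≤ logSize p + Z.card * Real.log N := by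
  induction h with
  | done p x => simp
  | link p Z x y p' r hx hy hxy rest ih =>
    obtain ⟨hF, hrep⟩ := hp.link (hZ x hx) (hZ y hy) hxy
    have h1 := ih hF (fun z hz => by
      rw [Function.update_of_ne (Finset.ne_of_mem_erase hz), hZ z (Finset.mem_of_mem_erase hz)])
      (le_trans (by
        norm_cast
        refine Finset.card_le_card fun z hz => ?_
        simp only [Finset.mem_filter, Finset.mem_univ, true_and, hrep] at hz ⊢
        by_cases h : rep p z = y
        · rw [h]; exact hy
        · rw [if_neg h] at hz; exact Finset.mem_of_mem_erase hz) hN)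
    have h2 := hp.logSize_link (hZ x hx) (hZ y hy) hxy (N := N) (le_trans (by
        norm_cast
        refine Finset.card_le_card fun z hz => ?_
        simp only [Finset.mem_filter, Finset.mem_univ, true_and] at hz ⊢
        rcases hz with h | h <;> rw [h] <;> assumption) hN)
    have h3 : (Z.card : ℝ) = (Z.erase y).card + 1 := by
      rw [← Finset.card_erase_add_one hy]; push_cast; ring
    rw [h3]
    linarith

end Forests

/-! ### Reachability, pairs in lists, and the invariants of the stored data. -/

section Graphs

variable {V : Type u} [Fintype V] {m : ℕ} {a : Fin m → V × V}

theorem Reach.refl (k : ℕ) (x : V) : Reach a k x x := ReflTransGen.refl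

theorem Reach.trans {k : ℕ} {x y z : V} (h : Reach a k x y) (h' : Reach a k y z) :
    Reach a k x z := ReflTransGen.trans h h'

theorem Reach.mono {k l : ℕ} (hkl : k ≤ l) {x y : V} (h : Reach a k x y) : Reach a l x y :=
  ReflTransGen.mono (fun _ _ ⟨j, hj, e⟩ => ⟨j, hj.trans_le hkl, e⟩) _ _ h

theorem Reach.arc {k : ℕ} {j : Fin m} (h : j.val < k) : Reach a k (a j).1 (a j).2 :=
  ReflTransGen.single ⟨j, h, rfl⟩

theorem reach_zero {x y : V} : Reach a 0 x y ↔ x = y := by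
  refine ⟨fun h => ?_, fun h => h ▸ Reach.refl _ _⟩
  induction h with
  | refl => rfl
  | tail _ h _ => obtain ⟨j, hj, _⟩ := h; omega

/-- A path that uses arc `i` can be cut before its first use of `i` and after its last one. -/
theorem reach_succ (i : Fin m) {x y : V} : Reach a (i.val + 1) x y ↔
    Reach a i.val x y ∨ (Reach a i.val x (a i).1 ∧ Reach a i.val (a i).2 y) := by
  constructor
  · intro h
    induction h with
    | refl => exact .inl (Reach.refl _ _)
    | @tail b c _ hbc ih =>
      obtain ⟨j, hj, e⟩ := hbc
      by_cases hji : j.val < i.val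
      · have hbc : Reach a i.val b c := by simpa [e] using Reach.arc (a := a) hji
        rcases ih with ih | ⟨h1, h2⟩
        · exact .inl (ih.trans hbc)
        · exact .inr ⟨h1, h2.trans hbc⟩
      · obtain rfl : j = i := Fin.ext (by omega)
        rw [e]
        rcases ih with ih | ⟨h1, h2⟩
        · exact .inr ⟨ih, Reach.refl _ _⟩
        · rw [e] at h1
          exact .inr ⟨h1, Reach.refl _ _⟩
  · rintro (h | ⟨h1, h2⟩)
    · exact h.mono (Nat.le_succ _)
    · exact ((h1.mono (Nat.le_succ _)).trans (Reach.arc (Nat.lt_succ_self _))).trans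
        (h2.mono (Nat.le_succ _))

/-- Relative position is expressed by two-element sublists because these pass directly through
appending and filtering, unlike indices. Membership of `y` is needed because the index of an absent
element is the length of the list. -/
theorem pair_sublist_iff {α : Type u} {L : List α} (hL : L.Nodup) {x y : α} :
    [x, y].Sublist L ↔ L.idxOf x < L.idxOf y ∧ y ∈ L := by
  induction L with
  | nil => simp
  | cons b L ih =>
    obtain ⟨hb, hL⟩ := List.nodup_cons.1 hL
    have ih := ih hL
    by_cases hxb : b = x
    · subst hxb
      rw [List.cons_sublist_cons, List.singleton_sublist]
      by_cases hy : b = y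
      · subst hy; simp [hb]
      · simp [List.idxOf_cons_ne _ hy, Ne.symm hy]
    · by_cases hy : b = y
      · subst hy
        simp only [List.idxOf_cons_self, not_lt_zero, false_and, iff_false]
        intro h
        cases h with
        | cons _ h => exact hb (h.subset (by simp))
        | cons_cons => exact hxb rfl
      · rw [List.idxOf_cons_ne _ hxb, List.idxOf_cons_ne _ hy, Nat.succ_lt_succ_iff,
          List.mem_cons, or_iff_right (Ne.symm hy), ← ih]
        refine ⟨fun h => ?_, fun h => h.cons _⟩
        cases h with
        | cons _ h => exact h
        | cons_cons => exact absurd rfl hxb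

theorem pair_sublist_append {α : Type u} {U W : List α} {x y : α} (hx : x ∈ U) (hy : y ∈ W) :
    [x, y].Sublist (U ++ W) :=
  (List.singleton_sublist.2 hx).append (List.singleton_sublist.2 hy)

theorem pair_sublist_left {α : Type u} {U W : List α} (h : (U ++ W).Nodup) {x y : α}
    (hxy : [x, y].Sublist (U ++ W)) (hx : x ∈ U) (hy : y ∈ U) : [x, y].Sublist U := by
  rw [pair_sublist_iff (List.Nodup.of_append_left h)]
  have := (pair_sublist_iff h).1 hxy
  rw [List.idxOf_append_of_mem hx, List.idxOf_append_of_mem hy] at this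
  exact ⟨this.1, hy⟩

theorem pair_sublist_right {α : Type u} {U W : List α} (h : (U ++ W).Nodup) {x y : α}
    (hxy : [x, y].Sublist (U ++ W)) (hx : x ∈ W) (hy : y ∈ W) : [x, y].Sublist W := by
  rw [pair_sublist_iff (List.Nodup.of_append_right h)]
  have := (pair_sublist_iff h).1 hxy
  have hd := List.disjoint_of_nodup_append h
  rw [List.idxOf_append_of_notMem fun h => hd h hx, List.idxOf_append_of_notMem fun h => hd h hy]
    at this
  exact ⟨by omega, hy⟩

/-- The data is correct for the graph of the first `k` arcs, while the arc sets represent the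
first `n` arcs. -/
structure Sound (a : Fin m → V × V) (k n : ℕ) (d : Data V m) : Prop where
  forest : Forest d.parent
  component : ∀ x y, rep d.parent x = rep d.parent y ↔ Reach a k x y ∧ Reach a k y x
  nodup : d.order.Nodup
  mem_order : ∀ x, x ∈ d.order ↔ rep d.parent x = x
  topological : ∀ j : Fin m, j.val < k → d.tail a j ≠ d.head a j → d.lt (d.tail a j) (d.head a j)
  of_mem_out : ∀ x, rep d.parent x = x → ∀ j ∈ d.out x, j.val < n ∧ d.tail a j = x
  of_mem_inc : ∀ x, rep d.parent x = x → ∀ j ∈ d.inc x, j.val < n ∧ d.head a j = x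
  mem_out : ∀ j : Fin m, j.val < n → d.tail a j ≠ d.head a j → j ∈ d.out (d.tail a j)
  mem_inc : ∀ j : Fin m, j.val < n → d.tail a j ≠ d.head a j → j ∈ d.inc (d.head a j)

theorem correct_iff {k : ℕ} {d : Data V m} : Correct a k d ↔ Sound a k k d := by
  constructor
  · intro h
    have hF : Forest d.parent := h.root
    refine ⟨hF, h.component, h.nodup, fun x => ?_, h.topological, fun x hx => ?_, fun x hx => ?_,
      h.mem_out, h.mem_inc⟩
    · rw [h.mem_order, hF.rep_eq_self]
    · exact h.of_mem_out x (hF.rep_eq_self.1 hx)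
    · exact h.of_mem_inc x (hF.rep_eq_self.1 hx)
  · intro h
    refine ⟨h.forest, h.component, h.nodup, fun x => ?_, h.topological, fun x hx => ?_,
      fun x hx => ?_, h.mem_out, h.mem_inc⟩
    · rw [h.mem_order, h.forest.rep_eq_self]
    · exact h.of_mem_out x (rep_of_fixed hx)
    · exact h.of_mem_inc x (rep_of_fixed hx)

theorem correct_empty {o : List V} (ho : o.Nodup) (ho' : ∀ x, x ∈ o) :
    Correct a 0 (Data.empty o) := by
  have h : ∀ x : V, rep id x = x := fun x => rep_of_fixed rfl
  rw [correct_iff]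
  refine ⟨fun x => rfl, fun x y => ?_, ho, fun x => ?_, ?_, ?_, ?_, ?_, ?_⟩
  · simp only [Data.empty, h, reach_zero]
    exact ⟨fun e => ⟨e, e.symm⟩, fun e => e.1⟩
  · simp [Data.empty, h, ho']
  all_goals simp [Data.empty]

namespace Sound

variable {k n : ℕ} {d : Data V m} (hd : Sound a k n d)
include hd

theorem rep_examine (es : List (Fin m)) : rep (d.examine a es).parent = rep d.parent :=
  (hd.forest.finds _).2

theorem tail_examine (es : List (Fin m)) (e : Fin m) : (d.examine a es).tail a e = d.tail a e :=
  congrFun (hd.rep_examine es) _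

theorem head_examine (es : List (Fin m)) (e : Fin m) : (d.examine a es).head a e = d.head a e :=
  congrFun (hd.rep_examine es) _

theorem examine (es : List (Fin m)) : Sound a k n (d.examine a es) := by
  have h := hd.rep_examine es
  have ht := hd.tail_examine es
  have hh := hd.head_examine es
  refine ⟨(hd.forest.finds _).1, ?_, hd.nodup, ?_, ?_, ?_, ?_, ?_, ?_⟩
  · rw [h]; exact hd.component
  · rw [h]; exact hd.mem_order
  · simp only [ht, hh]; exact hd.topological
  · simp only [ht, h]; exact hd.of_mem_out
  · simp only [hh, h]; exact hd.of_mem_inc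
  · simp only [ht, hh]; exact hd.mem_out
  · simp only [ht, hh]; exact hd.mem_inc

theorem dropOut {e : Fin m} (u : V) (he : d.IsLoop a e) : Sound a k n (d.dropOut u e) := by
  refine ⟨hd.forest, hd.component, hd.nodup, hd.mem_order, hd.topological, fun x hx j hj => ?_,
    hd.of_mem_inc, fun j hj hl => ?_, hd.mem_inc⟩
  · refine hd.of_mem_out x hx j ?_
    simp only [Data.dropOut] at hj
    by_cases h : x = u
    · subst h
      rw [Function.update_self] at hj
      exact Finset.mem_of_mem_erase hj
    · rwa [Function.update_of_ne h] at hj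
  · have h1 := hd.mem_out j hj hl
    have hje : j ≠ e := fun h => hl (h ▸ he)
    change j ∈ Function.update d.out u ((d.out u).erase e) (d.tail a j)
    by_cases h : d.tail a j = u
    · rw [h] at h1 ⊢
      rw [Function.update_self]
      exact Finset.mem_erase.2 ⟨hje, h1⟩
    · rwa [Function.update_of_ne h]

theorem dropInc {e : Fin m} (u : V) (he : d.IsLoop a e) : Sound a k n (d.dropInc u e) := by
  refine ⟨hd.forest, hd.component, hd.nodup, hd.mem_order, hd.topological, hd.of_mem_out,
    fun x hx j hj => ?_, hd.mem_out, fun j hj hl => ?_⟩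
  · refine hd.of_mem_inc x hx j ?_
    simp only [Data.dropInc] at hj
    by_cases h : x = u
    · subst h
      rw [Function.update_self] at hj
      exact Finset.mem_of_mem_erase hj
    · rwa [Function.update_of_ne h] at hj
  · have h1 := hd.mem_inc j hj hl
    have hje : j ≠ e := fun h => hl (h ▸ he)
    change j ∈ Function.update d.inc u ((d.inc u).erase e) (d.head a j)
    by_cases h : d.head a j = u
    · rw [h] at h1 ⊢
      rw [Function.update_self]
      exact Finset.mem_erase.2 ⟨hje, h1⟩
    · rwa [Function.update_of_ne h]

theorem rep_rep (x : V) : rep d.parent (rep d.parent x) = rep d.parent x := hd.forest.rep_rep x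

theorem rep_mem_order (x : V) : rep d.parent x ∈ d.order := (hd.mem_order _).2 (hd.rep_rep x)

theorem reach_rep (x : V) : Reach a k x (rep d.parent x) :=
  ((hd.component _ _).1 (hd.rep_rep x)).2

theorem rep_reach (x : V) : Reach a k (rep d.parent x) x :=
  ((hd.component _ _).1 (hd.rep_rep x)).1

theorem idxOf_inj {x y : V} (hx : rep d.parent x = x) (h : d.order.idxOf x = d.order.idxOf y) :
    x = y := (List.idxOf_inj ((hd.mem_order x).2 hx)).1 h

theorem rep_le_of_reach {x y : V} (h : Reach a k x y) :
    d.le (rep d.parent x) (rep d.parent y) := by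
  induction h with
  | refl => exact le_refl _
  | @tail b c _ hbc ih =>
    refine le_trans ih ?_
    obtain ⟨j, hj, e⟩ := hbc
    have h1 : rep d.parent b = d.tail a j := by simp [Data.tail, e]
    have h2 : rep d.parent c = d.head a j := by simp [Data.head, e]
    rw [h1, h2]
    by_cases h : d.tail a j = d.head a j
    · rw [h]
    · exact (hd.topological j hj h).le

end Sound

theorem Sound.rep_addArc {k n : ℕ} {d : Data V m} (hd : Sound a k n d) (i : Fin m) :
    rep (d.addArc a i).parent = rep d.parent := (hd.forest.finds _).2

theorem Sound.tail_addArc {k n : ℕ} {d : Data V m} (hd : Sound a k n d) (i e : Fin m) :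
    (d.addArc a i).tail a e = d.tail a e := congrFun (hd.rep_addArc i) _

theorem Sound.head_addArc {k n : ℕ} {d : Data V m} (hd : Sound a k n d) (i e : Fin m) :
    (d.addArc a i).head a e = d.head a e := congrFun (hd.rep_addArc i) _

theorem Sound.addArc {i : Fin m} {d : Data V m} (hd : Sound a i.val i.val d) :
    Sound a i.val (i.val + 1) (d.addArc a i) := by
  have h := hd.rep_addArc i
  have ht := hd.tail_addArc i
  have hh := hd.head_addArc i
  refine ⟨(hd.forest.finds _).1, ?_, hd.nodup, ?_, ?_, ?_, ?_, ?_, ?_⟩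
  · rw [h]; exact hd.component
  · rw [h]; exact hd.mem_order
  · simp only [ht, hh]; exact hd.topological
  · simp only [ht, h]
    intro x hx j hj
    simp only [Data.addArc] at hj
    by_cases hxi : x = d.tail a i
    · subst hxi
      rw [Function.update_self, Finset.mem_insert] at hj
      rcases hj with rfl | hj
      · exact ⟨Nat.lt_succ_self _, rfl⟩
      · have := hd.of_mem_out _ hx j hj
        exact ⟨by omega, this.2⟩
    · rw [Function.update_of_ne hxi] at hj
      have := hd.of_mem_out _ hx j hj
      exact ⟨by omega, this.2⟩
  · simp only [hh, h]
    intro x hx j hj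
    simp only [Data.addArc] at hj
    by_cases hxi : x = d.head a i
    · subst hxi
      rw [Function.update_self, Finset.mem_insert] at hj
      rcases hj with rfl | hj
      · exact ⟨Nat.lt_succ_self _, rfl⟩
      · have := hd.of_mem_inc _ hx j hj
        exact ⟨by omega, this.2⟩
    · rw [Function.update_of_ne hxi] at hj
      have := hd.of_mem_inc _ hx j hj
      exact ⟨by omega, this.2⟩
  · simp only [ht, hh]
    intro j hj hl
    simp only [Data.addArc]
    rcases Nat.lt_succ_iff_lt_or_eq.1 hj with hj | hj
    · by_cases hxi : d.tail a j = d.tail a i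
      · have := hd.mem_out j hj hl
        rw [hxi] at this ⊢
        rw [Function.update_self]
        exact Finset.mem_insert_of_mem this
      · rw [Function.update_of_ne hxi]
        exact hd.mem_out j hj hl
    · obtain rfl := Fin.ext hj
      simp
  · simp only [ht, hh]
    intro j hj hl
    simp only [Data.addArc]
    rcases Nat.lt_succ_iff_lt_or_eq.1 hj with hj | hj
    · by_cases hxi : d.head a j = d.head a i
      · have := hd.mem_inc j hj hl
        rw [hxi] at this ⊢
        rw [Function.update_self]
        exact Finset.mem_insert_of_mem this
      · rw [Function.update_of_ne hxi]
        exact hd.mem_inc j hj hl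
    · obtain rfl := Fin.ext hj
      simp

/-- An old path from the head to the tail would force the two components to coincide, since the head
is not less than the tail. So either the new arc is a loop or it closes no cycle, and the components
stay the same. If it is not a loop, it agrees with the order. -/
theorem Sound.quiet {i : Fin m} {d : Data V m} (hd : Sound a i.val (i.val + 1) d)
    (h : ¬ d.lt (d.head a i) (d.tail a i)) : Sound a (i.val + 1) (i.val + 1) d := by
  have key : Reach a i.val (a i).2 (a i).1 → Reach a i.val (a i).1 (a i).2 := by
    intro hr
    have h1 := hd.rep_le_of_reach hr
    have h2 : rep d.parent (a i).2 = rep d.parent (a i).1 := by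
      refine hd.idxOf_inj (hd.rep_rep _) ?_
      simp only [Data.lt, Data.le, Data.head, Data.tail] at h h1
      omega
    exact ((hd.component _ _).1 h2).2
  refine ⟨hd.forest, fun x y => ?_, hd.nodup, hd.mem_order, fun j hj hl => ?_, hd.of_mem_out,
    hd.of_mem_inc, hd.mem_out, hd.mem_inc⟩
  · rw [hd.component, reach_succ, reach_succ]
    constructor
    · exact fun h => ⟨.inl h.1, .inl h.2⟩
    · rintro ⟨h1 | ⟨h1, h2⟩, h3 | ⟨h3, h4⟩⟩
      · exact ⟨h1, h3⟩
      · exact ⟨h1, (h3.trans (key (h4.trans (h1.trans h3)))).trans h4⟩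
      · exact ⟨(h1.trans (key (h2.trans (h3.trans h1)))).trans h2, h3⟩
      · exact ⟨(h1.trans (key (h4.trans h1))).trans h2, (h3.trans (key (h4.trans h1))).trans h4⟩
  · rcases Nat.lt_succ_iff_lt_or_eq.1 hj with hj | hj
    · exact hd.topological j hj hl
    · obtain rfl := Fin.ext hj
      have : d.order.idxOf (d.tail a j) ≠ d.order.idxOf (d.head a j) := fun e =>
        hl (hd.idxOf_inj (hd.rep_rep _) e)
      simp only [Data.lt] at h ⊢
      omega

/-! ### Bidirectional search: what is known when it stops. -/

/-- The invariant of a bidirectional search for arc `i`. -/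
structure Searching (a : Fin m → V × V) (i : Fin m) (d : Data V m) (S : Search V m) : Prop where
  sound : Sound a i.val (i.val + 1) d
  gt : d.lt (d.head a i) (d.tail a i)
  head_mem : d.head a i ∈ S.F
  tail_mem : d.tail a i ∈ S.R
  F : ∀ x ∈ S.F, rep d.parent x = x ∧ Reach a i.val (a i).2 x
  R : ∀ y ∈ S.R, rep d.parent y = y ∧ Reach a i.val y (a i).1
  trF : ∀ e ∈ S.trF, e.val < i.val + 1 ∧ d.tail a e ≠ d.head a e ∧ d.tail a e ∈ S.F ∧
    d.head a e ∈ S.F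
  trB : ∀ e ∈ S.trB, e.val < i.val + 1 ∧ d.tail a e ≠ d.head a e ∧ d.tail a e ∈ S.R ∧
    d.head a e ∈ S.R

/-- The search has stopped at `s`, where `X` and `Y` are the vertices that have to be moved. -/
structure Stopped (d : Data V m) (S : Search V m) (X Y : Finset V) (s : V) : Prop where
  mem : s ∈ d.order
  mem_X : ∀ x, x ∈ X ↔ x ∈ S.F ∧ d.lt x s
  mem_Y : ∀ y, y ∈ Y ↔ y ∈ S.R ∧ d.lt s y
  out : ∀ x ∈ X, d.out x ⊆ S.trF
  inc : ∀ y ∈ Y, d.inc y ⊆ S.trB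

theorem Search.Stop.stopped {d : Data V m} {S : Search V m} {s : V} {X Y : Finset V}
    (h : S.Stop d s) (hX : ∀ x, x ∈ X ↔ x ∈ S.F ∧ d.lt x s)
    (hY : ∀ y, y ∈ Y ↔ y ∈ S.R ∧ d.lt s y) : Stopped d S X Y s :=
  ⟨h.1, hX, hY, fun x hx => h.2.1 x ((hX x).1 hx).1 ((hX x).1 hx).2,
    fun y hy => h.2.2 y ((hY y).1 hy).1 ((hY y).1 hy).2⟩

theorem Sound.searching_start {i : Fin m} {d : Data V m} (hd : Sound a i.val (i.val + 1) d)
    (h : d.lt (d.head a i) (d.tail a i)) :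
    Searching a i d (Search.start (d.tail a i) (d.head a i)) := by
  refine ⟨hd, h, by simp [Search.start], by simp [Search.start], ?_, ?_, by simp [Search.start],
    by simp [Search.start]⟩
  · intro x hx
    obtain rfl : x = d.head a i := by simpa [Search.start] using hx
    exact ⟨hd.rep_rep _, hd.reach_rep _⟩
  · intro x hx
    obtain rfl : x = d.tail a i := by simpa [Search.start] using hx
    exact ⟨hd.rep_rep _, hd.rep_reach _⟩

namespace Searching

variable {i : Fin m} {d : Data V m} {S : Search V m} (hS : Searching a i d S)
include hS

theorem examine (es : List (Fin m)) : Searching a i (d.examine a es) S := by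
  have h := hS.sound.rep_examine es
  have ht := hS.sound.tail_examine es
  have hh := hS.sound.head_examine es
  refine ⟨hS.sound.examine es, ?_, ?_, ?_, ?_, ?_, ?_, ?_⟩
  · rw [ht, hh]; exact hS.gt
  · rw [hh]; exact hS.head_mem
  · rw [ht]; exact hS.tail_mem
  · rw [h]; exact hS.F
  · rw [h]; exact hS.R
  · simp only [ht, hh]; exact hS.trF
  · simp only [ht, hh]; exact hS.trB

theorem dropOut {e : Fin m} (u : V) (he : d.IsLoop a e) : Searching a i (d.dropOut u e) S :=
  ⟨hS.sound.dropOut u he, hS.gt, hS.head_mem, hS.tail_mem, hS.F, hS.R, hS.trF, hS.trB⟩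

theorem dropInc {e : Fin m} (u : V) (he : d.IsLoop a e) : Searching a i (d.dropInc u e) S :=
  ⟨hS.sound.dropInc u he, hS.gt, hS.head_mem, hS.tail_mem, hS.F, hS.R, hS.trF, hS.trB⟩

theorem isLoop_examine {e : Fin m} {es : List (Fin m)} (h : d.IsLoop a e) :
    (d.examine a es).IsLoop a e := by
  have : (d.examine a es).tail a e = (d.examine a es).head a e := by
    rw [hS.sound.tail_examine, hS.sound.head_examine]
    exact h
  exact this

/-- The general search may traverse the new arc `i` itself. Its head is the start of the forward
search, so forward vertices are nevertheless reachable by old arcs alone. -/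
theorem traverse_out {u : V} {e : Fin m} (hu : u ∈ S.F) (he : e ∈ d.out u)
    (hl : ¬ d.IsLoop a e) :
    Searching a i d { S with F := insert (d.head a e) S.F, trF := insert e S.trF } := by
  obtain ⟨he1, he2⟩ := hS.sound.of_mem_out u (hS.F u hu).1 e he
  refine ⟨hS.sound, hS.gt, Finset.mem_insert_of_mem hS.head_mem, hS.tail_mem, ?_, hS.R, ?_, hS.trB⟩
  · intro x hx
    rcases Finset.mem_insert.1 hx with rfl | hx
    · refine ⟨hS.sound.rep_rep _, ?_⟩
      rcases Nat.lt_succ_iff_lt_or_eq.1 he1 with h | h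
      · have h1 : Reach a i.val u (a e).1 := by
          rw [← he2]; exact hS.sound.rep_reach _
        exact (((hS.F u hu).2.trans h1).trans (Reach.arc h)).trans (hS.sound.reach_rep _)
      · obtain rfl := Fin.ext h
        exact hS.sound.reach_rep _
    · exact hS.F x hx
  · intro f hf
    rcases Finset.mem_insert.1 hf with rfl | hf
    · exact ⟨he1, hl, Finset.mem_insert_of_mem (he2 ▸ hu), Finset.mem_insert_self _ _⟩
    · obtain ⟨h1, h2, h3, h4⟩ := hS.trF f hf
      exact ⟨h1, h2, Finset.mem_insert_of_mem h3, Finset.mem_insert_of_mem h4⟩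

theorem traverse_inc {z : V} {e : Fin m} (hz : z ∈ S.R) (he : e ∈ d.inc z)
    (hl : ¬ d.IsLoop a e) :
    Searching a i d { S with R := insert (d.tail a e) S.R, trB := insert e S.trB } := by
  obtain ⟨he1, he2⟩ := hS.sound.of_mem_inc z (hS.R z hz).1 e he
  refine ⟨hS.sound, hS.gt, hS.head_mem, Finset.mem_insert_of_mem hS.tail_mem, hS.F, ?_, hS.trF, ?_⟩
  · intro x hx
    rcases Finset.mem_insert.1 hx with rfl | hx
    · refine ⟨hS.sound.rep_rep _, ?_⟩
      rcases Nat.lt_succ_iff_lt_or_eq.1 he1 with h | h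
      · have h1 : Reach a i.val (a e).2 z := by
          rw [← he2]; exact hS.sound.reach_rep _
        exact (((hS.sound.rep_reach _).trans (Reach.arc h)).trans h1).trans (hS.R z hz).2
      · obtain rfl := Fin.ext h
        exact hS.sound.rep_reach _
    · exact hS.R x hx
  · intro f hf
    rcases Finset.mem_insert.1 hf with rfl | hf
    · exact ⟨he1, hl, Finset.mem_insert_self _ _, Finset.mem_insert_of_mem (he2 ▸ hz)⟩
    · obtain ⟨h1, h2, h3, h4⟩ := hS.trB f hf
      exact ⟨h1, h2, Finset.mem_insert_of_mem h3, Finset.mem_insert_of_mem h4⟩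

variable {X Y : Finset V} {s : V} (hT : Stopped d S X Y s)
include hT

theorem trF_of_lt {j : Fin m} (hj : j.val < i.val + 1) (hl : d.tail a j ≠ d.head a j)
    (hF : d.tail a j ∈ S.F) (hs : d.lt (d.tail a j) s) : j ∈ S.trF :=
  hT.out _ ((hT.mem_X _).2 ⟨hF, hs⟩) (hS.sound.mem_out j hj hl)

theorem trB_of_lt {j : Fin m} (hj : j.val < i.val + 1) (hl : d.tail a j ≠ d.head a j)
    (hR : d.head a j ∈ S.R) (hs : d.lt s (d.head a j)) : j ∈ S.trB :=
  hT.inc _ ((hT.mem_Y _).2 ⟨hR, hs⟩) (hS.sound.mem_inc j hj hl)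

/-- Whenever the path moves on to another component, the component that it leaves is less than `s`,
since positions increase up to `z`. Being forward, it has been scanned, so the arc has been
traversed. -/
theorem mem_F_of_reach {x z : V} (hx : rep d.parent x ∈ S.F) (h : Reach a i.val x z)
    (hz : d.le (rep d.parent z) s) : rep d.parent z ∈ S.F := by
  induction h with
  | refl => exact hx
  | @tail b c _ hbc ih =>
    obtain ⟨j, hj, e⟩ := hbc
    have h1 : rep d.parent b = d.tail a j := by simp [Data.tail, e]
    have h2 : rep d.parent c = d.head a j := by simp [Data.head, e]
    rw [h1] at ih
    rw [h2] at hz ⊢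
    by_cases h : d.tail a j = d.head a j
    · rw [← h]; exact ih (h ▸ hz)
    · have h3 := hS.sound.topological j hj h
      simp only [Data.lt, Data.le] at h3 hz ih
      exact (hS.trF j (hS.trF_of_lt hT (by omega) h (ih (by omega))
        (by simp only [Data.lt]; omega))).2.2.2

theorem mem_R_of_reach {y z : V} (hy : rep d.parent y ∈ S.R) (h : Reach a i.val z y)
    (hz : d.le s (rep d.parent z)) : rep d.parent z ∈ S.R := by
  unfold Reach at h
  induction h using ReflTransGen.head_induction_on with
  | refl => exact hy
  | @head b c hbc _ ih =>
    obtain ⟨j, hj, e⟩ := hbc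
    have h1 : rep d.parent b = d.tail a j := by simp [Data.tail, e]
    have h2 : rep d.parent c = d.head a j := by simp [Data.head, e]
    rw [h2] at ih
    rw [h1] at hz ⊢
    by_cases h : d.tail a j = d.head a j
    · rw [h]; exact ih (h ▸ hz)
    · have h3 := hS.sound.topological j hj h
      simp only [Data.lt, Data.le] at h3 hz ih
      exact (hS.trB j (hS.trB_of_lt hT (by omega) h (ih (by omega))
        (by simp only [Data.lt]; omega))).2.2.1

/-- Below `s` forward reachability applies and above `s` backward reachability. This is why the
vertices of the new component need not be sought outside `X ∪ Y ∪ {s}`. -/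
theorem mem_of_between {z : V} (h1 : Reach a i.val (a i).2 z) (h2 : Reach a i.val z (a i).1) :
    rep d.parent z ∈ insert s (X ∪ Y) := by
  rw [Finset.mem_insert, Finset.mem_union, hT.mem_X, hT.mem_Y]
  rcases lt_trichotomy (d.order.idxOf (rep d.parent z)) (d.order.idxOf s) with h | h | h
  · exact .inr (.inl ⟨hS.mem_F_of_reach hT hS.head_mem h1 h.le, h⟩)
  · exact .inl (hS.sound.idxOf_inj (hS.sound.rep_rep _) h)
  · exact .inr (.inr ⟨hS.mem_R_of_reach hT hS.tail_mem h2 h.le, h⟩)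

omit hT in
theorem reach_of_mem {x : V} (hF : x ∈ S.F) (hR : x ∈ S.R) :
    Reach a i.val (a i).2 (a i).1 := (hS.F x hF).2.trans (hS.R x hR).2

omit hT in
theorem exists_crossing {x y s : V} (h : Reach a i.val x y) (hx : d.le (rep d.parent x) s)
    (hy : d.lt s (rep d.parent y)) : ∃ j : Fin m, j.val < i.val ∧ d.le (d.tail a j) s ∧
      d.lt s (d.head a j) ∧ Reach a i.val x (a j).1 ∧ Reach a i.val (a j).2 y := by
  induction h with
  | refl => simp only [Data.lt, Data.le] at hx hy; omega
  | @tail b c hab hbc ih =>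
    by_cases hb : d.lt s (rep d.parent b)
    · obtain ⟨j, h1, h2, h3, h4, h5⟩ := ih hb
      exact ⟨j, h1, h2, h3, h4, h5.tail hbc⟩
    · obtain ⟨j, hj, e⟩ := hbc
      refine ⟨j, hj, ?_, ?_, ?_, ?_⟩
      · simp only [Data.lt, Data.le, Data.tail, e] at hb ⊢; omega
      · simpa [Data.head, e] using hy
      · rw [e]; exact hab
      · rw [e]; exact Reach.refl _ _

/-- If the tail of the new arc is at most `s`, the forward search finds it; if the head is at least
`s`, the backward search finds it. Otherwise some arc of the path crosses `s`. Its tail is forward,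
and its head is backward and greater than `s`, so the arc has been traversed backward and its tail
is backward too. -/
theorem exists_both (h : Reach a i.val (a i).2 (a i).1) : ∃ x, x ∈ S.F ∧ x ∈ S.R := by
  by_cases h1 : d.le (d.tail a i) s
  · exact ⟨_, hS.mem_F_of_reach hT hS.head_mem h h1, hS.tail_mem⟩
  by_cases h2 : d.le s (d.head a i)
  · exact ⟨_, hS.head_mem, hS.mem_R_of_reach hT hS.tail_mem h h2⟩
  simp only [Data.le, not_le] at h1 h2
  obtain ⟨j, hj, h3, h4, h5, h6⟩ := hS.exists_crossing h (s := s) h2.le h1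
  have h7 : d.tail a j ∈ S.F := hS.mem_F_of_reach hT hS.head_mem h5 h3
  have h8 : d.head a j ∈ S.R := hS.mem_R_of_reach hT hS.tail_mem h6 (le_of_lt h4)
  have hl : d.tail a j ≠ d.head a j := by
    intro e; rw [e] at h3; simp only [Data.lt, Data.le] at h3 h4; omega
  exact ⟨_, h7, (hS.trB j (hS.trB_of_lt hT (by omega) hl h8 h4)).2.2.1⟩

theorem detects : Detects a i d S X Y s := by
  have key : (∃ x, x ∈ S.F ∧ x ∈ S.R) ↔ Reach a i.val (a i).2 (a i).1 :=
    ⟨fun ⟨x, h1, h2⟩ => hS.reach_of_mem h1 h2, hS.exists_both hT⟩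
  refine ⟨key, fun h z hz h1 h2 => ?_⟩
  have h1' : Reach a i.val (a i).2 z := by
    rcases (reach_succ i).1 h1 with h1 | h1
    · exact h.trans h1
    · exact h1.2
  have h2' : Reach a i.val z (a i).1 := by
    rcases (reach_succ i).1 h2 with h2 | h2
    · exact h2
    · exact h2.1
  have := hS.mem_of_between hT h1' h2'
  rwa [rep_of_fixed hz] at this

/-- A non-loop arc of the path goes up in the order, so its tail is less than `s` or its head is
greater than `s`. In the first case it has been traversed forward, in the second backward. -/
theorem sub_path {x z : V} (h : Reach a i.val x z) (hx : Reach a i.val (a i).2 x)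
    (hz : Reach a i.val z (a i).1) :
    ReflTransGen (S.Sub a i d X Y s) (rep d.parent x) (rep d.parent z) := by
  induction h with
  | refl => exact .refl
  | @tail b c hab hbc ih =>
    have hbc' : Reach a i.val b c := ReflTransGen.single hbc
    have ih := ih (hbc'.trans hz)
    have hb := hS.mem_of_between hT (hx.trans hab) (hbc'.trans hz)
    have hc := hS.mem_of_between hT ((hx.trans hab).trans hbc') hz
    obtain ⟨j, hj, e⟩ := hbc
    have h1 : rep d.parent b = d.tail a j := by simp [Data.tail, e]
    have h2 : rep d.parent c = d.head a j := by simp [Data.head, e]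
    by_cases hl : d.tail a j = d.head a j
    · rwa [h2, ← hl, ← h1]
    · refine ih.tail ⟨hb, hc, j, ?_, h1.symm, h2.symm⟩
      have h3 := hS.sound.topological j hj hl
      rw [h1] at hb
      rw [h2] at hc
      rw [Finset.mem_insert, Finset.mem_union, hT.mem_X, hT.mem_Y] at hb hc
      rw [Finset.mem_insert, Finset.mem_union]
      simp only [Data.lt] at h3 hb hc
      rcases hb with hb | hb | hb
      · rw [hb] at h3
        rcases hc with hc | hc | hc
        · rw [hc] at h3; omega
        · omega
        · exact .inr (.inr (hS.trB_of_lt hT (by omega) hl hc.1 hc.2))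
      · exact .inr (.inl (hS.trF_of_lt hT (by omega) hl hb.1 hb.2))
      · rcases hc with hc | hc | hc
        · rw [hc] at h3; omega
        · omega
        · exact .inr (.inr (hS.trB_of_lt hT (by omega) hl hc.1 hc.2))

omit hT in
theorem reach_of_sub {x y : V} (h : S.Sub a i d X Y s x y) : Reach a (i.val + 1) x y := by
  obtain ⟨_, _, e, he, rfl, rfl⟩ := h
  have he' : e.val < i.val + 1 := by
    rcases Finset.mem_insert.1 he with rfl | he
    · exact Nat.lt_succ_self _
    · rcases Finset.mem_union.1 he with he | he
      · exact (hS.trF e he).1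
      · exact (hS.trB e he).1
  exact ((hS.sound.rep_reach _).mono (Nat.le_succ _)).trans ((Reach.arc he').trans
    ((hS.sound.reach_rep _).mono (Nat.le_succ _)))

/-- Paths of the traversed subgraph are paths of the new graph, and conversely `sub_path` brings the
old paths through `z` into the subgraph, where the new arc closes the cycle. So the contracted set
is the true component. -/
theorem mem_newComponent (h : Reach a i.val (a i).2 (a i).1) (z : V) :
    z ∈ S.newComponent a i d X Y s ↔
      rep d.parent z = z ∧ Reach a i.val (a i).2 z ∧ Reach a i.val z (a i).1 := by
  rw [Search.newComponent, Finset.mem_filter]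
  have hroot : ∀ z ∈ insert s (X ∪ Y), rep d.parent z = z := by
    intro z hz
    rw [Finset.mem_insert, Finset.mem_union, hT.mem_X, hT.mem_Y] at hz
    rcases hz with rfl | hz | hz
    · exact (hS.sound.mem_order _).1 hT.mem
    · exact (hS.F z hz.1).1
    · exact (hS.R z hz.1).1
  have hsub : ∀ x y, ReflTransGen (S.Sub a i d X Y s) x y → Reach a (i.val + 1) x y := by
    intro x y hxy
    induction hxy with
    | refl => exact Reach.refl _ _
    | tail _ h ih => exact ih.trans (hS.reach_of_sub h)
  constructor
  · rintro ⟨h1, h2, h3⟩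
    have e1 := hsub _ _ h2
    have e2 := hsub _ _ h3
    refine ⟨hroot z h1, ?_, ?_⟩
    · rcases (reach_succ i).1 e1 with e1 | e1
      · exact (h.trans (hS.sound.reach_rep _)).trans e1
      · exact e1.2
    · rcases (reach_succ i).1 e2 with e2 | e2
      · exact e2.trans (hS.sound.rep_reach _)
      · exact e2.1
  · rintro ⟨h1, h2, h3⟩
    have e1 := hS.mem_of_between hT h2 h3
    have e2 := hS.sub_path hT h2 (Reach.refl _ _) h3
    have e3 := hS.sub_path hT h3 h2 (Reach.refl _ _)
    rw [h1] at e1 e2 e3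
    refine ⟨e1, ReflTransGen.head ⟨hS.mem_of_between hT h (Reach.refl _ _),
      hS.mem_of_between hT (Reach.refl _ _) h, i, Finset.mem_insert_self _ _, rfl, rfl⟩ e2, e3⟩

end Searching

end Graphs

/-! ### The new order as a concatenation of blocks. -/

section Rebuilds

variable {V : Type u} [Fintype V] {m : ℕ} {a : Fin m → V × V}
  {i : Fin m} {d : Data V m} {S : Search V m} {X Y : Finset V} {s : V}

/-- The vertices that are not moved, in their old order. -/
structure Kept (d : Data V m) (X Y : Finset V) (s : V) (P Q : List V) : Prop where
  nodup : (P ++ s :: Q).Nodup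
  mem_P : ∀ x, x ∈ P ↔ x ∈ d.order ∧ d.lt x s ∧ x ∉ X
  mem_Q : ∀ x, x ∈ Q ↔ x ∈ d.order ∧ d.lt s x ∧ x ∉ Y
  pair_P : ∀ x ∈ P, ∀ y ∈ P, d.lt x y → [x, y].Sublist P
  pair_Q : ∀ x ∈ Q, ∀ y ∈ Q, d.lt x y → [x, y].Sublist Q

/-- All of `X` lies before `s` and all of `Y` after it. Hence the part before `s` has lost only `X`
and the part after `s` only `Y`, and the kept vertices stay in their old order. -/
theorem Stopped.kept (hd : d.order.Nodup) (hT : Stopped d S X Y s) {P Q : List V}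
    (hPQ : d.order.filter (fun x => x ∉ X ∪ Y) = P ++ s :: Q) : Kept d X Y s P Q := by
  have hn : (P ++ s :: Q).Nodup := hPQ ▸ hd.filter _
  have hsub : (P ++ s :: Q).Sublist d.order := hPQ ▸ List.filter_sublist
  have hmem : ∀ x, x ∈ P ++ s :: Q ↔ x ∈ d.order ∧ x ∉ X ∧ x ∉ Y := by
    intro x
    rw [← hPQ]
    simp [List.mem_filter]
  have hP : ∀ x ∈ P, d.lt x s := fun x hx =>
    ((pair_sublist_iff hd).1 ((pair_sublist_append hx (by simp)).trans hsub)).1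
  have hQ : ∀ x ∈ Q, d.lt s x := fun x hx => by
    refine ((pair_sublist_iff hd).1 (List.Sublist.trans ?_ hsub)).1
    exact ((List.singleton_sublist.2 hx).cons_cons s).trans (List.sublist_append_right P (s :: Q))
  have hpair : ∀ x ∈ P ++ s :: Q, ∀ y ∈ P ++ s :: Q, d.lt x y → [x, y].Sublist (P ++ s :: Q) := by
    intro x hx y hy h
    have h1 := (pair_sublist_iff hd).2 ⟨h, ((hmem y).1 hy).1⟩
    have h2 := h1.filter (fun x => decide (x ∉ X ∪ Y))
    rw [hPQ] at h2
    have hx' := (hmem x).1 hx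
    have hy' := (hmem y).1 hy
    simpa [hx', hy'] using h2
  refine ⟨hn, fun x => ⟨fun hx => ?_, fun hx => ?_⟩, fun x => ⟨fun hx => ?_, fun hx => ?_⟩,
    fun x hx y hy h => ?_, fun x hx y hy h => ?_⟩
  · have := (hmem x).1 (by simp [hx])
    exact ⟨this.1, hP x hx, this.2.1⟩
  · have h1 := (hmem x).2 ⟨hx.1, hx.2.2, fun h => by
      have h2 := ((hT.mem_Y x).1 h).2
      have h3 := hx.2.1
      simp only [Data.lt] at h2 h3; omega⟩
    have h3 := hx.2.1
    rcases List.mem_append.1 h1 with h1 | h1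
    · exact h1
    · rcases List.mem_cons.1 h1 with rfl | h1
      · simp [Data.lt] at h3
      · have h2 := hQ x h1
        simp only [Data.lt] at h2 h3; omega
  · have := (hmem x).1 (by simp [hx])
    exact ⟨this.1, hQ x hx, this.2.2⟩
  · have h1 := (hmem x).2 ⟨hx.1, fun h => by
      have h2 := ((hT.mem_X x).1 h).2
      have h3 := hx.2.1
      simp only [Data.lt] at h2 h3; omega, hx.2.2⟩
    have h3 := hx.2.1
    rcases List.mem_append.1 h1 with h1 | h1
    · have h2 := hP x h1
      simp only [Data.lt] at h2 h3; omega
    · rcases List.mem_cons.1 h1 with rfl | h1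
      · simp [Data.lt] at h3
      · exact h1
  · exact pair_sublist_left hn (hpair x (by simp [hx]) y (by simp [hy]) h) hx hy
  · have e : P ++ s :: Q = (P ++ [s]) ++ Q := by simp
    rw [e] at hn hpair
    exact pair_sublist_right hn (hpair x (by simp [hx]) y (by simp [hy]) h) hx hy

/-- The arguments of the reordering step: the new order is `P ++ S₁ ++ OY ++ M ++ OX ++ S₂ ++ Q`,
where `M` contains the new component, and `S₁` or `S₂` contains `s`, unless `s` is in the new
component. -/
structure Blocks (a : Fin m → V × V) (i : Fin m) (d : Data V m) (S : Search V m) (X Y : Finset V)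
    (s : V) (Z : Finset V) (r : V) (P S₁ OY M OX S₂ Q : List V) : Prop where
  kept : Kept d X Y s P Q
  mem_Z : ∀ z, z ∈ Z ↔ rep d.parent z = z ∧ Reach a i.val (a i).2 z ∧ Reach a i.val z (a i).1
  r_mem : Z.Nonempty → r ∈ Z
  hX : IsTopOrder (S.Sub a i d X Y s) (X \ Z) OX
  hY : IsTopOrder (S.Sub a i d X Y s) (Y \ Z) OY
  nodup_M : M.Nodup
  mem_M : ∀ x, x ∈ M ↔ x = r ∧ r ∈ Z
  nodup_S : (S₁ ++ S₂).Nodup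
  mem_S₁ : ∀ x ∈ S₁, x = s ∧ s ∉ S.F ∧ s ∉ Z
  mem_S₂ : ∀ x ∈ S₂, x = s ∧ s ∉ S.R ∧ s ∉ Z
  s_mem : s ∉ Z → s ∈ S₁ ∨ s ∈ S₂

namespace Blocks

variable {Z : Finset V} {r : V} {P S₁ OY M OX S₂ Q : List V}
  (hB : Blocks a i d S X Y s Z r P S₁ OY M OX S₂ Q)
include hB

theorem mem_OX (x : V) : x ∈ OX ↔ x ∈ X ∧ x ∉ Z := by
  rw [← List.mem_toFinset, hB.hX.2.1, Finset.mem_sdiff]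

theorem mem_OY (x : V) : x ∈ OY ↔ x ∈ Y ∧ x ∉ Z := by
  rw [← List.mem_toFinset, hB.hY.2.1, Finset.mem_sdiff]

variable (hS : Searching a i d S) (hT : Stopped d S X Y s)
include hS hT

theorem cases_of_mem {x : V} (hx : x ∈ d.order) :
    (x ∈ P ∧ d.lt x s) ∨ x = s ∨ (x ∈ X ∧ x ∈ S.F ∧ d.lt x s) ∨ (x ∈ Y ∧ x ∈ S.R ∧ d.lt s x) ∨
      (x ∈ Q ∧ d.lt s x) := by
  rcases lt_trichotomy (d.order.idxOf x) (d.order.idxOf s) with h | h | h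
  · by_cases hX : x ∈ X
    · exact .inr (.inr (.inl ⟨hX, (hT.mem_X x).1 hX⟩))
    · exact .inl ⟨(hB.kept.mem_P x).2 ⟨hx, h, hX⟩, h⟩
  · exact .inr (.inl (hS.sound.idxOf_inj ((hS.sound.mem_order x).1 hx) h))
  · by_cases hY : x ∈ Y
    · exact .inr (.inr (.inr (.inl ⟨hY, (hT.mem_Y x).1 hY⟩)))
    · exact .inr (.inr (.inr (.inr ⟨(hB.kept.mem_Q x).2 ⟨hx, h, hY⟩, h⟩)))

theorem mem_insert {z : V} (hz : z ∈ Z) : z ∈ insert s (X ∪ Y) := by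
  obtain ⟨h1, h2, h3⟩ := (hB.mem_Z z).1 hz
  rw [← h1]
  exact hS.mem_of_between hT h2 h3

theorem notMem_P {z : V} (hz : z ∈ Z) : z ∉ P := fun h => by
  obtain ⟨_, h2, h3⟩ := (hB.kept.mem_P z).1 h
  have := hB.mem_insert hS hT hz
  rw [Finset.mem_insert, Finset.mem_union, hT.mem_Y] at this
  rcases this with rfl | h | h
  · simp [Data.lt] at h2
  · exact h3 h
  · have := h.2; simp only [Data.lt] at this h2; omega

theorem notMem_Q {z : V} (hz : z ∈ Z) : z ∉ Q := fun h => by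
  obtain ⟨_, h2, h3⟩ := (hB.kept.mem_Q z).1 h
  have := hB.mem_insert hS hT hz
  rw [Finset.mem_insert, Finset.mem_union, hT.mem_X] at this
  rcases this with rfl | h | h
  · simp [Data.lt] at h2
  · have := h.2; simp only [Data.lt] at this h2; omega
  · exact h3 h

omit hT in
theorem both_mem {x : V} (hF : x ∈ S.F) (hR : x ∈ S.R) : x ∈ Z :=
  (hB.mem_Z x).2 ⟨(hS.F x hF).1, (hS.F x hF).2, (hS.R x hR).2⟩

theorem mem_iff (x : V) : x ∈ P ++ (S₁ ++ (OY ++ (M ++ (OX ++ (S₂ ++ Q))))) ↔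
    (x ∈ d.order ∧ x ∉ Z) ∨ (x = r ∧ r ∈ Z) := by
  simp only [List.mem_append, hB.mem_OX, hB.mem_OY, hB.mem_M]
  constructor
  · rintro (h | h | h | h | h | h | h)
    · exact .inl ⟨((hB.kept.mem_P x).1 h).1, fun hz => hB.notMem_P hS hT hz h⟩
    · obtain ⟨rfl, _, h⟩ := hB.mem_S₁ x h
      exact .inl ⟨hT.mem, h⟩
    · exact .inl ⟨(hS.sound.mem_order x).2 (hS.R x ((hT.mem_Y x).1 h.1).1).1, h.2⟩
    · exact .inr h
    · exact .inl ⟨(hS.sound.mem_order x).2 (hS.F x ((hT.mem_X x).1 h.1).1).1, h.2⟩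
    · obtain ⟨rfl, _, h⟩ := hB.mem_S₂ x h
      exact .inl ⟨hT.mem, h⟩
    · exact .inl ⟨((hB.kept.mem_Q x).1 h).1, fun hz => hB.notMem_Q hS hT hz h⟩
  · rintro (⟨h, hz⟩ | h)
    · rcases hB.cases_of_mem hS hT h with h | rfl | h | h | h
      · exact .inl h.1
      · rcases hB.s_mem hz with h | h <;> simp [h]
      · exact .inr (.inr (.inr (.inr (.inl ⟨h.1, hz⟩))))
      · exact .inr (.inr (.inl ⟨h.1, hz⟩))
      · simp [h.1]
    · simp [h]

theorem nodup : (P ++ (S₁ ++ (OY ++ (M ++ (OX ++ (S₂ ++ Q)))))).Nodup := by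
  have hP : ∀ x ∈ P, d.lt x s ∧ x ∉ X ∧ x ∉ Z := fun x hx =>
    ⟨((hB.kept.mem_P x).1 hx).2.1, ((hB.kept.mem_P x).1 hx).2.2, fun h => hB.notMem_P hS hT h hx⟩
  have hQ : ∀ x ∈ Q, d.lt s x ∧ x ∉ Y ∧ x ∉ Z := fun x hx =>
    ⟨((hB.kept.mem_Q x).1 hx).2.1, ((hB.kept.mem_Q x).1 hx).2.2, fun h => hB.notMem_Q hS hT h hx⟩
  have hX : ∀ x ∈ OX, d.lt x s ∧ x ∈ X ∧ x ∉ Z := fun x hx =>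
    ⟨((hT.mem_X x).1 ((hB.mem_OX x).1 hx).1).2, (hB.mem_OX x).1 hx⟩
  have hY : ∀ x ∈ OY, d.lt s x ∧ x ∈ Y ∧ x ∉ Z := fun x hx =>
    ⟨((hT.mem_Y x).1 ((hB.mem_OY x).1 hx).1).2, (hB.mem_OY x).1 hx⟩
  have h1 : ∀ x ∈ S₁, x = s ∧ x ∉ Z := fun x hx => by
    obtain ⟨rfl, _, h⟩ := hB.mem_S₁ x hx; exact ⟨rfl, h⟩
  have h2 : ∀ x ∈ S₂, x = s ∧ x ∉ Z := fun x hx => by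
    obtain ⟨rfl, _, h⟩ := hB.mem_S₂ x hx; exact ⟨rfl, h⟩
  have hM : ∀ x ∈ M, x ∈ Z := fun x hx => by
    obtain ⟨rfl, h⟩ := (hB.mem_M x).1 hx; exact h
  have hss : ¬ d.lt s s := by simp [Data.lt]
  have hasymm : ∀ x y, d.lt x y → ¬ d.lt y x := fun x y h h' => by
    simp only [Data.lt] at h h'; omega
  have nP := List.Nodup.of_append_left hB.kept.nodup
  have nQ := (List.nodup_cons.1 (List.Nodup.of_append_right hB.kept.nodup)).2
  have nS := hB.nodup_S
  have nM := hB.nodup_M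
  have nX := hB.hX.1
  have nY := hB.hY.1
  simp only [List.nodup_append, List.mem_append] at nS ⊢
  refine ⟨nP, ⟨nS.1, ⟨nY, ⟨nM, ⟨nX, ⟨nS.2.1, nQ, ?_⟩, ?_⟩, ?_⟩, ?_⟩, ?_⟩, ?_⟩
  all_goals
    rintro x hx y hy rfl
    grind

/-- The tail of an old arc into `Y` is backward, hence in `P`, equal to `s`, in `Y`, or in `Z` if it
is also forward. The head of an old arc out of `X` is forward, with the dual possibilities. The side
on which `s` is placed fits this: `s` comes before `OY` unless it is not backward, and after `OX`
unless it is not forward. What remains is a check of the possible pairs of blocks. -/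
theorem pair {x y : V} (hx : x ∈ d.order) (hy : y ∈ d.order)
    (hxy : (∃ e : Fin m, e.val < i.val ∧ d.tail a e = x ∧ d.head a e = y) ∨
      (x = d.tail a i ∧ y = d.head a i))
    (hne : (if x ∈ Z then r else x) ≠ if y ∈ Z then r else y) :
    [if x ∈ Z then r else x, if y ∈ Z then r else y].Sublist
      (P ++ (S₁ ++ (OY ++ (M ++ (OX ++ (S₂ ++ Q)))))) := by
  have hne' : x ≠ y := fun h => hne (by rw [h])
  have hss : ¬ d.lt s s := by simp [Data.lt]
  have hasymm : ∀ x y, d.lt x y → ¬ d.lt y x := fun x y h h' => by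
    simp only [Data.lt] at h h'; omega
  have htrans : ∀ x y z, d.lt x y → d.lt y z → d.lt x z := fun x y z h h' =>
    lt_trans (a := d.order.idxOf x) h h'
  have hcx := hB.cases_of_mem hS hT hx
  have hcy := hB.cases_of_mem hS hT hy
  have hboth := fun x => hB.both_mem hS (x := x)
  have hX := hB.mem_OX
  have hY := hB.mem_OY
  have hnP := fun z => hB.notMem_P hS hT (z := z)
  have hnQ := fun z => hB.notMem_Q hS hT (z := z)
  have hPX := fun x h => ((hB.kept.mem_P x).1 h).2.2
  have hQY := fun x h => ((hB.kept.mem_Q x).1 h).2.2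
  have hmX := hT.mem_X
  have hmY := hT.mem_Y
  have hs := hB.s_mem
  have hS₁ := hB.mem_S₁
  have hS₂ := hB.mem_S₂
  -- Pairs from different blocks are in order by the arrangement of the blocks. Pairs inside `P` or
  -- `Q` keep their old order, and pairs inside `OY` or `OX` use the given topological orders.
  have b1 : ∀ p q, p ∈ P → (q ∈ S₁ ∨ q ∈ OY ∨ q ∈ M ∨ q ∈ OX ∨ q ∈ S₂ ∨ q ∈ Q) →
      [p, q].Sublist (P ++ (S₁ ++ (OY ++ (M ++ (OX ++ (S₂ ++ Q)))))) := fun p q hp hq =>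
    pair_sublist_append hp (by simpa using hq)
  have b2 : ∀ p q, p ∈ S₁ → (q ∈ OY ∨ q ∈ M ∨ q ∈ OX ∨ q ∈ S₂ ∨ q ∈ Q) →
      [p, q].Sublist (P ++ (S₁ ++ (OY ++ (M ++ (OX ++ (S₂ ++ Q)))))) := fun p q hp hq =>
    (pair_sublist_append hp (by simpa using hq)).trans (List.sublist_append_right _ _)
  have b3 : ∀ p q, p ∈ OY → (q ∈ M ∨ q ∈ OX ∨ q ∈ S₂ ∨ q ∈ Q) →
      [p, q].Sublist (P ++ (S₁ ++ (OY ++ (M ++ (OX ++ (S₂ ++ Q)))))) := fun p q hp hq =>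
    ((pair_sublist_append hp (by simpa using hq)).trans (List.sublist_append_right _ _)).trans
      (List.sublist_append_right _ _)
  have b4 : ∀ p q, p ∈ M → (q ∈ OX ∨ q ∈ S₂ ∨ q ∈ Q) →
      [p, q].Sublist (P ++ (S₁ ++ (OY ++ (M ++ (OX ++ (S₂ ++ Q)))))) := fun p q hp hq =>
    (((pair_sublist_append hp (by simpa using hq)).trans (List.sublist_append_right _ _)).trans
      (List.sublist_append_right _ _)).trans (List.sublist_append_right _ _)
  have b5 : ∀ p q, p ∈ OX → (q ∈ S₂ ∨ q ∈ Q) →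
      [p, q].Sublist (P ++ (S₁ ++ (OY ++ (M ++ (OX ++ (S₂ ++ Q)))))) := fun p q hp hq =>
    ((((pair_sublist_append hp (by simpa using hq)).trans (List.sublist_append_right _ _)).trans
      (List.sublist_append_right _ _)).trans (List.sublist_append_right _ _)).trans
      (List.sublist_append_right _ _)
  have b6 : ∀ p q, p ∈ S₂ → q ∈ Q →
      [p, q].Sublist (P ++ (S₁ ++ (OY ++ (M ++ (OX ++ (S₂ ++ Q)))))) := fun p q hp hq =>
    (((((pair_sublist_append hp hq).trans (List.sublist_append_right _ _)).trans
      (List.sublist_append_right _ _)).trans (List.sublist_append_right _ _)).trans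
      (List.sublist_append_right _ _)).trans (List.sublist_append_right _ _)
  have bP : ∀ p q, p ∈ P → q ∈ P → d.lt p q →
      [p, q].Sublist (P ++ (S₁ ++ (OY ++ (M ++ (OX ++ (S₂ ++ Q)))))) := fun p q hp hq h =>
    (hB.kept.pair_P p hp q hq h).trans (List.sublist_append_left _ _)
  have bQ : ∀ p q, p ∈ Q → q ∈ Q → d.lt p q →
      [p, q].Sublist (P ++ (S₁ ++ (OY ++ (M ++ (OX ++ (S₂ ++ Q)))))) := fun p q hp hq h =>
    ((((((hB.kept.pair_Q p hp q hq h).trans (List.sublist_append_right _ _)).trans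
      (List.sublist_append_right _ _)).trans (List.sublist_append_right _ _)).trans
      (List.sublist_append_right _ _)).trans (List.sublist_append_right _ _)).trans
      (List.sublist_append_right _ _)
  have bY : [x, y].Sublist OY →
      [x, y].Sublist (P ++ (S₁ ++ (OY ++ (M ++ (OX ++ (S₂ ++ Q)))))) := fun h =>
    ((h.trans (List.sublist_append_left _ _)).trans (List.sublist_append_right _ _)).trans
      (List.sublist_append_right _ _)
  have bX : [x, y].Sublist OX →
      [x, y].Sublist (P ++ (S₁ ++ (OY ++ (M ++ (OX ++ (S₂ ++ Q)))))) := fun h =>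
    ((((h.trans (List.sublist_append_left _ _)).trans (List.sublist_append_right _ _)).trans
      (List.sublist_append_right _ _)).trans (List.sublist_append_right _ _)).trans
      (List.sublist_append_right _ _)
  rcases hxy with ⟨e, he, het, heh⟩ | ⟨hxi, hyi⟩
  · have hl : d.tail a e ≠ d.head a e := by rw [het, heh]; exact hne'
    have hlt : d.lt x y := by
      have := hS.sound.topological e he hl
      rwa [het, heh] at this
    have hreach : Reach a i.val x y := by
      have h1 := hS.sound.rep_reach (a e).1
      have h2 := hS.sound.reach_rep (a e).2
      rw [show rep d.parent (a e).1 = x from het] at h1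
      rw [show rep d.parent (a e).2 = y from heh] at h2
      exact (h1.trans (Reach.arc he)).trans h2
    have fX : x ∈ X → e ∈ S.trF ∧ y ∈ S.F := fun h => by
      have h1 := hS.trF_of_lt hT (j := e) (by omega) hl (by rw [het]; exact ((hmX x).1 h).1)
        (by rw [het]; exact ((hmX x).1 h).2)
      exact ⟨h1, heh ▸ (hS.trF e h1).2.2.2⟩
    have fY : y ∈ Y → e ∈ S.trB ∧ x ∈ S.R := fun h => by
      have h1 := hS.trB_of_lt hT (j := e) (by omega) hl (by rw [heh]; exact ((hmY y).1 h).1)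
        (by rw [heh]; exact ((hmY y).1 h).2)
      exact ⟨h1, het ▸ (hS.trB e h1).2.2.1⟩
    -- No arc leads from `Z` to a backward vertex outside `Z`, nor from a forward vertex outside `Z`
    -- into `Z`. So an arc out of `Z` does not end in `OY`, and an arc into `Z` does not start in
    -- `OX`.
    have zR : x ∈ Z → y ∈ S.R → y ∈ Z := fun h1 h2 =>
      (hB.mem_Z y).2 ⟨(hS.R y h2).1, ((hB.mem_Z x).1 h1).2.1.trans hreach, (hS.R y h2).2⟩
    have zF : y ∈ Z → x ∈ S.F → x ∈ Z := fun h1 h2 =>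
      (hB.mem_Z x).2 ⟨(hS.F x h2).1, (hS.F x h2).2, hreach.trans ((hB.mem_Z y).1 h1).2.2⟩
    have sX : x ∈ OX → y ∈ OX → [x, y].Sublist OX := fun h1 h2 => by
      rw [pair_sublist_iff hB.hX.1]
      refine ⟨hB.hX.2.2 x ?_ y ?_ ⟨?_, ?_, e, ?_, het, heh⟩, h2⟩
      · simpa using (hX x).1 h1
      · simpa using (hX y).1 h2
      · simp [((hX x).1 h1).1]
      · simp [((hX y).1 h2).1]
      · simp [(fX ((hX x).1 h1).1).1]
    have sY : x ∈ OY → y ∈ OY → [x, y].Sublist OY := fun h1 h2 => by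
      rw [pair_sublist_iff hB.hY.1]
      refine ⟨hB.hY.2.2 x ?_ y ?_ ⟨?_, ?_, e, ?_, het, heh⟩, h2⟩
      · simpa using (hY x).1 h1
      · simpa using (hY y).1 h2
      · simp [((hY x).1 h1).1]
      · simp [((hY y).1 h2).1]
      · simp [(fY ((hY y).1 h2).1).1]
    by_cases hxZ : x ∈ Z
    · have hyZ : y ∉ Z := fun h => hne (by simp [hxZ, h])
      have hr : r ∈ M := (hB.mem_M r).2 ⟨rfl, hB.r_mem ⟨x, hxZ⟩⟩
      rw [if_pos hxZ, if_neg hyZ]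
      refine b4 r y hr ?_
      grind
    · rw [if_neg hxZ]
      by_cases hyZ : y ∈ Z
      · rw [if_pos hyZ]
        have hr : r ∈ M := (hB.mem_M r).2 ⟨rfl, hB.r_mem ⟨y, hyZ⟩⟩
        have hmem := hB.mem_insert hS hT hyZ
        rw [Finset.mem_insert, Finset.mem_union] at hmem
        have : x ∈ P ∨ x ∈ S₁ ∨ x ∈ OY := by grind
        rcases this with h | h | h
        · exact b1 _ _ h (by simp [hr])
        · exact b2 _ _ h (by simp [hr])
        · exact b3 _ _ h (by simp [hr])
      · rw [if_neg hyZ]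
        rcases hcx with hcx | hcx | hcx | hcx | hcx
        · grind
        · grind
        · grind
        · grind
        · grind
  -- The new arc is the only one against the old order. Unless it becomes a loop, its tail is
  -- backward and not forward and its head is forward and not backward, so the blocks put the tail
  -- first.
  · have hlt : d.lt y x := by rw [hxi, hyi]; exact hS.gt
    have hxR : x ∈ S.R := by rw [hxi]; exact hS.tail_mem
    have hyF : y ∈ S.F := by rw [hyi]; exact hS.head_mem
    have hxZ : x ∉ Z := fun h => hne (by
      have h1 := ((hB.mem_Z x).1 h).2.1
      have h2 : y ∈ Z := (hB.mem_Z y).2 ⟨(hS.F y hyF).1, (hS.F y hyF).2, by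
        rw [hyi]
        exact (hS.sound.rep_reach _).trans (h1.trans (hS.R x hxR).2)⟩
      simp [h, h2])
    have hyZ : y ∉ Z := fun h => hxZ (by
      have h1 := ((hB.mem_Z y).1 h).2.2
      exact (hB.mem_Z x).2 ⟨(hS.R x hxR).1, (hS.F y hyF).2.trans (h1.trans (by
        rw [hxi]; exact hS.sound.reach_rep _)), (hS.R x hxR).2⟩)
    have hxF : x ∉ S.F := fun h => hxZ (hboth x h hxR)
    have hyR : y ∉ S.R := fun h => hyZ (hboth y hyF h)
    rw [if_neg hxZ, if_neg hyZ]
    rcases hcx with hcx | hcx | hcx | hcx | hcx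
    · grind
    · grind
    · grind
    · grind
    · grind

/-- The rebuilding cases differ only in the blocks. The arc sets are prescribed only at the roots of
the new forest, since those of other vertices are never used. -/
theorem correct {p' : V → V} {out' inc' : V → Finset (Fin m)} (hp : Forest p')
    (hrep : ∀ x, rep p' x = if rep d.parent x ∈ Z then r else rep d.parent x)
    (hout : ∀ x, rep p' x = x → out' x = if x ∈ Z then Z.biUnion d.out else d.out x)
    (hinc : ∀ x, rep p' x = x → inc' x = if x ∈ Z then Z.biUnion d.inc else d.inc x) :
    Correct a (i.val + 1)
      ⟨p', out', inc', P ++ (S₁ ++ (OY ++ (M ++ (OX ++ (S₂ ++ Q)))))⟩ := by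
  have hd := hS.sound
  have hZ : ∀ x, rep d.parent x ∈ Z ↔ Reach a i.val (a i).2 x ∧ Reach a i.val x (a i).1 := by
    intro x
    rw [hB.mem_Z]
    exact ⟨fun h => ⟨h.2.1.trans (hd.rep_reach x), (hd.reach_rep x).trans h.2.2⟩,
      fun h => ⟨hd.rep_rep x, h.1.trans (hd.reach_rep x), (hd.rep_reach x).trans h.2⟩⟩
  have hrootZ : ∀ z ∈ Z, rep d.parent z = z := fun z hz => ((hB.mem_Z z).1 hz).1
  have hr : ∀ x, rep d.parent x ∈ Z → r ∈ Z := fun x hx => hB.r_mem ⟨_, hx⟩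
  have hfix : ∀ x, rep p' x = x ↔ (rep d.parent x = x ∧ x ∉ Z) ∨ (x = r ∧ r ∈ Z) := by
    intro x
    rw [hrep]
    by_cases h : rep d.parent x ∈ Z
    · rw [if_pos h]
      constructor
      · intro e; exact .inr ⟨e.symm, hr x h⟩
      · rintro (⟨h1, h2⟩ | h1)
        · exact absurd (h1 ▸ h) h2
        · exact h1.1.symm
    · rw [if_neg h]
      constructor
      · intro e; exact .inl ⟨e, e ▸ h⟩
      · rintro (h1 | ⟨rfl, h1⟩)
        · exact h1.1
        · exact hrootZ _ h1
  rw [correct_iff]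
  refine ⟨hp, fun x y => ?_, hB.nodup hS hT, fun x => ?_, fun j hj hl => ?_, ?_, ?_, ?_, ?_⟩
  · simp only [hrep]
    by_cases hx : rep d.parent x ∈ Z <;> by_cases hy : rep d.parent y ∈ Z
    · rw [if_pos hx, if_pos hy]
      rw [hZ] at hx hy
      exact ⟨fun _ => ⟨(reach_succ i).2 (.inr ⟨hx.2, hy.1⟩), (reach_succ i).2 (.inr ⟨hy.2, hx.1⟩)⟩,
        fun _ => rfl⟩
    · rw [if_pos hx, if_neg hy]
      refine ⟨fun h => absurd (h ▸ hr x hx) hy, fun ⟨h1, h2⟩ => absurd ?_ hy⟩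
      rw [hZ] at hx ⊢
      rw [reach_succ] at h1 h2
      exact ⟨h1.elim (fun h => hx.1.trans h) fun h => h.2,
        h2.elim (fun h => h.trans hx.2) fun h => h.1⟩
    · rw [if_neg hx, if_pos hy]
      refine ⟨fun h => absurd (h ▸ hr y hy) hx, fun ⟨h1, h2⟩ => absurd ?_ hx⟩
      rw [hZ] at hy ⊢
      rw [reach_succ] at h1 h2
      exact ⟨h2.elim (fun h => hy.1.trans h) fun h => h.2,
        h1.elim (fun h => h.trans hy.2) fun h => h.1⟩
    · rw [if_neg hx, if_neg hy, hd.component]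
      rw [hZ] at hx
      rw [reach_succ, reach_succ]
      constructor
      · exact fun h => ⟨.inl h.1, .inl h.2⟩
      -- Two vertices that reach each other with the help of arc `i` would lie in `Z`.
      · rintro ⟨h1 | ⟨h1, h2⟩, h3 | ⟨h3, h4⟩⟩
        · exact ⟨h1, h3⟩
        · exact absurd ⟨h4, h1.trans h3⟩ hx
        · exact absurd ⟨h2.trans h3, h1⟩ hx
        · exact absurd ⟨h4, h1⟩ hx
  · rw [hfix, hB.mem_iff hS hT, hd.mem_order]
  · simp only [Data.tail, Data.head, hrep] at hl ⊢
    have h1 : (∃ e : Fin m, e.val < i.val ∧ d.tail a e = d.tail a j ∧ d.head a e = d.head a j) ∨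
        (d.tail a j = d.tail a i ∧ d.head a j = d.head a i) := by
      rcases Nat.lt_succ_iff_lt_or_eq.1 hj with hj | hj
      · exact .inl ⟨j, hj, rfl, rfl⟩
      · obtain rfl := Fin.ext hj
        exact .inr ⟨rfl, rfl⟩
    exact ((pair_sublist_iff (hB.nodup hS hT)).1
      (hB.pair hS hT (hd.rep_mem_order _) (hd.rep_mem_order _) h1 hl)).1
  · intro x hx j hj
    change j ∈ out' x at hj
    rw [hout x hx] at hj
    change _ ∧ rep p' _ = x
    rw [hrep]
    by_cases h : x ∈ Z
    · rw [if_pos h] at hj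
      obtain ⟨z, hz, hj⟩ := Finset.mem_biUnion.1 hj
      obtain ⟨h1, h2⟩ := hd.of_mem_out z (hrootZ z hz) j hj
      change rep d.parent (a j).1 = z at h2
      rw [h2, if_pos hz]
      refine ⟨h1, ?_⟩
      rcases (hfix x).1 hx with h' | h'
      · exact absurd h h'.2
      · exact h'.1.symm
    · rw [if_neg h] at hj
      have hx' : rep d.parent x = x := by
        rcases (hfix x).1 hx with h' | h'
        · exact h'.1
        · exact absurd (h'.1 ▸ h'.2) h
      obtain ⟨h1, h2⟩ := hd.of_mem_out x hx' j hj
      change rep d.parent (a j).1 = x at h2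
      rw [h2, if_neg h]
      exact ⟨h1, rfl⟩
  · intro x hx j hj
    change j ∈ inc' x at hj
    rw [hinc x hx] at hj
    change _ ∧ rep p' _ = x
    rw [hrep]
    by_cases h : x ∈ Z
    · rw [if_pos h] at hj
      obtain ⟨z, hz, hj⟩ := Finset.mem_biUnion.1 hj
      obtain ⟨h1, h2⟩ := hd.of_mem_inc z (hrootZ z hz) j hj
      change rep d.parent (a j).2 = z at h2
      rw [h2, if_pos hz]
      refine ⟨h1, ?_⟩
      rcases (hfix x).1 hx with h' | h'
      · exact absurd h h'.2
      · exact h'.1.symm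
    · rw [if_neg h] at hj
      have hx' : rep d.parent x = x := by
        rcases (hfix x).1 hx with h' | h'
        · exact h'.1
        · exact absurd (h'.1 ▸ h'.2) h
      obtain ⟨h1, h2⟩ := hd.of_mem_inc x hx' j hj
      change rep d.parent (a j).2 = x at h2
      rw [h2, if_neg h]
      exact ⟨h1, rfl⟩
  · intro j hj hl
    change j ∈ out' (rep p' (a j).1)
    rw [hout _ (hp.rep_rep _), hrep]
    have hl' : d.tail a j ≠ d.head a j := fun h => hl (by
      simp only [Data.tail, Data.head, hrep] at h ⊢
      rw [h])
    have h1 := hd.mem_out j hj hl'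
    by_cases h : rep d.parent (a j).1 ∈ Z
    · rw [if_pos h, if_pos (hr _ h)]
      exact Finset.mem_biUnion.2 ⟨_, h, h1⟩
    · rw [if_neg h, if_neg h]
      exact h1
  · intro j hj hl
    change j ∈ inc' (rep p' (a j).2)
    rw [hinc _ (hp.rep_rep _), hrep]
    have hl' : d.tail a j ≠ d.head a j := fun h => hl (by
      simp only [Data.tail, Data.head, hrep] at h ⊢
      rw [h])
    have h1 := hd.mem_inc j hj hl'
    by_cases h : rep d.parent (a j).2 ∈ Z
    · rw [if_pos h, if_pos (hr _ h)]
      exact Finset.mem_biUnion.2 ⟨_, h, h1⟩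
    · rw [if_neg h, if_neg h]
      exact h1

end Blocks

/-! ### The rebuilding step is correct and always possible. -/

namespace Searching

variable (hS : Searching a i d S) (hT : Stopped d S X Y s)
include hS

theorem disjoint_iff (hT : Stopped d S X Y s) :
    Disjoint S.F S.R ↔ ¬ Reach a i.val (a i).2 (a i).1 := by
  rw [← not_iff_not, not_not, Finset.not_disjoint_iff]
  exact (hS.detects hT).1

include hT

theorem rebuild_correct {d' : Data V m} {n : ℕ} (h : Rebuild a i d S X Y s d' n) :
    Correct a (i.val + 1) d' := by
  have hd := hS.sound
  cases h with
  | after hFR hs OX OY P Q hX hY hPQ =>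
    -- Without a cycle there is no new component, so `Z` and `M` are empty and `s` is a dummy value
    -- for `r`.
    have hB : Blocks a i d S X Y s ∅ s P [s] OY [] OX [] Q :=
      { kept := hT.kept hd.nodup hPQ
        mem_Z := fun z => by
          have h1 := (hS.disjoint_iff hT).1 hFR
          simpa using fun _ h2 h3 => h1 (h2.trans h3)
        r_mem := by simp
        hX := by simpa using hX
        hY := by simpa using hY
        nodup_M := by simp
        mem_M := by simp
        nodup_S := by simp
        mem_S₁ := by simp [hs]
        mem_S₂ := by simp
        s_mem := by simp }
    have := hB.correct hS hT (p' := d.parent) (out' := d.out) (inc' := d.inc) hd.forest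
      (by simp) (by simp) (by simp)
    simpa using this
  | before hFR hs OX OY P Q hX hY hPQ =>
    have hB : Blocks a i d S X Y s ∅ s P [] OY [] OX [s] Q :=
      { kept := hT.kept hd.nodup hPQ
        mem_Z := fun z => by
          have h1 := (hS.disjoint_iff hT).1 hFR
          simpa using fun _ h2 h3 => h1 (h2.trans h3)
        r_mem := by simp
        hX := by simpa using hX
        hY := by simpa using hY
        nodup_M := by simp
        mem_M := by simp
        nodup_S := by simp
        mem_S₁ := by simp
        mem_S₂ := by simp [hs]
        s_mem := by simp }
    have := hB.correct hS hT (p' := d.parent) (out' := d.out) (inc' := d.inc) hd.forest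
      (by simp) (by simp) (by simp)
    simpa using this
  | contract hFR Z hZ p' r hlink OX OY P Q hX hY hPQ =>
    have hreach : Reach a i.val (a i).2 (a i).1 := by
      have := (hS.disjoint_iff hT).not.1 hFR
      rwa [not_not] at this
    have hmZ : ∀ z, z ∈ Z ↔
        rep d.parent z = z ∧ Reach a i.val (a i).2 z ∧ Reach a i.val z (a i).1 := by
      rw [hZ]; exact hS.mem_newComponent hT hreach
    obtain ⟨hp, hr, hrep⟩ := hlink.spec hd.forest
      fun z hz => hd.forest.rep_eq_self.1 ((hmZ z).1 hz).1
    have key : ∀ S₁ S₂ : List V, Blocks a i d S X Y s Z r P S₁ OY [r] OX S₂ Q →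
        Correct a (i.val + 1) ⟨p', Function.update d.out r (Z.biUnion d.out),
          Function.update d.inc r (Z.biUnion d.inc),
          P ++ (S₁ ++ (OY ++ ([r] ++ (OX ++ (S₂ ++ Q)))))⟩ := by
      intro S₁ S₂ hB
      have hup : ∀ (f : V → Finset (Fin m)) (x : V), rep p' x = x →
          Function.update f r (Z.biUnion f) x = if x ∈ Z then Z.biUnion f else f x := by
        intro f x hx
        by_cases hxr : x = r
        · subst hxr; simp [hr]
        · rw [Function.update_of_ne hxr, if_neg]
          intro h
          rw [hrep, ((hmZ x).1 h).1, if_pos h] at hx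
          exact hxr hx.symm
      exact hB.correct hS hT hp hrep (hup d.out) (hup d.inc)
    have mk : ∀ S₁ S₂ : List V, (S₁ ++ S₂).Nodup → (∀ x ∈ S₁, x = s ∧ s ∉ S.F ∧ s ∉ Z) →
        (∀ x ∈ S₂, x = s ∧ s ∉ S.R ∧ s ∉ Z) → (s ∉ Z → s ∈ S₁ ∨ s ∈ S₂) →
        Blocks a i d S X Y s Z r P S₁ OY [r] OX S₂ Q := fun S₁ S₂ h1 h2 h3 h4 =>
      { kept := hT.kept hd.nodup hPQ
        mem_Z := hmZ
        r_mem := fun _ => hr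
        hX := hX
        hY := hY
        nodup_M := by simp
        mem_M := by simp [hr]
        nodup_S := h1
        mem_S₁ := h2
        mem_S₂ := h3
        s_mem := h4 }
    split_ifs with h1 h2
    · simpa using key [] [] (mk [] [] (by simp) (by simp) (by simp) (by simp [h1]))
    · have h3 : s ∉ S.R := fun h => h1 ((hmZ s).2
        ⟨(hS.R s h).1, (hS.F s h2).2, (hS.R s h).2⟩)
      simpa using key [] [s] (mk [] [s] (by simp) (by simp) (by simp [h1, h3]) (by simp))
    · simpa using key [s] [] (mk [s] [] (by simp) (by simp [h1, h2]) (by simp) (by simp))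

/-- The old order restricted to `T` serves: only the new arc goes against it, and one end of the new
arc is missing from `T`. -/
theorem exists_topOrder {T : Finset V} (h : ∀ x ∈ T, rep d.parent x = x)
    (hT' : d.tail a i ∉ T ∨ d.head a i ∉ T) :
    ∃ L, IsTopOrder (S.Sub a i d X Y s) T L := by
  have hd := hS.sound
  refine ⟨d.order.filter (· ∈ T), hd.nodup.filter _, ?_, fun x hx y hy hxy => ?_⟩
  · ext x
    simp only [List.mem_toFinset, List.mem_filter, decide_eq_true_eq, and_iff_right_iff_imp]
    exact fun hx => (hd.mem_order x).2 (h x hx)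
  · obtain ⟨_, _, e, he, rfl, rfl⟩ := hxy
    have he' : e ≠ i → e.val < i.val + 1 ∧ d.tail a e ≠ d.head a e := fun hei => by
      rcases Finset.mem_insert.1 he with rfl | he
      · exact absurd rfl hei
      · rcases Finset.mem_union.1 he with he | he
        · exact ⟨(hS.trF e he).1, (hS.trF e he).2.1⟩
        · exact ⟨(hS.trB e he).1, (hS.trB e he).2.1⟩
    have hei : e ≠ i := by
      rintro rfl
      exact hT'.elim (fun h => h hx) fun h => h hy
    obtain ⟨h1, h2⟩ := he' hei
    have h3 : e.val ≠ i.val := fun h => hei (Fin.ext h)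
    have h4 := hd.topological e (by omega) h2
    have h5 := ((pair_sublist_iff hd.nodup).2 ⟨h4, hd.rep_mem_order _⟩).filter (· ∈ T)
    simp only [hx, hy, decide_true, List.filter_cons_of_pos, List.filter_nil] at h5
    exact ((pair_sublist_iff (hd.nodup.filter _)).1 h5).1

theorem exists_rebuild : ∃ d' n, Rebuild a i d S X Y s d' n := by
  have hd := hS.sound
  have hs : s ∈ d.order.filter (fun x => x ∉ X ∪ Y) := by
    simp [hT.mem, hT.mem_X, hT.mem_Y, Data.lt]
  obtain ⟨P, Q, hPQ⟩ := List.append_of_mem hs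
  have hrX : ∀ x ∈ X, rep d.parent x = x := fun x hx => (hS.F x ((hT.mem_X x).1 hx).1).1
  have hrY : ∀ x ∈ Y, rep d.parent x = x := fun x hx => (hS.R x ((hT.mem_Y x).1 hx).1).1
  by_cases hFR : Disjoint S.F S.R
  · rw [Finset.disjoint_left] at hFR
    obtain ⟨OX, hX⟩ := hS.exists_topOrder hT hrX (.inl fun h =>
      hFR ((hT.mem_X _).1 h).1 hS.tail_mem)
    obtain ⟨OY, hY⟩ := hS.exists_topOrder hT hrY (.inr fun h =>
      hFR hS.head_mem ((hT.mem_Y _).1 h).1)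
    by_cases h : s ∈ S.F
    · exact ⟨_, _, .before (Finset.disjoint_left.2 hFR) (hFR h) OX OY P Q hX hY hPQ⟩
    · exact ⟨_, _, .after (Finset.disjoint_left.2 hFR) h OX OY P Q hX hY hPQ⟩
  · have hreach : Reach a i.val (a i).2 (a i).1 := by
      have := (hS.disjoint_iff hT).not.1 hFR
      rwa [not_not] at this
    have hmem : d.tail a i ∈ S.newComponent a i d X Y s := (hS.mem_newComponent hT hreach _).2
      ⟨hd.rep_rep _, hreach.trans (hd.reach_rep _), hd.rep_reach _⟩
    obtain ⟨OX, hX⟩ := hS.exists_topOrder hT (T := X \ S.newComponent a i d X Y s)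
      (fun x hx => hrX x (Finset.mem_sdiff.1 hx).1) (.inl fun h => (Finset.mem_sdiff.1 h).2 hmem)
    obtain ⟨OY, hY⟩ := hS.exists_topOrder hT (T := Y \ S.newComponent a i d X Y s)
      (fun x hx => hrY x (Finset.mem_sdiff.1 hx).1) (.inl fun h => (Finset.mem_sdiff.1 h).2 hmem)
    obtain ⟨p', r, hlink⟩ := LinkAll.exists d.parent ⟨_, hmem⟩
    exact ⟨_, _, .contract hFR _ rfl p' r hlink OX OY P Q hX hY hPQ⟩

end Searching

end Rebuilds

/-! ### The general method: invariant, termination and progress. -/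

section GeneralMethod

variable {V : Type u} [Fintype V] {m : ℕ} {a : Fin m → V × V}

/-- The invariant of an algorithm whose searches satisfy `inv`. -/
structure Invariant {σ : Type u} (a : Fin m → V × V) (inv : Fin m → Data V m → σ → Prop)
    (c : Config V m σ) : Prop where
  bounded : c.done ≤ m
  idle : c.search = none → Correct a c.done c.data
  busy : ∀ T, c.search = some T → ∃ i : Fin m, i.val = c.done ∧ inv i c.data T

theorem invariant_empty {σ : Type u} {inv : Fin m → Data V m → σ → Prop} {o : List V}
    (ho : o.Nodup) (ho' : ∀ x, x ∈ o) : Invariant a inv (Config.empty o) :=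
  ⟨Nat.zero_le _, fun _ => correct_empty ho ho', fun _ h => by simp [Config.empty] at h⟩

theorem Invariant.begin {σ : Type u} {inv : Fin m → Data V m → σ → Prop}
    {start : Data V m → V → V → σ → Prop} {c c' : Config V m σ} (hc : Invariant a inv c)
    (h : Begin a start c c')
    (hinv : ∀ (i : Fin m) (T : σ), start c.data (c.data.tail a i) (c.data.head a i) T →
      Sound a i.val i.val c.data → Sound a i.val (i.val + 1) (c.data.addArc a i) →
      (c.data.addArc a i).lt ((c.data.addArc a i).head a i) ((c.data.addArc a i).tail a i) →
      inv i (c.data.addArc a i) T) : Invariant a inv c' := by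
  cases h with
  | quiet i hs hi h =>
    have hd : Sound a i.val i.val c.data := by
      have := correct_iff.1 (hc.idle hs); rwa [← hi] at this
    refine ⟨by have := i.isLt; simp only; omega, fun _ => ?_, fun _ h => by simp at h⟩
    rw [correct_iff]
    simp only [← hi]
    refine hd.addArc.quiet ?_
    rw [hd.tail_addArc, hd.head_addArc]
    exact h
  | search i T hs hi h hT =>
    have hd : Sound a i.val i.val c.data := by
      have := correct_iff.1 (hc.idle hs); rwa [← hi] at this
    refine ⟨hc.bounded, fun h => by simp at h, fun T' hT' => ⟨i, hi, ?_⟩⟩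
    obtain rfl : T = T' := by simpa using hT'
    refine hinv i T hT hd hd.addArc ?_
    rw [hd.tail_addArc, hd.head_addArc]
    exact h

theorem exists_begin {σ : Type u} {start : Data V m → V → V → σ → Prop} {c : Config V m σ} (hs : c.search = none)
    (hm : c.done < m) (hstart : ∀ i : Fin m, i.val = c.done →
      c.data.lt (c.data.head a i) (c.data.tail a i) →
      ∃ T, start c.data (c.data.tail a i) (c.data.head a i) T) : ∃ c', Begin a start c c' := by
  by_cases h : c.data.lt (c.data.head a ⟨c.done, hm⟩) (c.data.tail a ⟨c.done, hm⟩)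
  · obtain ⟨T, hT⟩ := hstart ⟨c.done, hm⟩ rfl h
    exact ⟨_, .search c ⟨c.done, hm⟩ T hs rfl h hT⟩
  · exact ⟨_, .quiet c ⟨c.done, hm⟩ hs rfl h⟩

theorem GeneralStep.invariant {c c' : Config V m (Search V m)}
    (hc : Invariant a (Searching a) c) (h : GeneralStep a c c') :
    Invariant a (Searching a) c' := by
  cases h with
  | start _ h =>
    refine hc.begin h fun i T hT hd hd' hlt => ?_
    have := hd'.searching_start hlt
    rw [hd.tail_addArc, hd.head_addArc] at this
    rwa [hT]
  | forward S u e hs hu he he' hl =>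
    obtain ⟨i, hi, hS⟩ := hc.busy S hs
    refine ⟨hc.bounded, fun h => by simp at h, fun T' hT' => ⟨i, hi, ?_⟩⟩
    obtain rfl := Option.some.inj hT'
    exact (hS.traverse_out hu he hl).examine _
  | backward S u e hs hu he he' hl =>
    obtain ⟨i, hi, hS⟩ := hc.busy S hs
    refine ⟨hc.bounded, fun h => by simp at h, fun T' hT' => ⟨i, hi, ?_⟩⟩
    obtain rfl := Option.some.inj hT'
    exact (hS.traverse_inc hu he hl).examine _
  | asideF S u e hs hu he he' hl =>
    obtain ⟨i, hi, hS⟩ := hc.busy S hs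
    refine ⟨hc.bounded, fun h => by simp at h, fun T' hT' => ⟨i, hi, ?_⟩⟩
    obtain rfl := Option.some.inj hT'
    exact (hS.examine _).dropOut u (hS.isLoop_examine hl)
  | asideB S u e hs hu he he' hl =>
    obtain ⟨i, hi, hS⟩ := hc.busy S hs
    refine ⟨hc.bounded, fun h => by simp at h, fun T' hT' => ⟨i, hi, ?_⟩⟩
    obtain rfl := Option.some.inj hT'
    exact (hS.examine _).dropInc u (hS.isLoop_examine hl)
  | finish S i s hs hi hend d' n h =>
    obtain ⟨j, hj, hS⟩ := hc.busy S hs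
    obtain rfl : i = j := Fin.ext (hi.trans hj.symm)
    have hT := hend.stopped (X := S.F.filter fun x => c.data.lt x s)
      (Y := S.R.filter fun y => c.data.lt s y) (by simp) (by simp)
    refine ⟨by have := i.isLt; simp only; omega, fun _ => ?_, fun _ h => by simp at h⟩
    have := hS.rebuild_correct hT h
    rwa [hi] at this

theorem GeneralStep.invariant_of_reach {c c' : Config V m (Search V m)}
    (hc : Invariant a (Searching a) c) (h : ReflTransGen (GeneralStep a) c c') :
    Invariant a (Searching a) c' := by
  induction h with
  | refl => exact hc
  | tail _ h ih => exact h.invariant ih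

/-- A measure that decreases in each step of the general method. -/
def generalMeasure (c : Config V m (Search V m)) : ℕ ×ₗ ℕ :=
  toLex (2 * (m - c.done) + (if c.search = none then 1 else 0),
    match c.search with
    | none => 0
    | some S => (m - S.trF.card) + (m - S.trB.card) +
        ∑ x, (c.data.out x).card + ∑ x, (c.data.inc x).card)

theorem card_insert_arc {T : Finset (Fin m)} {e : Fin m} (he : e ∉ T) :
    (insert e T).card = T.card + 1 ∧ T.card + 1 ≤ m := by
  have h1 := Finset.card_insert_of_notMem he
  have h2 := Finset.card_le_univ (insert e T)
  rw [Fintype.card_fin] at h2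
  omega

theorem sum_card_update_erase_lt {f : V → Finset (Fin m)} {u : V} {e : Fin m} (he : e ∈ f u) :
    ∑ x, (Function.update f u ((f u).erase e) x).card < ∑ x, (f x).card := by
  refine Finset.sum_lt_sum (fun x _ => ?_) ⟨u, Finset.mem_univ u, ?_⟩
  · by_cases h : x = u
    · subst h; rw [Function.update_self]; exact Finset.card_le_card (Finset.erase_subset _ _)
    · rw [Function.update_of_ne h]
  · rw [Function.update_self]; exact Finset.card_erase_lt_of_mem he

/-- Starting a search gives up the extra 1 of an idle configuration, and finishing it regains this 1
but lowers the doubled number of missing arcs by 2. The steps in between traverse a new arc or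
delete one from an arc set. -/
theorem GeneralStep.measure_lt {c c' : Config V m (Search V m)} (h : GeneralStep a c c') :
    generalMeasure c' < generalMeasure c := by
  rw [Prod.Lex.lt_iff]
  cases h with
  | start _ h =>
    left
    cases h with
    | quiet i hs hi h =>
      have := i.isLt
      simp only [generalMeasure, hs, ofLex_toLex, if_true]
      omega
    | search i T hs hi h hT =>
      simp only [generalMeasure, hs, ofLex_toLex, if_true, reduceCtorEq, if_false]
      omega
  | forward S u e hs hu he he' hl =>
    right
    have := card_insert_arc he'
    simp only [generalMeasure, hs, ofLex_toLex, Data.examine, this.1, reduceCtorEq, if_false, true_and]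
    omega
  | backward S u e hs hu he he' hl =>
    right
    have := card_insert_arc he'
    simp only [generalMeasure, hs, ofLex_toLex, Data.examine, this.1, reduceCtorEq, if_false, true_and]
    omega
  | asideF S u e hs hu he he' hl =>
    right
    have := sum_card_update_erase_lt he
    simp only [generalMeasure, hs, ofLex_toLex, Data.examine, Data.dropOut, reduceCtorEq, if_false,
      true_and]
    omega
  | asideB S u e hs hu he he' hl =>
    right
    have := sum_card_update_erase_lt he
    simp only [generalMeasure, hs, ofLex_toLex, Data.examine, Data.dropInc, reduceCtorEq, if_false,
      true_and]
    omega
  | finish S i s hs hi hend d' n h =>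
    left
    have := i.isLt
    simp only [generalMeasure, hs, ofLex_toLex, if_true, reduceCtorEq, if_false]
    omega

theorem GeneralStep.exists_step {c : Config V m (Search V m)}
    (hc : Invariant a (Searching a) c) (h : c.search.isSome ∨ c.done < m) :
    ∃ c', GeneralStep a c c' := by
  cases hs : c.search with
  | none =>
    obtain ⟨c', h'⟩ := exists_begin (a := a)
      (start := fun _ v w S => S = Search.start v w) hs (by simpa [hs] using h)
      fun i _ _ => ⟨_, rfl⟩
    exact ⟨c', .start c c' h'⟩
  | some S =>
    obtain ⟨i, hi, hS⟩ := hc.busy S hs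
    -- Any vertex could be tested as a threshold: if the search may not stop there, some vertex has
    -- an untraversed arc and the search can go on.
    by_cases hend : S.Stop c.data (c.data.head a i)
    · obtain ⟨d', n, h⟩ := hS.exists_rebuild (hend.stopped
        (X := S.F.filter fun x => c.data.lt x (c.data.head a i))
        (Y := S.R.filter fun y => c.data.lt (c.data.head a i) y) (by simp) (by simp))
      exact ⟨_, .finish c S i _ hs hi hend d' n h⟩
    · rw [Search.Stop, not_and, not_and_or] at hend
      rcases hend (hS.sound.rep_mem_order _) with hend | hend
      · push Not at hend
        obtain ⟨u, hu, _, hsub⟩ := hend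
        obtain ⟨e, he, he'⟩ := Finset.not_subset.1 hsub
        by_cases hl : c.data.IsLoop a e
        · exact ⟨_, .asideF c S u e hs hu he he' hl⟩
        · exact ⟨_, .forward c S u e hs hu he he' hl⟩
      · push Not at hend
        obtain ⟨u, hu, _, hsub⟩ := hend
        obtain ⟨e, he, he'⟩ := Finset.not_subset.1 hsub
        by_cases hl : c.data.IsLoop a e
        · exact ⟨_, .asideB c S u e hs hu he he' hl⟩
        · exact ⟨_, .backward c S u e hs hu he he' hl⟩

theorem generalStep_maintains {o : List V} (ho : o.Nodup) (ho' : ∀ x, x ∈ o) :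
    Maintains a (GeneralStep a) (Config.empty o) where
  terminates := by
    have hwf : WellFounded fun c' c : Config V m (Search V m) => GeneralStep a c c' :=
      Subrelation.wf (fun h => h.measure_lt) (InvImage.wf generalMeasure wellFounded_lt)
    exact hwf.apply _
  progress c hc h := GeneralStep.exists_step
    (GeneralStep.invariant_of_reach (invariant_empty ho ho') hc) h
  bounded c hc := (GeneralStep.invariant_of_reach (invariant_empty ho ho') hc).bounded
  correct c hc h := (GeneralStep.invariant_of_reach (invariant_empty ho ho') hc).idle h

theorem generalStep_detects {o : List V} (ho : o.Nodup) (ho' : ∀ x, x ∈ o)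
    {c : Config V m (Search V m)} {S : Search V m} {i : Fin m} {s : V} {X Y : Finset V}
    (hc : ReflTransGen (GeneralStep a) (Config.empty o) c) (hs : c.search = some S)
    (hi : i.val = c.done) (hend : S.Stop c.data s)
    (hX : ∀ x, x ∈ X ↔ x ∈ S.F ∧ c.data.lt x s) (hY : ∀ y, y ∈ Y ↔ y ∈ S.R ∧ c.data.lt s y) :
    Detects a i c.data S X Y s := by
  obtain ⟨j, hj, hS⟩ := (GeneralStep.invariant_of_reach (invariant_empty ho ho') hc).busy S hs
  obtain rfl : i = j := Fin.ext (hi.trans hj.symm)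
  exact hS.detects (hend.stopped hX hY)

end GeneralMethod

/-! ### Compatible search with a soft threshold -/

section SoftSearch

variable {V : Type u} [Fintype V] {m : ℕ} {a : Fin m → V × V}

/-- The invariant of a compatible search for arc `i`. -/
structure SoftSearching (a : Fin m → V × V) (i : Fin m) (d : Data V m) (T : Soft V m) : Prop where
  base : Searching a i d T.toSearch
  trF_lt : ∀ e ∈ T.trF, e.val < i.val
  trB_lt : ∀ e ∈ T.trB, e.val < i.val
  A_sub : T.A ⊆ T.F
  B_sub : T.B ⊆ T.F
  X_sub : T.X ⊆ T.F
  C_sub : T.C ⊆ T.R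
  D_sub : T.D ⊆ T.R
  Y_sub : T.Y ⊆ T.R
  l_mem : T.l ∈ d.order
  h_mem : T.h ∈ d.order
  s_mem : T.s ∈ d.order
  head_le : d.le (d.head a i) T.l
  l_le : d.le T.l T.s
  s_le : d.le T.s T.h
  h_le : d.le T.h (d.tail a i)
  A_ge : ∀ u ∈ T.A, d.le T.l u
  B_ge : ∀ u ∈ T.B, d.le T.s u
  C_le : ∀ z ∈ T.C, d.le z T.h
  D_le : ∀ z ∈ T.D, d.le z T.s
  X_out : ∀ x ∈ T.X, d.out x ⊆ T.trF
  Y_inc : ∀ y ∈ T.Y, d.inc y ⊆ T.trB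
  F_cover : ∀ x ∈ T.F, x ∈ T.A ∨ x ∈ T.B ∨ x ∈ T.X ∨ d.le T.h x
  R_cover : ∀ y ∈ T.R, y ∈ T.C ∨ y ∈ T.D ∨ y ∈ T.Y ∨ d.le y T.l
  pairing : ∃ M : Finset (Fin m × Fin m), Set.InjOn Prod.fst (M : Set (Fin m × Fin m)) ∧
    Set.InjOn Prod.snd (M : Set (Fin m × Fin m)) ∧ M.image Prod.fst = T.trF ∧
    M.image Prod.snd = T.trB ∧ ∀ p ∈ M, d.lt (d.tail a p.1) (d.head a p.2)
  F_card : T.F.card ≤ T.trF.card + 1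
  R_card : T.R.card ≤ T.trB.card + 1

namespace SoftSearching

variable {i : Fin m} {d : Data V m} {T : Soft V m} (hT : SoftSearching a i d T)
include hT

/-- If the forward candidates are used up, the threshold is `h`. By `F_cover` every forward vertex
below `h` has been scanned. Backward candidates are at most `h`, and the discarded backward vertices
are at most `l ≤ h`, so those above `h` have been scanned too. The other case is symmetric with `l`.
-/
theorem stopped (h : T.Stop) : Stopped d T.toSearch (T.finalX d) (T.finalY d) T.final := by
  have hl := hT.l_le
  have hs := hT.s_le
  have hfX : ∀ x ∈ T.F, d.lt x T.final → x ∈ T.X := by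
    intro x hx hlt
    have hcov := hT.F_cover x hx
    simp only [Soft.final] at hlt
    split_ifs at hlt with hAB
    · rw [Finset.union_eq_empty] at hAB
      rw [hAB.1, hAB.2] at hcov
      rcases hcov with h | h | h | h
      · simp at h
      · simp at h
      · exact h
      · simp only [Data.lt, Data.le] at *; omega
    · rcases hcov with h | h | h | h
      · have := hT.A_ge x h; simp only [Data.lt, Data.le] at *; omega
      · have := hT.B_ge x h; simp only [Data.lt, Data.le] at *; omega
      · exact h
      · simp only [Data.lt, Data.le] at *; omega
  have hfY : ∀ y ∈ T.R, d.lt T.final y → y ∈ T.Y := by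
    intro y hy hlt
    have hcov := hT.R_cover y hy
    simp only [Soft.final] at hlt
    split_ifs at hlt with hAB
    · rcases hcov with h | h | h | h
      · have := hT.C_le y h; simp only [Data.lt, Data.le] at *; omega
      · have := hT.D_le y h; simp only [Data.lt, Data.le] at *; omega
      · exact h
      · simp only [Data.lt, Data.le] at *; omega
    · have hCD := h.resolve_left hAB
      rw [Finset.union_eq_empty] at hCD
      rw [hCD.1, hCD.2] at hcov
      rcases hcov with h | h | h | h
      · simp at h
      · simp at h
      · exact h
      · simp only [Data.lt, Data.le] at *; omega
  refine ⟨?_, fun x => ?_, fun y => ?_, fun x hx => ?_, fun y hy => ?_⟩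
  · rw [Soft.final]
    split_ifs
    · exact hT.h_mem
    · exact hT.l_mem
  · rw [Soft.finalX, Finset.mem_filter]
    exact ⟨fun h => ⟨hT.X_sub h.1, h.2⟩, fun h => ⟨hfX x h.1 h.2, h.2⟩⟩
  · rw [Soft.finalY, Finset.mem_filter]
    exact ⟨fun h => ⟨hT.Y_sub h.1, h.2⟩, fun h => ⟨hfY y h.1 h.2, h.2⟩⟩
  · exact hT.X_out x (Finset.mem_filter.1 hx).1
  · exact hT.Y_inc y (Finset.mem_filter.1 hy).1

theorem examine (es : List (Fin m)) : SoftSearching a i (d.examine a es) T := by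
  have ht := hT.base.sound.tail_examine es
  have hh := hT.base.sound.head_examine es
  exact { hT with
    base := hT.base.examine es
    head_le := by rw [hh]; exact hT.head_le
    h_le := by rw [ht]; exact hT.h_le
    pairing := by simp only [ht, hh]; exact hT.pairing }

theorem dropOut {e : Fin m} (u : V) (he : d.IsLoop a e) : SoftSearching a i (d.dropOut u e) T :=
  { hT with
    base := hT.base.dropOut u he
    X_out := fun x hx f hf => hT.X_out x hx (by
      simp only [Data.dropOut] at hf
      by_cases h : x = u
      · subst h
        rw [Function.update_self] at hf
        exact Finset.mem_of_mem_erase hf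
      · rwa [Function.update_of_ne h] at hf) }

theorem dropInc {e : Fin m} (u : V) (he : d.IsLoop a e) : SoftSearching a i (d.dropInc u e) T :=
  { hT with
    base := hT.base.dropInc u he
    Y_inc := fun x hx f hf => hT.Y_inc x hx (by
      simp only [Data.dropInc] at hf
      by_cases h : x = u
      · subst h
        rw [Function.update_self] at hf
        exact Finset.mem_of_mem_erase hf
      · rwa [Function.update_of_ne h] at hf) }

theorem root_F {u : V} (hu : u ∈ T.F) : u ∈ d.order :=
  (hT.base.sound.mem_order u).2 (hT.base.F u hu).1

theorem root_R {u : V} (hu : u ∈ T.R) : u ∈ d.order :=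
  (hT.base.sound.mem_order u).2 (hT.base.R u hu).1

/-- A vertex below `h` is below the tail of the new arc, so arc `i` does not leave it. Thus
compatible search traverses only old arcs, unlike the general search. -/
theorem out_lt {u : V} (hu : u ∈ T.A) (h : d.lt u T.h) {e : Fin m} (he : e ∈ d.out u) :
    e.val < i.val ∧ d.tail a e = u := by
  obtain ⟨h1, h2⟩ := hT.base.sound.of_mem_out u (hT.base.F u (hT.A_sub hu)).1 e he
  refine ⟨(Nat.lt_succ_iff_lt_or_eq.1 h1).resolve_right fun hei => ?_, h2⟩
  obtain rfl := Fin.ext hei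
  have := hT.h_le
  rw [h2] at this
  simp only [Data.lt, Data.le] at *; omega

theorem inc_lt {z : V} (hz : z ∈ T.C) (h : d.lt T.l z) {e : Fin m} (he : e ∈ d.inc z) :
    e.val < i.val ∧ d.head a e = z := by
  obtain ⟨h1, h2⟩ := hT.base.sound.of_mem_inc z (hT.base.R z (hT.C_sub hz)).1 e he
  refine ⟨(Nat.lt_succ_iff_lt_or_eq.1 h1).resolve_right fun hei => ?_, h2⟩
  obtain rfl := Fin.ext hei
  have := hT.head_le
  rw [h2] at this
  simp only [Data.lt, Data.le] at *; omega

theorem eraseA {u : V} (hu : u ∈ T.A) (h : d.le T.h u) :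
    SoftSearching a i d { T with A := T.A.erase u } :=
  { hT with
    A_sub := (Finset.erase_subset _ _).trans hT.A_sub
    A_ge := fun x hx => hT.A_ge x (Finset.mem_of_mem_erase hx)
    F_cover := fun x hx => by
      by_cases hxu : x = u
      · subst hxu; exact .inr (.inr (.inr h))
      · simpa [hxu] using hT.F_cover x hx }

theorem eraseC {z : V} (hz : z ∈ T.C) (h : d.le z T.l) :
    SoftSearching a i d { T with C := T.C.erase z } :=
  { hT with
    C_sub := (Finset.erase_subset _ _).trans hT.C_sub
    C_le := fun x hx => hT.C_le x (Finset.mem_of_mem_erase hx)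
    R_cover := fun x hx => by
      by_cases hxu : x = z
      · subst hxu; exact .inr (.inr (.inr h))
      · simpa [hxu] using hT.R_cover x hx }

theorem moveB {u : V} (hu : u ∈ T.A) (h : d.le T.s u) :
    SoftSearching a i d { T with A := T.A.erase u, B := insert u T.B } :=
  { hT with
    A_sub := (Finset.erase_subset _ _).trans hT.A_sub
    B_sub := Finset.insert_subset (hT.A_sub hu) hT.B_sub
    A_ge := fun x hx => hT.A_ge x (Finset.mem_of_mem_erase hx)
    B_ge := fun x hx => by
      rcases Finset.mem_insert.1 hx with rfl | hx
      · exact h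
      · exact hT.B_ge x hx
    F_cover := fun x hx => by
      by_cases hxu : x = u
      · subst hxu; simp
      · simpa [hxu] using hT.F_cover x hx }

theorem moveD {z : V} (hz : z ∈ T.C) (h : d.le z T.s) :
    SoftSearching a i d { T with C := T.C.erase z, D := insert z T.D } :=
  { hT with
    C_sub := (Finset.erase_subset _ _).trans hT.C_sub
    D_sub := Finset.insert_subset (hT.C_sub hz) hT.D_sub
    C_le := fun x hx => hT.C_le x (Finset.mem_of_mem_erase hx)
    D_le := fun x hx => by
      rcases Finset.mem_insert.1 hx with rfl | hx
      · exact h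
      · exact hT.D_le x hx
    R_cover := fun x hx => by
      by_cases hxu : x = z
      · subst hxu; simp
      · simpa [hxu] using hT.R_cover x hx }

theorem moveX {u : V} (hu : u ∈ T.A) (h : d.out u ⊆ T.trF) :
    SoftSearching a i d { T with A := T.A.erase u, X := insert u T.X } :=
  { hT with
    A_sub := (Finset.erase_subset _ _).trans hT.A_sub
    X_sub := Finset.insert_subset (hT.A_sub hu) hT.X_sub
    A_ge := fun x hx => hT.A_ge x (Finset.mem_of_mem_erase hx)
    X_out := fun x hx => by
      rcases Finset.mem_insert.1 hx with rfl | hx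
      · exact h
      · exact hT.X_out x hx
    F_cover := fun x hx => by
      by_cases hxu : x = u
      · subst hxu; simp
      · simpa [hxu] using hT.F_cover x hx }

theorem moveY {z : V} (hz : z ∈ T.C) (h : d.inc z ⊆ T.trB) :
    SoftSearching a i d { T with C := T.C.erase z, Y := insert z T.Y } :=
  { hT with
    C_sub := (Finset.erase_subset _ _).trans hT.C_sub
    Y_sub := Finset.insert_subset (hT.C_sub hz) hT.Y_sub
    C_le := fun x hx => hT.C_le x (Finset.mem_of_mem_erase hx)
    Y_inc := fun x hx => by
      rcases Finset.mem_insert.1 hx with rfl | hx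
      · exact h
      · exact hT.Y_inc x hx
    R_cover := fun x hx => by
      by_cases hxu : x = z
      · subst hxu; simp
      · simpa [hxu] using hT.R_cover x hx }

/-- Far candidates are at least the old `s`, which becomes `l`, so they qualify as near ones. The
new soft threshold is not less than the old one, which keeps the far backward candidates below it.
-/
theorem refillF (hA : T.A = ∅) {t : V} (ht : t ∈ T.B) :
    SoftSearching a i d
      { T with A := T.B, B := ∅, l := T.s, s := if d.le t T.h then t else T.h } :=
  { hT with
    A_sub := hT.B_sub
    B_sub := by simp
    l_mem := hT.s_mem
    s_mem := by
      simp only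
      split_ifs
      · exact hT.root_F (hT.B_sub ht)
      · exact hT.h_mem
    head_le := hT.head_le.trans hT.l_le
    l_le := by
      simp only
      split_ifs
      · exact hT.B_ge t ht
      · exact hT.s_le
    s_le := by
      simp only
      split_ifs with h
      · exact h
      · exact le_refl _
    A_ge := hT.B_ge
    B_ge := by simp
    D_le := fun z hz => (hT.D_le z hz).trans (by
      simp only
      split_ifs
      · exact hT.B_ge t ht
      · exact hT.s_le)
    F_cover := fun x hx => by
      rcases hT.F_cover x hx with h | h | h | h
      · simp [hA] at h
      · exact .inl h
      · exact .inr (.inr (.inl h))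
      · exact .inr (.inr (.inr h))
    R_cover := fun y hy => by
      rcases hT.R_cover y hy with h | h | h | h
      · exact .inl h
      · exact .inr (.inl h)
      · exact .inr (.inr (.inl h))
      · exact .inr (.inr (.inr (h.trans hT.l_le))) }

theorem refillB (hC : T.C = ∅) {t : V} (ht : t ∈ T.D) :
    SoftSearching a i d
      { T with C := T.D, D := ∅, h := T.s, s := if d.le T.l t then t else T.l } :=
  { hT with
    C_sub := hT.D_sub
    D_sub := by simp
    h_mem := hT.s_mem
    s_mem := by
      simp only
      split_ifs
      · exact hT.root_R (hT.D_sub ht)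
      · exact hT.l_mem
    h_le := hT.s_le.trans hT.h_le
    s_le := by
      simp only
      split_ifs
      · exact hT.D_le t ht
      · exact hT.l_le
    l_le := by
      simp only
      split_ifs with h
      · exact h
      · exact le_refl _
    C_le := hT.D_le
    D_le := by simp
    B_ge := fun z hz => le_trans (by
      simp only
      split_ifs
      · exact hT.D_le t ht
      · exact hT.l_le) (hT.B_ge z hz)
    R_cover := fun x hx => by
      rcases hT.R_cover x hx with h | h | h | h
      · simp [hC] at h
      · exact .inl h
      · exact .inr (.inr (.inl h))
      · exact .inr (.inr (.inr h))
    F_cover := fun y hy => by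
      rcases hT.F_cover y hy with h | h | h | h
      · exact .inl h
      · exact .inr (.inl h)
      · exact .inr (.inr (.inl h))
      · exact .inr (.inr (.inr (hT.s_le.trans h))) }

/-- The two arcs become a new element of the pairing, which records the compatibility `u < z` for
the count of related pairs. Each side gains at most one vertex per arc, so the numbers of forward
and backward vertices are bounded by the numbers of arcs. -/
theorem traverse {u z : V} {e e' : Fin m} (huz : T.Pair d u z)
    (he : e ∈ d.out u) (heT : e ∉ T.trF) (hle : ¬ d.IsLoop a e)
    (he' : e' ∈ d.inc z) (heT' : e' ∉ T.trB) (hle' : ¬ d.IsLoop a e') :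
    SoftSearching a i d { T with
      F := insert (d.head a e) T.F
      R := insert (d.tail a e') T.R
      trF := insert e T.trF
      trB := insert e' T.trB
      A := if d.head a e ∈ T.F then T.A else insert (d.head a e) T.A
      C := if d.tail a e' ∈ T.R then T.C else insert (d.tail a e') T.C } := by
  obtain ⟨hu, hz, huh, hlz, hlt⟩ := huz
  obtain ⟨h1, h2⟩ := hT.out_lt hu huh he
  obtain ⟨h3, h4⟩ := hT.inc_lt hz hlz he'
  have h5 := hT.base.sound.topological e h1 hle
  have h6 := hT.base.sound.topological e' h3 hle'
  rw [h2] at h5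
  rw [h4] at h6
  have h7 : d.le T.l (d.head a e) := (hT.A_ge u hu).trans (le_of_lt h5)
  have h8 : d.le (d.tail a e') T.h := le_trans (le_of_lt h6) (hT.C_le z hz)
  exact { hT with
    base := (hT.base.traverse_out (hT.A_sub hu) he hle).traverse_inc (hT.C_sub hz) he' hle'
    trF_lt := fun f hf => by
      rcases Finset.mem_insert.1 hf with rfl | hf
      · exact h1
      · exact hT.trF_lt f hf
    trB_lt := fun f hf => by
      rcases Finset.mem_insert.1 hf with rfl | hf
      · exact h3
      · exact hT.trB_lt f hf
    A_sub := by
      simp only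
      split_ifs
      · exact hT.A_sub.trans (Finset.subset_insert _ _)
      · exact Finset.insert_subset_insert _ hT.A_sub
    B_sub := hT.B_sub.trans (Finset.subset_insert _ _)
    X_sub := hT.X_sub.trans (Finset.subset_insert _ _)
    C_sub := by
      simp only
      split_ifs
      · exact hT.C_sub.trans (Finset.subset_insert _ _)
      · exact Finset.insert_subset_insert _ hT.C_sub
    D_sub := hT.D_sub.trans (Finset.subset_insert _ _)
    Y_sub := hT.Y_sub.trans (Finset.subset_insert _ _)
    A_ge := fun x hx => by
      simp only at hx
      split_ifs at hx
      · exact hT.A_ge x hx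
      · rcases Finset.mem_insert.1 hx with rfl | hx
        · exact h7
        · exact hT.A_ge x hx
    C_le := fun x hx => by
      simp only at hx
      split_ifs at hx
      · exact hT.C_le x hx
      · rcases Finset.mem_insert.1 hx with rfl | hx
        · exact h8
        · exact hT.C_le x hx
    X_out := fun x hx => (hT.X_out x hx).trans (Finset.subset_insert _ _)
    Y_inc := fun x hx => (hT.Y_inc x hx).trans (Finset.subset_insert _ _)
    F_cover := fun x hx => by
      have hcov := hT.F_cover x
      simp only at hx ⊢
      split_ifs with h
      · rw [Finset.insert_eq_of_mem h] at hx
        exact hcov hx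
      · rcases Finset.mem_insert.1 hx with rfl | hx
        · simp
        · rcases hcov hx with h | h
          · exact .inl (Finset.mem_insert_of_mem h)
          · exact .inr h
    R_cover := fun x hx => by
      have hcov := hT.R_cover x
      simp only at hx ⊢
      split_ifs with h
      · rw [Finset.insert_eq_of_mem h] at hx
        exact hcov hx
      · rcases Finset.mem_insert.1 hx with rfl | hx
        · simp
        · rcases hcov hx with h | h
          · exact .inl (Finset.mem_insert_of_mem h)
          · exact .inr h
    pairing := by
      obtain ⟨M, hM1, hM2, hMF, hMB, hM⟩ := hT.pairing
      have n1 : ∀ p ∈ M, p.1 ≠ e := fun p hp h => heT (by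
        rw [← hMF]; exact Finset.mem_image.2 ⟨p, hp, h⟩)
      have n2 : ∀ p ∈ M, p.2 ≠ e' := fun p hp h => heT' (by
        rw [← hMB]; exact Finset.mem_image.2 ⟨p, hp, h⟩)
      refine ⟨insert (e, e') M, ?_, ?_, ?_, ?_, ?_⟩
      · rw [Finset.coe_insert, Set.injOn_insert fun h => n1 _ h rfl]
        exact ⟨hM1, fun ⟨p, hp, h⟩ => n1 p hp h⟩
      · rw [Finset.coe_insert, Set.injOn_insert fun h => n1 _ h rfl]
        exact ⟨hM2, fun ⟨p, hp, h⟩ => n2 p hp h⟩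
      · rw [Finset.image_insert, hMF]
      · rw [Finset.image_insert, hMB]
      · intro p hp
        rcases Finset.mem_insert.1 hp with rfl | hp
        · simp only [h2, h4]; exact hlt
        · exact hM p hp
    F_card := by
      have e1 := Finset.card_insert_le (d.head a e) T.F
      have e2 := Finset.card_insert_of_notMem heT
      have e3 := hT.F_card
      simp only
      omega
    R_card := by
      have e1 := Finset.card_insert_le (d.tail a e') T.R
      have e2 := Finset.card_insert_of_notMem heT'
      have e3 := hT.R_card
      simp only
      omega }

end SoftSearching

theorem Searching.soft_start {i : Fin m} {d : Data V m} {T : Soft V m}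
    (hS : Searching a i d (Search.start (d.tail a i) (d.head a i)))
    (h : Soft.Start d (d.tail a i) (d.head a i) T) : SoftSearching a i d T := by
  obtain ⟨s, hs, h1, h2, rfl⟩ := h
  exact
  { base := hS
    trF_lt := by simp [Search.start]
    trB_lt := by simp [Search.start]
    A_sub := by simp [Search.start]
    B_sub := by simp
    X_sub := by simp
    C_sub := by simp [Search.start]
    D_sub := by simp
    Y_sub := by simp
    l_mem := hS.sound.rep_mem_order _
    h_mem := hS.sound.rep_mem_order _
    s_mem := hs
    head_le := le_refl _
    l_le := h1
    s_le := h2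
    h_le := le_refl _
    A_ge := by simp [Data.le]
    B_ge := by simp
    C_le := by simp [Data.le]
    D_le := by simp
    X_out := by simp
    Y_inc := by simp
    F_cover := by simp [Search.start]
    R_cover := by simp [Search.start]
    pairing := ⟨∅, by simp [Search.start]⟩
    F_card := by simp [Search.start]
    R_card := by simp [Search.start] }

theorem PlainStep.invariant {c c' : Config V m (Soft V m)}
    (hc : Invariant a (SoftSearching a) c) (h : PlainStep a c c') :
    Invariant a (SoftSearching a) c' := by
  have key : ∀ {T : Soft V m} {d' : Data V m} {T' : Soft V m} {k : ℕ}, c.search = some T →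
      (∀ i, SoftSearching a i c.data T → SoftSearching a i d' T') →
      Invariant a (SoftSearching a) ⟨c.done, d', some T', k⟩ := by
    intro T d' T' k hs h
    obtain ⟨i, hi, hT⟩ := hc.busy T hs
    refine ⟨hc.bounded, fun h => by simp at h, fun T'' hT'' => ⟨i, hi, ?_⟩⟩
    obtain rfl := Option.some.inj hT''
    exact h i hT
  cases h with
  | start _ h =>
    refine hc.begin h fun i T hT hd hd' hlt => ?_
    have := hd'.searching_start hlt
    refine Searching.soft_start this ?_
    rw [hd.tail_addArc, hd.head_addArc]
    exact hT
  | case2f T u z hs hu hz h => exact key hs fun i hT => hT.eraseA hu h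
  | case2b T u z hs hu hz h => exact key hs fun i hT => hT.eraseC hz h
  | case3f T u z hs hu hz _ _ _ h => exact key hs fun i hT => hT.moveB hu h
  | case3b T u z hs hu hz _ _ _ h => exact key hs fun i hT => hT.moveD hz h
  | case4f T u z hs huz h => exact key hs fun i hT => hT.moveX huz.1 h
  | case4b T u z hs huz h => exact key hs fun i hT => hT.moveY huz.2.1 h
  | asideF T u z e hs huz hz he he' hl =>
    exact key hs fun i hT => (hT.examine _).dropOut u (hT.base.isLoop_examine hl)
  | asideB T u z e hs huz hz he he' hl =>
    exact key hs fun i hT => (hT.examine _).dropInc z (hT.base.isLoop_examine hl)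
  | case5 T u z e e' x y hs huz he heT hle he' heT' hle' hx hy =>
    subst hx hy
    exact key hs fun i hT => (hT.traverse huz he heT hle he' heT' hle').examine _
  | finish T i hs hi hend d' n h =>
    obtain ⟨j, hj, hT⟩ := hc.busy T hs
    obtain rfl : i = j := Fin.ext (hi.trans hj.symm)
    refine ⟨by have := i.isLt; simp only; omega, fun _ => ?_, fun _ h => by simp at h⟩
    have := hT.base.rebuild_correct (hT.stopped hend) h
    rwa [hi] at this

theorem CanRefillF.invariant {c : Config V m (Soft V m)} {T : Soft V m} {t : V}
    (hc : Invariant a (SoftSearching a) c) (h : CanRefillF c T) (ht : t ∈ T.B) :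
    Invariant a (SoftSearching a) (refillF c T t) := by
  obtain ⟨i, hi, hT⟩ := hc.busy T h.1
  refine ⟨hc.bounded, fun h => by simp [refillF, Config.set] at h, fun T' hT' => ⟨i, hi, ?_⟩⟩
  obtain rfl := Option.some.inj hT'
  exact hT.refillF h.2.2.1 ht

theorem CanRefillB.invariant {c : Config V m (Soft V m)} {T : Soft V m} {t : V}
    (hc : Invariant a (SoftSearching a) c) (h : CanRefillB c T) (ht : t ∈ T.D) :
    Invariant a (SoftSearching a) (refillB c T t) := by
  obtain ⟨i, hi, hT⟩ := hc.busy T h.1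
  refine ⟨hc.bounded, fun h => by simp [refillB, Config.set] at h, fun T' hT' => ⟨i, hi, ?_⟩⟩
  obtain rfl := Option.some.inj hT'
  exact hT.refillB h.2.2.1 ht

theorem SoftStep.invariant {rule : List V → Finset V → V → Prop} {c c' : Config V m (Soft V m)}
    (hc : Invariant a (SoftSearching a) c) (h : SoftStep a rule c c') :
    Invariant a (SoftSearching a) c' := by
  cases h with
  | plain _ h => exact h.invariant hc
  | case1f T t h ht _ => exact h.invariant hc ht
  | case1b T t h ht _ => exact h.invariant hc ht

theorem SoftStep.invariant_of_reach {rule : List V → Finset V → V → Prop}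
    {c c' : Config V m (Soft V m)} (hc : Invariant a (SoftSearching a) c)
    (h : ReflTransGen (SoftStep a rule) c c') : Invariant a (SoftSearching a) c' := by
  induction h with
  | refl => exact hc
  | tail _ h ih => exact h.invariant ih

theorem SoftStep.exists_step {rule : List V → Finset V → V → Prop}
    (hrule : ∀ (o : List V) (S : Finset V), S.Nonempty → ∃ t ∈ S, rule o S t)
    {c : Config V m (Soft V m)} (hc : Invariant a (SoftSearching a) c)
    (h : c.search.isSome ∨ c.done < m) : ∃ c', SoftStep a rule c c' := by
  cases hs : c.search with
  | none =>
    obtain ⟨c', h'⟩ := exists_begin (a := a) (start := Soft.Start) hs (by simpa [hs] using h)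
      fun i hi hlt => by
        have hd : Sound a c.done c.done c.data := correct_iff.1 (hc.idle hs)
        exact ⟨_, c.data.head a i, hd.rep_mem_order _, le_refl _, le_of_lt hlt, rfl⟩
    exact ⟨c', .plain c c' (.start c c' h')⟩
  | some T =>
    obtain ⟨i, hi, hT⟩ := hc.busy T hs
    by_cases hend : T.Stop
    · obtain ⟨d', n, h⟩ := hT.base.exists_rebuild (hT.stopped hend)
      exact ⟨_, .plain _ _ (.finish c T i hs hi hend d' n h)⟩
    have hend' := hend
    rw [Soft.Stop, not_or, Finset.union_eq_empty, Finset.union_eq_empty] at hend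
    by_cases hA : T.A = ∅
    · have hB : T.B.Nonempty := Finset.nonempty_iff_ne_empty.2 fun h => hend.1 ⟨hA, h⟩
      obtain ⟨t, ht, hr⟩ := hrule c.data.order T.B hB
      exact ⟨_, .case1f c T t ⟨hs, hend', hA, hB⟩ ht hr⟩
    by_cases hC : T.C = ∅
    · have hD : T.D.Nonempty := Finset.nonempty_iff_ne_empty.2 fun h => hend.2 ⟨hC, h⟩
      obtain ⟨t, ht, hr⟩ := hrule c.data.order T.D hD
      exact ⟨_, .case1b c T t ⟨hs, hend', hC, hD⟩ ht hr⟩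
    obtain ⟨u, hu⟩ := Finset.nonempty_iff_ne_empty.2 hA
    obtain ⟨z, hz⟩ := Finset.nonempty_iff_ne_empty.2 hC
    by_cases h2f : c.data.le T.h u
    · exact ⟨_, .plain _ _ (.case2f c T u z hs hu hz h2f)⟩
    by_cases h2b : c.data.le z T.l
    · exact ⟨_, .plain _ _ (.case2b c T u z hs hu hz h2b)⟩
    have huh : c.data.lt u T.h := not_le.1 h2f
    have hlz : c.data.lt T.l z := not_le.1 h2b
    by_cases hzu : c.data.le z u
    · by_cases hsu : c.data.le T.s u
      · exact ⟨_, .plain _ _ (.case3f c T u z hs hu hz huh hlz hzu hsu)⟩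
      · refine ⟨_, .plain _ _ (.case3b c T u z hs hu hz huh hlz hzu ?_)⟩
        simp only [Data.le] at hzu hsu ⊢; omega
    have hp : T.Pair c.data u z := ⟨hu, hz, huh, hlz, not_le.1 hzu⟩
    by_cases h4f : c.data.out u ⊆ T.trF
    · exact ⟨_, .plain _ _ (.case4f c T u z hs hp h4f)⟩
    by_cases h4b : c.data.inc z ⊆ T.trB
    · exact ⟨_, .plain _ _ (.case4b c T u z hs hp h4b)⟩
    obtain ⟨e, he, heT⟩ := Finset.not_subset.1 h4f
    obtain ⟨e', he', heT'⟩ := Finset.not_subset.1 h4b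
    by_cases hl : c.data.IsLoop a e
    · exact ⟨_, .plain _ _ (.asideF c T u z e hs hp h4b he heT hl)⟩
    by_cases hl' : c.data.IsLoop a e'
    · exact ⟨_, .plain _ _ (.asideB c T u z e' hs hp h4f he' heT' hl')⟩
    exact ⟨_, .plain _ _ (.case5 c T u z e e' _ _ hs hp he heT hl he' heT' hl' rfl rfl)⟩

theorem softStep_detects {rule : List V → Finset V → V → Prop} {o : List V} (ho : o.Nodup)
    (ho' : ∀ x, x ∈ o) {c : Config V m (Soft V m)} {T : Soft V m} {i : Fin m}
    (hc : ReflTransGen (SoftStep a rule) (Config.empty o) c) (hs : c.search = some T)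
    (hi : i.val = c.done) (hend : T.Stop) :
    Detects a i c.data T.toSearch (T.finalX c.data) (T.finalY c.data) T.final := by
  obtain ⟨j, hj, hT⟩ := (SoftStep.invariant_of_reach (invariant_empty ho ho') hc).busy T hs
  obtain rfl : i = j := Fin.ext (hi.trans hj.symm)
  exact hT.base.detects (hT.stopped hend)

end SoftSearch

/-! ### Related pairs of arcs -/

section Related

variable {V : Type u} [Fintype V] {m : ℕ} {a : Fin m → V × V}

/-- Two arcs are related if they are on a common path. -/
def Related (a : Fin m → V × V) (k : ℕ) (e f : Fin m) : Prop :=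
  e.val < k ∧ f.val < k ∧ (Reach a k (a e).2 (a f).1 ∨ Reach a k (a f).2 (a e).1)

/-- An arc is internal if its ends are in the same strong component. -/
def Internal (a : Fin m → V × V) (k : ℕ) (e : Fin m) : Prop :=
  e.val < k ∧ Reach a k (a e).2 (a e).1

/-- The number of related pairs plus the number of pairs of internal arcs. -/
def pairCount (a : Fin m → V × V) (k : ℕ) : ℕ :=
  ∑ p : Fin m × Fin m, ((if Related a k p.1 p.2 then 1 else 0) +
    if Internal a k p.1 ∧ Internal a k p.2 then 1 else 0)

theorem Related.mono {k l : ℕ} (hkl : k ≤ l) {e f : Fin m} (h : Related a k e f) :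
    Related a l e f :=
  ⟨h.1.trans_le hkl, h.2.1.trans_le hkl, h.2.2.imp (Reach.mono hkl) (Reach.mono hkl)⟩

theorem Internal.mono {k l : ℕ} (hkl : k ≤ l) {e : Fin m} (h : Internal a k e) :
    Internal a l e := ⟨h.1.trans_le hkl, h.2.mono hkl⟩

theorem pairCount_le (k : ℕ) : pairCount a k ≤ 2 * m ^ 2 := by
  have h : pairCount a k ≤ ∑ _p : Fin m × Fin m, 2 :=
    Finset.sum_le_sum fun p _ => by split_ifs <;> omega
  simp only [Finset.sum_const, Finset.card_univ, Fintype.card_prod, Fintype.card_fin,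
    smul_eq_mul] at h
  calc _ ≤ _ := h
    _ = _ := by ring

/-- Both terms are monotone in the number of arcs. A pair of `P` gains at least one unit: it becomes
related, or it was related already and becomes a pair of internal arcs, which it was not before. -/
theorem pairCount_add_card_le {k l : ℕ} (hkl : k ≤ l) (P : Finset (Fin m × Fin m))
    (hP : ∀ p ∈ P, Related a l p.1 p.2 ∧ (Related a k p.1 p.2 →
      (Internal a l p.1 ∧ Internal a l p.2) ∧ ¬ Internal a k p.1)) :
    pairCount a k + P.card ≤ pairCount a l := by
  have hsplit : ∀ k, pairCount a k = _ := fun k =>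
    (Finset.sum_filter_add_sum_filter_not Finset.univ (· ∈ P) _).symm
  rw [Finset.card_eq_sum_ones, hsplit k, hsplit l]
  have e : (Finset.univ.filter (· ∈ P)) = P := by ext; simp
  rw [e, add_right_comm, ← Finset.sum_add_distrib]
  refine add_le_add (Finset.sum_le_sum fun p hp => ?_) (Finset.sum_le_sum fun p _ => ?_)
  · obtain ⟨h1, h2⟩ := hP p hp
    rw [if_pos h1]
    by_cases h : Related a k p.1 p.2
    · rw [if_pos h, if_neg fun h' => (h2 h).2 h'.1, if_pos (h2 h).1]
    · rw [if_neg h]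
      by_cases h' : Internal a k p.1 ∧ Internal a k p.2
      · rw [if_pos h', if_pos ⟨h'.1.mono hkl, h'.2.mono hkl⟩]
      · rw [if_neg h']; omega
  · have h1 : Related a k p.1 p.2 → Related a l p.1 p.2 := Related.mono hkl
    have h2 : (Internal a k p.1 ∧ Internal a k p.2) → (Internal a l p.1 ∧ Internal a l p.2) :=
      fun h => ⟨h.1.mono hkl, h.2.mono hkl⟩
    split_ifs <;> first | omega | (exfalso; tauto)

namespace SoftSearching

variable {i : Fin m} {d : Data V m} {T : Soft V m} (hT : SoftSearching a i d T)
include hT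

/-- The new arc completes a path from `f` to `e`. If the arcs were related before, the order
excludes an old path from `f` to `e`. An old path from `e` to `f` closes a cycle through both arcs,
while `e`, not being a loop, was not internal. -/
theorem related_of_lt {e f : Fin m} (he : e ∈ T.trF) (hf : f ∈ T.trB)
    (h : d.lt (d.tail a e) (d.head a f)) :
    Related a (i.val + 1) e f ∧ (Related a i.val e f →
      (Internal a (i.val + 1) e ∧ Internal a (i.val + 1) f) ∧ ¬ Internal a i.val e) := by
  have hd := hT.base.sound
  have hei := hT.trF_lt e he
  have hfi := hT.trB_lt f hf
  obtain ⟨_, hel, heF, _⟩ := hT.base.trF e he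
  obtain ⟨_, _, _, hfR⟩ := hT.base.trB f hf
  have h1 : Reach a i.val (a i).2 (a e).1 := (hT.base.F _ heF).2.trans (hd.rep_reach _)
  have h2 : Reach a i.val (a f).2 (a i).1 := (hd.reach_rep _).trans (hT.base.R _ hfR).2
  refine ⟨⟨by omega, by omega, .inr ((reach_succ i).2 (.inr ⟨h2, h1⟩))⟩, fun hr => ?_⟩
  rcases hr.2.2 with hr | hr
  · have h3 : Reach a i.val (a e).2 (a i).1 := (hr.trans (Reach.arc hfi)).trans h2
    have h4 : Reach a i.val (a i).2 (a f).1 := (h1.trans (Reach.arc hei)).trans hr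
    exact ⟨⟨⟨by omega, (reach_succ i).2 (.inr ⟨h3, h1⟩)⟩, ⟨by omega,
      (reach_succ i).2 (.inr ⟨h2, h4⟩)⟩⟩, fun h5 =>
        hel ((hd.component _ _).2 ⟨Reach.arc hei, h5.2⟩)⟩
  · have := hd.rep_le_of_reach hr
    simp only [Data.lt, Data.le, Data.tail, Data.head] at this h
    omega

theorem trB_card : T.trB.card = T.trF.card := by
  obtain ⟨M, h1, h2, h3, h4, _⟩ := hT.pairing
  rw [← h3, ← h4, Finset.card_image_of_injOn h1, Finset.card_image_of_injOn h2]

/-- For two elements `p`, `q` of the pairing, `p.1` with `q.2` or `q.1` with `p.2` satisfies the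
order condition: if both failed, the conditions for `p` and `q` themselves would give a cyclic chain
of inequalities. So at least half of all combinations increase `pairCount`. -/
theorem sq_card_le : T.trF.card ^ 2 + 2 * pairCount a i.val ≤ 2 * pairCount a (i.val + 1) := by
  obtain ⟨M, hM1, hM2, hMF, hMB, hM⟩ := hT.pairing
  set f : (Fin m × Fin m) × (Fin m × Fin m) → Fin m × Fin m := fun q => (q.1.1, q.2.2) with hf
  have hcard : T.trF.card = M.card := by rw [← hMF, Finset.card_image_of_injOn hM1]
  set R : (Fin m × Fin m) × (Fin m × Fin m) → Prop :=
    fun q => d.lt (d.tail a q.1.1) (d.head a q.2.2) with hR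
  -- The combinations yield different pairs of arcs because an arc determines its element of the
  -- pairing.
  have hinj : Set.InjOn f ((M ×ˢ M).filter R : Finset _) := by
    intro q hq q' hq' h
    simp only [Finset.coe_filter, Finset.mem_product, Set.mem_ofPred_eq] at hq hq'
    simp only [hf, Prod.mk.injEq] at h
    exact Prod.ext (hM1 hq.1.1 hq'.1.1 h.1) (hM2 hq.1.2 hq'.1.2 h.2)
  have h1 : M.card ^ 2 ≤ 2 * ((M ×ˢ M).filter R).card := by
    have hswap : (((M ×ˢ M).filter R).image Prod.swap).card = ((M ×ˢ M).filter R).card :=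
      Finset.card_image_of_injective _ Prod.swap_injective
    have hsub : M ×ˢ M ⊆ (M ×ˢ M).filter R ∪ ((M ×ˢ M).filter R).image Prod.swap := by
      rintro ⟨p, q⟩ hpq
      have hpq' := Finset.mem_product.1 hpq
      have e1 := hM p hpq'.1
      have e2 := hM q hpq'.2
      rw [Finset.mem_union]
      by_cases h : R (p, q)
      · exact .inl (Finset.mem_filter.2 ⟨hpq, h⟩)
      · refine .inr (Finset.mem_image.2 ⟨(q, p), Finset.mem_filter.2
          ⟨Finset.mem_product.2 hpq'.symm, ?_⟩, rfl⟩)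
        simp only [hR, Data.lt] at h e1 e2 ⊢
        omega
    have := (Finset.card_le_card hsub).trans (Finset.card_union_le _ _)
    rw [Finset.card_product, hswap] at this
    rw [sq]
    omega
  have h2 := pairCount_add_card_le (a := a) (Nat.le_succ i.val) (((M ×ˢ M).filter R).image f) (by
    intro p hp
    obtain ⟨q, hq, rfl⟩ := Finset.mem_image.1 hp
    obtain ⟨hq, hRq⟩ := Finset.mem_filter.1 hq
    have hq' := Finset.mem_product.1 hq
    exact hT.related_of_lt (by rw [← hMF]; exact Finset.mem_image.2 ⟨q.1, hq'.1, rfl⟩)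
      (by rw [← hMB]; exact Finset.mem_image.2 ⟨q.2, hq'.2, rfl⟩) hRq)
  rw [Finset.card_image_of_injOn hinj] at h2
  rw [hcard]
  have h3 : i.val.succ = i.val + 1 := rfl
  rw [h3] at h2
  omega

end SoftSearching

end Related

/-! ### Arcs that have not been put aside, and the potential of the forest -/

section DataPotential

variable {V : Type u} [Fintype V] {m : ℕ} {a : Fin m → V × V}

/-- The number of times that an arc can still be put aside, if `n` arcs have been inserted. -/
def liveCount (a : Fin m → V × V) (n : ℕ) (d : Data V m) : ℕ :=
  (Finset.univ.filter fun e : Fin m => n ≤ e.val ∨ e ∈ d.out (d.tail a e)).card +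
    (Finset.univ.filter fun e : Fin m => n ≤ e.val ∨ e ∈ d.inc (d.head a e)).card

theorem liveCount_le (n : ℕ) (d : Data V m) : liveCount a n d ≤ 2 * m := by
  have h1 := Finset.card_le_univ
    (Finset.univ.filter fun e : Fin m => n ≤ e.val ∨ e ∈ d.out (d.tail a e))
  have h2 := Finset.card_le_univ
    (Finset.univ.filter fun e : Fin m => n ≤ e.val ∨ e ∈ d.inc (d.head a e))
  rw [Fintype.card_fin] at h1 h2
  rw [liveCount]
  omega

theorem liveCount_le_of {n n' : ℕ} {d d' : Data V m}
    (h1 : ∀ e : Fin m, (n' ≤ e.val ∨ e ∈ d'.out (d'.tail a e)) → n ≤ e.val ∨ e ∈ d.out (d.tail a e))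
    (h2 : ∀ e : Fin m, (n' ≤ e.val ∨ e ∈ d'.inc (d'.head a e)) → n ≤ e.val ∨ e ∈ d.inc (d.head a e)) :
    liveCount a n' d' ≤ liveCount a n d :=
  add_le_add (Finset.card_le_card (Finset.monotone_filter_right _ fun e _ => h1 e))
    (Finset.card_le_card (Finset.monotone_filter_right _ fun e _ => h2 e))

theorem Sound.liveCount_examine {k n : ℕ} {d : Data V m} (hd : Sound a k n d) (n' : ℕ)
    (es : List (Fin m)) : liveCount a n' (d.examine a es) = liveCount a n' d := by
  simp only [liveCount, hd.tail_examine, hd.head_examine]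
  rfl

/-- Arcs that are still to come are counted as live from the start, so an insertion adds nothing. -/
theorem Sound.liveCount_addArc {k n : ℕ} {d : Data V m} (hd : Sound a k n d) (i : Fin m) :
    liveCount a (i.val + 1) (d.addArc a i) ≤ liveCount a i.val d := by
  have key : ∀ (f : V → Finset (Fin m)) (x y : V) (e : Fin m),
      e ∈ Function.update f x (insert i (f x)) y → e = i ∨ e ∈ f y := by
    intro f x y e h
    by_cases hxy : y = x
    · subst hxy
      rwa [Function.update_self, Finset.mem_insert] at h
    · rw [Function.update_of_ne hxy] at h
      exact .inr h
  refine liveCount_le_of (fun e h => ?_) (fun e h => ?_)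
  · rw [hd.tail_addArc] at h
    rcases h with h | h
    · exact .inl (by omega)
    · rcases key _ _ _ _ h with rfl | h
      · exact .inl le_rfl
      · exact .inr h
  · rw [hd.head_addArc] at h
    rcases h with h | h
    · exact .inl (by omega)
    · rcases key _ _ _ _ h with rfl | h
      · exact .inl le_rfl
      · exact .inr h

theorem Sound.liveCount_dropOut {k n : ℕ} {d : Data V m} (hd : Sound a k n d) {u : V}
    (hu : rep d.parent u = u) {e : Fin m} (he : e ∈ d.out u) :
    liveCount a n (d.dropOut u e) + 1 ≤ liveCount a n d := by
  obtain ⟨h1, h2⟩ := hd.of_mem_out u hu e he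
  have key : (Finset.univ.filter fun f : Fin m => n ≤ f.val ∨
      f ∈ (d.dropOut u e).out ((d.dropOut u e).tail a f)) ⊂
      (Finset.univ.filter fun f : Fin m => n ≤ f.val ∨ f ∈ d.out (d.tail a f)) := by
    rw [Finset.ssubset_iff_of_subset]
    · refine ⟨e, by simp [h2, he], ?_⟩
      simp only [Finset.mem_filter, Finset.mem_univ, true_and, not_or, not_le]
      refine ⟨h1, ?_⟩
      change e ∉ Function.update d.out u ((d.out u).erase e) (d.tail a e)
      rw [h2, Function.update_self]
      simp
    · refine Finset.monotone_filter_right _ fun f _ hf => hf.imp id fun hf => ?_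
      change f ∈ Function.update d.out u ((d.out u).erase e) (d.tail a f) at hf
      by_cases h : d.tail a f = u
      · rw [h] at hf ⊢
        rw [Function.update_self] at hf
        exact Finset.mem_of_mem_erase hf
      · rwa [Function.update_of_ne h] at hf
  have := Finset.card_lt_card key
  simp only [liveCount]
  change _ + (Finset.univ.filter fun f : Fin m => n ≤ f.val ∨ f ∈ d.inc (d.head a f)).card + 1 ≤ _
  omega

theorem Sound.liveCount_dropInc {k n : ℕ} {d : Data V m} (hd : Sound a k n d) {u : V}
    (hu : rep d.parent u = u) {e : Fin m} (he : e ∈ d.inc u) :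
    liveCount a n (d.dropInc u e) + 1 ≤ liveCount a n d := by
  obtain ⟨h1, h2⟩ := hd.of_mem_inc u hu e he
  have key : (Finset.univ.filter fun f : Fin m => n ≤ f.val ∨
      f ∈ (d.dropInc u e).inc ((d.dropInc u e).head a f)) ⊂
      (Finset.univ.filter fun f : Fin m => n ≤ f.val ∨ f ∈ d.inc (d.head a f)) := by
    rw [Finset.ssubset_iff_of_subset]
    · refine ⟨e, by simp [h2, he], ?_⟩
      simp only [Finset.mem_filter, Finset.mem_univ, true_and, not_or, not_le]
      refine ⟨h1, ?_⟩
      change e ∉ Function.update d.inc u ((d.inc u).erase e) (d.head a e)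
      rw [h2, Function.update_self]
      simp
    · refine Finset.monotone_filter_right _ fun f _ hf => hf.imp id fun hf => ?_
      change f ∈ Function.update d.inc u ((d.inc u).erase e) (d.head a f) at hf
      by_cases h : d.head a f = u
      · rw [h] at hf ⊢
        rw [Function.update_self] at hf
        exact Finset.mem_of_mem_erase hf
      · rwa [Function.update_of_ne h] at hf
  have := Finset.card_lt_card key
  simp only [liveCount]
  change (Finset.univ.filter fun f : Fin m => n ≤ f.val ∨ f ∈ d.out (d.tail a f)).card + _ + 1 ≤ _
  omega

/-- The vertices that are ends of arcs. -/
def touched (a : Fin m → V × V) : Finset V :=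
  Finset.univ.image (fun e => (a e).1) ∪ Finset.univ.image fun e => (a e).2

theorem head_mem_touched (e : Fin m) : (a e).2 ∈ touched a :=
  Finset.mem_union_right _ (Finset.mem_image_of_mem (fun e => (a e).2) (Finset.mem_univ e))

theorem touched_card_le : (touched a).card ≤ 2 * m := by
  have h1 := Finset.card_image_le (s := Finset.univ) (f := fun e => (a e).1)
  have h2 := Finset.card_image_le (s := Finset.univ) (f := fun e => (a e).2)
  have h3 := Finset.card_union_le (Finset.univ.image fun e => (a e).1)
    (Finset.univ.image fun e => (a e).2)
  rw [Finset.card_univ, Fintype.card_fin] at h1 h2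
  rw [touched]
  omega

theorem Reach.target_mem_touched {k : ℕ} {x y : V} (h : Reach a k x y) (hxy : x ≠ y) :
    y ∈ touched a := by
  cases h with
  | refl => exact absurd rfl hxy
  | tail _ h =>
    obtain ⟨j, _, e⟩ := h
    have := head_mem_touched (a := a) j
    rwa [e] at this

/-- A component with at least two vertices consists of ends of arcs. This bounds subtree sizes in
terms of `m` alone, whatever the number of vertices. -/
theorem Sound.class_card_le {k n : ℕ} {d : Data V m} (hd : Sound a k n d) (hm : 0 < m) (x : V) :
    (Finset.univ.filter fun y => rep d.parent y = rep d.parent x).card ≤ 2 * m := by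
  by_cases h : (Finset.univ.filter fun y => rep d.parent y = rep d.parent x) ⊆ touched a
  · exact (Finset.card_le_card h).trans touched_card_le
  · obtain ⟨y, hy, hy'⟩ := Finset.not_subset.1 h
    have hy := (Finset.mem_filter.1 hy).2
    have : (Finset.univ.filter fun y => rep d.parent y = rep d.parent x) ⊆ {y} := by
      intro z hz
      have hz := (Finset.mem_filter.1 hz).2
      rw [Finset.mem_singleton]
      by_contra hne
      exact hy' (((hd.component z y).1 (hz.trans hy.symm)).1.target_mem_touched hne)
    have := Finset.card_le_card this
    rw [Finset.card_singleton] at this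
    omega

/-- The number of components that contain ends of arcs. -/
def rootCount (a : Fin m → V × V) (p : V → V) : ℕ :=
  ((touched a).filter fun x => rep p x = x).card

/-- The factor of the logarithmic potential. -/
def findFactor (m : ℕ) : ℝ := 2 * Real.sqrt (Real.sqrt m)

/-- The potential that pays for finds and for putting loops aside. -/
def dataPotential (a : Fin m → V × V) (n : ℕ) (d : Data V m) : ℝ :=
  findFactor m * (logSize d.parent + Real.log (2 * m) * rootCount a d.parent) +
    13 * liveCount a n d

theorem findFactor_nonneg (m : ℕ) : 0 ≤ findFactor m := by rw [findFactor]; positivity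

theorem one_lt_findFactor {m : ℕ} (hm : 0 < m) : 1 < findFactor m := by
  have h : (1 : ℝ) ≤ m := by exact_mod_cast hm
  have h1 : 1 ≤ Real.sqrt (Real.sqrt m) := Real.one_le_sqrt.2 (Real.one_le_sqrt.2 h)
  rw [findFactor]
  linarith

theorem findFactor_sq (m : ℕ) : findFactor m ^ 2 = 4 * Real.sqrt m := by
  rw [findFactor, mul_pow, Real.sq_sqrt (Real.sqrt_nonneg _)]
  norm_num

/-- The fourth power of the factor is `16 * m`, so at most four increases of a subtree size by this
factor fit on a find path. -/
theorem log_le_findFactor {m : ℕ} (hm : 0 < m) :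
    Real.log (2 * m) ≤ 4 * Real.log (findFactor m) := by
  have h : (1 : ℝ) ≤ m := by exact_mod_cast hm
  have h4 : findFactor m ^ 4 = 16 * m := by
    rw [show findFactor m ^ 4 = (findFactor m ^ 2) ^ 2 by ring, findFactor_sq, mul_pow,
      Real.sq_sqrt (by linarith)]
    norm_num
  have := Real.log_pow (findFactor m) 4
  rw [h4] at this
  calc Real.log (2 * m) ≤ Real.log (16 * m) := Real.log_le_log (by linarith) (by linarith)
    _ = _ := by rw [this]; norm_num

theorem log_two_mul_nonneg {m : ℕ} (hm : 0 < m) : 0 ≤ Real.log (2 * m) := by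
  have h : (1 : ℝ) ≤ m := by exact_mod_cast hm
  exact Real.log_nonneg (by linarith)

theorem dataPotential_nonneg (hm : 0 < m) (n : ℕ) (d : Data V m) : 0 ≤ dataPotential a n d := by
  have h1 := findFactor_nonneg m
  have h2 := logSize_nonneg d.parent
  have h3 := log_two_mul_nonneg hm
  rw [dataPotential]
  positivity

/-- At most `2 * m` roots count, and `log (2 * m)` is at most 4 times the factor. So the reserve for
links is at most `8 * m * findFactor m ^ 2`, which is `32 * (m * √m)`. The other 26 is 13 for each
of at most `2 * m` deletions of loops. -/
theorem dataPotential_empty_le (o : List V) :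
    dataPotential a 0 (Data.empty o) ≤ (32 + 26) * (m * Real.sqrt m) := by
  rcases Nat.eq_zero_or_pos m with rfl | hm
  · have h := liveCount_le (a := a) 0 (Data.empty o)
    have h' : liveCount a 0 (Data.empty o) = 0 := by omega
    simp [dataPotential, h', findFactor]
  have h1m : (1 : ℝ) ≤ m := by exact_mod_cast hm
  have hs : 1 ≤ Real.sqrt m := Real.one_le_sqrt.2 h1m
  have h1 : (liveCount a 0 (Data.empty o) : ℝ) ≤ 2 * m := by
    exact_mod_cast liveCount_le (a := a) 0 (Data.empty o)
  have h2 : (rootCount a (id : V → V) : ℝ) ≤ 2 * m := by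
    have : rootCount a (id : V → V) ≤ 2 * m :=
      (Finset.card_le_card (Finset.filter_subset _ _)).trans touched_card_le
    exact_mod_cast this
  have h3 : Real.log (2 * m) ≤ 4 * findFactor m := by
    have h4 := Real.log_le_sub_one_of_pos (show 0 < findFactor m by
      have := one_lt_findFactor hm; linarith)
    have h5 := log_le_findFactor hm
    linarith
  have h4 : Real.log (2 * m) * rootCount a (id : V → V) ≤ 4 * findFactor m * (2 * m) :=
    mul_le_mul h3 h2 (by positivity) (by have := findFactor_nonneg m; positivity)
  have h5 := mul_le_mul_of_nonneg_left h4 (findFactor_nonneg m)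
  have h6 : findFactor m * (4 * findFactor m * (2 * m)) = 32 * (m * Real.sqrt m) := by
    rw [show findFactor m * (4 * findFactor m * (2 * m)) = 8 * m * findFactor m ^ 2 by ring,
      findFactor_sq]
    ring
  have h7 : (m : ℝ) ≤ m * Real.sqrt m := le_mul_of_one_le_right (by linarith) hs
  rw [dataPotential]
  change findFactor m * (logSize (id : V → V) + Real.log (2 * m) * rootCount a (id : V → V)) + _ ≤ _
  rw [logSize_id, zero_add]
  linarith

theorem length_ends (es : List (Fin m)) : (ends a es).length = 2 * es.length := by
  induction es with
  | nil => rfl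
  | cons e es ih => simp [ends] at ih ⊢; omega

theorem Sound.finds_le {k n : ℕ} {d : Data V m} (hd : Sound a k n d) (hm : 0 < m)
    (es : List (Fin m)) :
    ((finds d.parent (ends a es)).2 : ℝ) +
      findFactor m * logSize (finds d.parent (ends a es)).1 ≤
      12 * es.length + findFactor m * logSize d.parent := by
  have h := hd.forest.finds_le (ends a es) (one_lt_findFactor hm) (N := 2 * m) (fun y => by
    have := (Finset.card_le_card (hd.forest.subtree_subset y)).trans (hd.class_card_le hm y)
    exact_mod_cast this) (log_le_findFactor hm)
  rw [length_ends] at h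
  push_cast at h
  linarith

theorem Sound.rootCount_finds {k n : ℕ} {d : Data V m} (hd : Sound a k n d) (xs : List V) :
    rootCount a (finds d.parent xs).1 = rootCount a d.parent := by
  rw [rootCount, rootCount, (hd.forest.finds xs).2]

theorem Sound.dataPotential_examine {k n : ℕ} {d : Data V m} (hd : Sound a k n d) (hm : 0 < m)
    (n' : ℕ) (es : List (Fin m)) : (d.examineCost a es : ℝ) + dataPotential a n' (d.examine a es) ≤
      12 * es.length + dataPotential a n' d := by
  have h := hd.finds_le hm es
  rw [dataPotential, dataPotential, hd.liveCount_examine]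
  simp only [Data.examineCost, Data.examine, hd.rootCount_finds]
  linarith

theorem Sound.dataPotential_addArc {k n : ℕ} {d : Data V m} (hd : Sound a k n d) (i : Fin m) :
    (d.examineCost a [i] : ℝ) + dataPotential a (i.val + 1) (d.addArc a i) ≤
      12 + dataPotential a i.val d := by
  have h := hd.finds_le i.pos [i]
  have h2 : (liveCount a (i.val + 1) (d.addArc a i) : ℝ) ≤ liveCount a i.val d := by
    exact_mod_cast hd.liveCount_addArc i
  rw [dataPotential, dataPotential]
  simp only [Data.examineCost, Data.addArc, hd.rootCount_finds, List.length_singleton,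
    Nat.cast_one] at h h2 ⊢
  linarith

/-- The links raise `logSize` by at most `(Z.card - 1) * log (2 * m)` and remove as many counted
roots, so the reserve for roots pays for them exactly. The bound on `n` holds because `Z` lies
within the forward and backward vertices and `s`. -/
theorem Searching.dataPotential_rebuild {i : Fin m} {d d' : Data V m} {S : Search V m}
    {X Y : Finset V} {s : V} {n : ℕ} (hS : Searching a i d S) (hT : Stopped d S X Y s)
    (h : Rebuild a i d S X Y s d' n) :
    dataPotential a (i.val + 1) d' ≤ dataPotential a (i.val + 1) d ∧
      n ≤ S.F.card + S.R.card + 1 := by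
  have hd := hS.sound
  cases h with
  | after hFR hs OX OY P Q hX hY hPQ => exact ⟨le_refl _, Nat.zero_le _⟩
  | before hFR hs OX OY P Q hX hY hPQ => exact ⟨le_refl _, Nat.zero_le _⟩
  | contract hFR Z hZ p' r hlink OX OY P Q hX hY hPQ =>
    have hreach : Reach a i.val (a i).2 (a i).1 := by
      have := (hS.disjoint_iff hT).not.1 hFR
      rwa [not_not] at this
    have hmZ : ∀ z, z ∈ Z ↔
        rep d.parent z = z ∧ Reach a i.val (a i).2 z ∧ Reach a i.val z (a i).1 := by
      rw [hZ]; exact hS.mem_newComponent hT hreach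
    have hroot : ∀ z ∈ Z, d.parent z = z :=
      fun z hz => hd.forest.rep_eq_self.1 ((hmZ z).1 hz).1
    obtain ⟨hp, hr, hrep⟩ := hlink.spec hd.forest hroot
    have htouch : ∀ x, Reach a i.val (a i).2 x → x ∈ touched a := by
      intro x hx
      by_cases h : (a i).2 = x
      · exact h ▸ head_mem_touched i
      · exact hx.target_mem_touched h
    have hlog := hlink.logSize_le hd.forest hroot (N := 2 * m) (by
      have : (Finset.univ.filter fun x => rep d.parent x ∈ Z) ⊆ touched a := fun x hx =>
        htouch x (((hmZ _).1 (Finset.mem_filter.1 hx).2).2.1.trans (hd.rep_reach x))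
      exact_mod_cast (Finset.card_le_card this).trans touched_card_le)
    have hcount : rootCount a p' + Z.card ≤ rootCount a d.parent + 1 := by
      have h1 : ((touched a).filter fun x => rep p' x = x) ⊆
          insert r (((touched a).filter fun x => rep d.parent x = x) \ Z) := by
        intro x hx
        obtain ⟨hx1, hx2⟩ := Finset.mem_filter.1 hx
        rw [hrep] at hx2
        split_ifs at hx2 with h
        · simp [hx2]
        · rw [Finset.mem_insert, Finset.mem_sdiff, Finset.mem_filter]
          exact .inr ⟨⟨hx1, hx2⟩, hx2 ▸ h⟩
      have h2 : Z ⊆ (touched a).filter fun x => rep d.parent x = x := fun z hz =>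
        Finset.mem_filter.2 ⟨htouch z ((hmZ z).1 hz).2.1, ((hmZ z).1 hz).1⟩
      have h3 := (Finset.card_le_card h1).trans (Finset.card_insert_le _ _)
      rw [Finset.card_sdiff_of_subset h2] at h3
      have h4 := Finset.card_le_card h2
      rw [rootCount, rootCount]
      omega
    have hlive : liveCount a (i.val + 1) ⟨p', Function.update d.out r (Z.biUnion d.out),
        Function.update d.inc r (Z.biUnion d.inc), if s ∈ Z then P ++ (OY ++ r :: OX) ++ Q
            else if s ∉ S.F then P ++ s :: (OY ++ r :: OX) ++ Q
            else P ++ (OY ++ r :: OX) ++ s :: Q⟩ ≤ liveCount a (i.val + 1) d := by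
      refine liveCount_le_of (fun e h => h.imp id fun h => ?_) (fun e h => h.imp id fun h => ?_)
      · change e ∈ Function.update d.out r (Z.biUnion d.out) (rep p' (a e).1) at h
        rw [hrep] at h
        split_ifs at h with hz
        · rw [Function.update_self] at h
          obtain ⟨z, hz, he⟩ := Finset.mem_biUnion.1 h
          rw [(hd.of_mem_out z ((hmZ z).1 hz).1 e he).2]
          exact he
        · rw [Function.update_of_ne fun h => hz (by rw [h]; exact hr)] at h
          exact h
      · change e ∈ Function.update d.inc r (Z.biUnion d.inc) (rep p' (a e).2) at h
        rw [hrep] at h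
        split_ifs at h with hz
        · rw [Function.update_self] at h
          obtain ⟨z, hz, he⟩ := Finset.mem_biUnion.1 h
          rw [(hd.of_mem_inc z ((hmZ z).1 hz).1 e he).2]
          exact he
        · rw [Function.update_of_ne fun h => hz (by rw [h]; exact hr)] at h
          exact h
    constructor
    · have hl := log_two_mul_nonneg i.pos
      have hcount' : (rootCount a p' : ℝ) + Z.card ≤ rootCount a d.parent + 1 := by
        exact_mod_cast hcount
      have h1 := mul_le_mul_of_nonneg_left hcount' hl
      have h2 : logSize p' + Real.log (2 * m) * rootCount a p' ≤
          logSize d.parent + Real.log (2 * m) * rootCount a d.parent := by linarith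
      have h3 := mul_le_mul_of_nonneg_left h2 (findFactor_nonneg m)
      have hlive' := (Nat.cast_le (α := ℝ)).2 hlive
      rw [dataPotential, dataPotential]
      simp only at h3 ⊢
      linarith
    · have h1 : Z ⊆ insert s (S.F ∪ S.R) := fun z hz => by
        obtain ⟨e1, e2, e3⟩ := (hmZ z).1 hz
        have := hS.mem_of_between hT e2 e3
        rw [e1, Finset.mem_insert, Finset.mem_union, hT.mem_X, hT.mem_Y] at this
        rw [Finset.mem_insert, Finset.mem_union]
        exact this.imp id (Or.imp And.left And.left)
      have h2 := (Finset.card_le_card h1).trans (Finset.card_insert_le _ _)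
      have h3 := Finset.card_union_le S.F S.R
      omega

end DataPotential

/-! ### The potential of the candidates -/

section Candidates

variable {V : Type u} {p : V → ℤ} {A B S : Finset V} {u : V} {l s h : ℤ}

/-- The number of elements of `S` strictly between two positions. -/
def between (p : V → ℤ) (S : Finset V) (l h : ℤ) : ℕ := (S.filter fun u => l < p u ∧ p u < h).card

/-- The potential of near candidates `A` and far candidates `B`. -/
def candPotential (p : V → ℤ) (A B : Finset V) (l s h : ℤ) : ℕ :=
  B.card + between p A l h + max (between p A l s) (between p A s h + between p B s h)

theorem between_mono {S S' : Finset V} (hS : S ⊆ S') {l l' h h' : ℤ} (hl : l' ≤ l) (hh : h ≤ h') :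
    between p S l h ≤ between p S' l' h' := by
  refine Finset.card_le_card fun u hu => ?_
  obtain ⟨h1, h2, h3⟩ := Finset.mem_filter.1 hu
  exact Finset.mem_filter.2 ⟨hS h1, hl.trans_lt h2, h3.trans_le hh⟩

theorem between_erase (hu : u ∈ S) (hl : l < p u) (hh : p u < h) :
    between p (S.erase u) l h + 1 = between p S l h := by
  rw [between, between, Finset.filter_erase]
  exact Finset.card_erase_add_one (Finset.mem_filter.2 ⟨hu, hl, hh⟩)

theorem between_insert_le (u : V) : between p (insert u S) l h ≤ between p S l h + 1 := by
  rw [between, between, Finset.filter_insert]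
  split_ifs
  · exact Finset.card_insert_le _ _
  · exact Nat.le_succ _

theorem between_insert_of_le (hu : p u ≤ l) : between p (insert u S) l h = between p S l h := by
  rw [between, between, Finset.filter_insert, if_neg (by omega)]

theorem between_eq_zero (hS : ∀ u ∈ S, h ≤ p u ∨ p u ≤ l) : between p S l h = 0 := by
  rw [between, Finset.card_eq_zero, Finset.filter_eq_empty_iff]
  intro u hu
  have := hS u hu
  omega

theorem candPotential_erase (u : V) :
    candPotential p (A.erase u) B l s h ≤ candPotential p A B l s h := by
  have hsub := Finset.erase_subset u A
  have h1 := between_mono (p := p) hsub (le_refl l) (le_refl h)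
  have h2 := between_mono (p := p) hsub (le_refl l) (le_refl s)
  have h3 := between_mono (p := p) hsub (le_refl s) (le_refl h)
  rw [candPotential, candPotential]
  omega

theorem candPotential_insert (u : V) :
    candPotential p (insert u A) B l s h ≤ candPotential p A B l s h + 2 := by
  have h1 := between_insert_le (p := p) (S := A) (l := l) (h := h) u
  have h2 := between_insert_le (p := p) (S := A) (l := l) (h := s) u
  have h3 := between_insert_le (p := p) (S := A) (l := s) (h := h) u
  rw [candPotential, candPotential]
  omega

theorem candPotential_singleton (u : V) : candPotential p {u} ∅ l s h ≤ 2 := by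
  have := candPotential_insert (p := p) (A := ∅) (B := ∅) (l := l) (s := s) (h := h) u
  simpa [candPotential, between] using this

/-- The vertex is counted in `B.card` instead of between `l` and `h`. In the second entry of the
maximum its count passes from `A` to `B`; it has no such count if it is `s` itself. -/
theorem candPotential_move (hu : u ∈ A) (hl : l < p u) (hs : s ≤ p u) (hh : p u < h) :
    candPotential p (A.erase u) (insert u B) l s h ≤ candPotential p A B l s h := by
  have h1 := between_erase hu hl hh
  have h2 := between_mono (p := p) (Finset.erase_subset u A) (le_refl l) (le_refl s)
  have h3 := Finset.card_insert_le u B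
  rw [candPotential, candPotential]
  rcases hs.lt_or_eq with hs | hs
  · have h4 := between_erase hu hs hh
    have h5 := between_insert_le (p := p) (S := B) (l := s) (h := h) u
    omega
  · have h4 := between_mono (p := p) (Finset.erase_subset u A) (le_refl s) (le_refl h)
    have h5 := between_insert_of_le (p := p) (S := B) (h := h) hs.symm.le
    omega

/-- The opposite candidates are refilled, and the old soft threshold becomes a hard threshold. -/
theorem candPotential_threshold {s' : ℤ} (hl : l ≤ s') (hs' : s' ≤ s) (hs : s ≤ h)
    (hB : ∀ u ∈ B, s ≤ p u) : candPotential p A B l s' s ≤ candPotential p A B l s h := by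
  -- In the new maximum `B` contributes nothing, as it lies at or beyond the new `h`. Both entries
  -- are then at most the number of near candidates between `l` and the old `s`, which is why this
  -- number is an entry of the old maximum.
  have h1 := between_mono (p := p) (le_refl A) (le_refl l) hs'
  have h2 := between_mono (p := p) (le_refl A) hl (le_refl s)
  have h3 : between p B s' s = 0 := between_eq_zero fun u hu => .inl (hB u hu)
  have h4 := between_mono (p := p) (le_refl A) (le_refl l) hs
  rw [candPotential, candPotential]
  omega

/-- Before the refill a candidate strictly between `s` and `h` counts twice and any other candidate
counts once. Afterwards the former count once, and only the larger side of the new threshold counts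
again. The minimum with `h` loses nothing, since candidates at or beyond `h` no longer count. -/
theorem candPotential_refill (t : V) :
    candPotential p B ∅ s (min (p t) h) h + B.card ≤ candPotential p ∅ B l s h +
      max (B.filter fun u => p u < p t).card (B.filter fun u => p t < p u).card := by
  have h1 : between p B s (min (p t) h) ≤ (B.filter fun u => p u < p t).card := by
    refine Finset.card_le_card (Finset.monotone_filter_right _ fun u _ hu => ?_)
    have := hu.2
    omega
  have h2 : between p B (min (p t) h) h ≤ (B.filter fun u => p t < p u).card := by
    refine Finset.card_le_card (Finset.monotone_filter_right _ fun u _ hu => ?_)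
    have := hu.1
    have := hu.2
    omega
  have h3 : ∀ l h, between p ∅ l h = 0 := fun l h => by simp [between]
  rw [candPotential, candPotential]
  simp only [h3, Finset.card_empty]
  omega

/-- The ranks run through `0, ..., g - 1`, so the sum is that of the smaller of `k + 1` and `g - k`.
As the larger of the two is at most `g + 1`, it suffices to sum the products. -/
theorem sum_rank_le (hp : Set.InjOn p S) :
    S.card ^ 2 ≤ 6 * ∑ t ∈ S, (S.card - max (S.filter fun u => p u < p t).card
      (S.filter fun u => p t < p u).card) := by
  set r : V → ℕ := fun t => (S.filter fun u => p u < p t).card with hr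
  have hlt : ∀ t ∈ S, r t < S.card := fun t ht => by
    refine Finset.card_lt_card ?_
    rw [Finset.ssubset_iff_of_subset (Finset.filter_subset _ _)]
    exact ⟨t, ht, by simp⟩
  have hgt : ∀ t ∈ S, r t + (S.filter fun u => p t < p u).card + 1 = S.card := by
    intro t ht
    have h1 : S = insert t ((S.filter fun u => p u < p t) ∪ S.filter fun u => p t < p u) := by
      ext u
      simp only [Finset.mem_insert, Finset.mem_union, Finset.mem_filter]
      constructor
      · intro hu
        rcases lt_trichotomy (p u) (p t) with h | h | h
        · exact .inr (.inl ⟨hu, h⟩)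
        · exact .inl (hp hu ht h)
        · exact .inr (.inr ⟨hu, h⟩)
      · rintro (rfl | h | h)
        · exact ht
        · exact h.1
        · exact h.1
    conv_rhs => rw [h1]
    rw [Finset.card_insert_of_notMem (by simp), Finset.card_union_of_disjoint]
    rw [Finset.disjoint_left]
    intro u hu hu'
    have h2 := (Finset.mem_filter.1 hu).2
    have h3 := (Finset.mem_filter.1 hu').2
    omega
  have hinj : Set.InjOn r S := by
    have key : ∀ t ∈ S, ∀ t' ∈ S, p t < p t' → r t < r t' := by
      intro t ht t' _ h
      refine Finset.card_lt_card ?_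
      rw [Finset.ssubset_iff_of_subset]
      · exact ⟨t, Finset.mem_filter.2 ⟨ht, h⟩, by simp⟩
      · exact Finset.monotone_filter_right _ fun u _ hu => lt_trans hu h
    intro t ht t' ht' h
    rcases lt_trichotomy (p t) (p t') with h' | h' | h'
    · have := key t ht t' ht' h'; omega
    · exact hp ht ht' h'
    · have := key t' ht' t ht h'; omega
  have himg : S.image r = Finset.range S.card := by
    refine Finset.eq_of_subset_of_card_le (fun k hk => ?_) ?_
    · obtain ⟨t, ht, rfl⟩ := Finset.mem_image.1 hk
      exact Finset.mem_range.2 (hlt t ht)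
    · rw [Finset.card_range, Finset.card_image_of_injOn hinj]
  have hsum : ∑ t ∈ S, (S.card - max (r t) (S.filter fun u => p t < p u).card) =
      ∑ k ∈ Finset.range S.card, (S.card - max k (S.card - 1 - k)) := by
    rw [← himg, Finset.sum_image hinj]
    refine Finset.sum_congr rfl fun t ht => ?_
    have := hgt t ht
    congr 2
    omega
  -- The bound `c` stays fixed in the induction on `n`. For `n = c` the sum of the products is `c *
  -- (c + 1) * (c + 2) / 6`, which is where the 6 comes from.
  have hpoly : ∀ c n : ℕ, n ≤ c →
      6 * ∑ k ∈ Finset.range n, (c - k) * (k + 1) + 2 * n ^ 3 = 3 * c * n * (n + 1) + 2 * n := by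
    intro c n
    induction n with
    | zero => intro _; simp
    | succ n ih =>
      intro hn
      have ih := ih (by omega)
      rw [Finset.sum_range_succ]
      obtain ⟨e, rfl⟩ : ∃ e, c = n + e := ⟨c - n, by omega⟩
      rw [Nat.add_sub_cancel_left]
      nlinarith [ih]
  have hterm : ∑ k ∈ Finset.range S.card, (S.card - k) * (k + 1) ≤
      (S.card + 1) * ∑ k ∈ Finset.range S.card, (S.card - max k (S.card - 1 - k)) := by
    rw [Finset.mul_sum]
    refine Finset.sum_le_sum fun k hk => ?_
    have hk := Finset.mem_range.1 hk
    rcases le_total k (S.card - 1 - k) with h | h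
    · rw [max_eq_right h]
      have e : S.card - (S.card - 1 - k) = k + 1 := by omega
      rw [e]
      exact Nat.mul_le_mul_right _ (by omega)
    · rw [max_eq_left h, mul_comm]
      exact Nat.mul_le_mul_right _ (by omega)
  rw [show (∑ t ∈ S, (S.card - max (S.filter fun u => p u < p t).card
      (S.filter fun u => p t < p u).card)) = _ from hsum]
  have h1 := hpoly S.card S.card le_rfl
  set g := S.card
  set Q := ∑ k ∈ Finset.range g, (g - max k (g - 1 - k))
  have h2 : g ^ 2 * (g + 1) ≤ 6 * Q * (g + 1) := by nlinarith
  exact Nat.le_of_mul_le_mul_right h2 (Nat.succ_pos g)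

end Candidates

/-! ### The total potential -/

section Potential

variable {V : Type u} [Fintype V] {m : ℕ} {a : Fin m → V × V}

/-- The position of a vertex in the current order. -/
def Data.pos (d : Data V m) (x : V) : ℤ := d.order.idxOf x

theorem Data.pos_lt {d : Data V m} {x y : V} : d.pos x < d.pos y ↔ d.lt x y := by
  simp [Data.pos, Data.lt]

theorem Data.pos_le {d : Data V m} {x y : V} : d.pos x ≤ d.pos y ↔ d.le x y := by
  simp [Data.pos, Data.le]

/-- The potential of the forward candidates. -/
def Soft.forwardPotential (d : Data V m) (T : Soft V m) : ℕ :=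
  candPotential d.pos T.A T.B (d.pos T.l) (d.pos T.s) (d.pos T.h)

/-- The potential of the backward candidates. -/
def Soft.backwardPotential (d : Data V m) (T : Soft V m) : ℕ :=
  candPotential (fun x => -d.pos x) T.C T.D (-d.pos T.h) (-d.pos T.s) (-d.pos T.l)

/-- The part of the potential that belongs to a search. -/
def Soft.potential (κ : ℝ) (d : Data V m) (T : Soft V m) : ℝ :=
  κ * (T.forwardPotential d + T.backwardPotential d) + T.A.card + T.C.card -
    (27 + 4 * κ) * T.trF.card - (15 + 4 * κ)

/-- The part of the potential that pays for the searches that are not finished. -/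
def arcPotential (κ : ℝ) (a : Fin m → V × V) (n : ℕ) : ℝ :=
  (33 + 4 * κ) / Real.sqrt m * (2 * (m : ℝ) ^ 2 - pairCount a n) +
    ((33 + 4 * κ) / 2 * Real.sqrt m + 21 + 4 * κ) * (m - n)

/-- The total potential, including the time spent so far. -/
def Config.potential (κ : ℝ) (a : Fin m → V × V) (c : Config V m (Soft V m)) : ℝ :=
  c.cost + arcPotential κ a c.done +
    match c.search with
    | none => dataPotential a c.done c.data
    | some T => dataPotential a (c.done + 1) c.data + T.potential κ c.data

/-- What the end of a search for arc `i` releases suffices to pay for the search. -/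
theorem SoftSearching.arcPotential_le {κ : ℝ} (hκ : 0 ≤ κ) {i : Fin m} {d : Data V m}
    {T : Soft V m} (hT : SoftSearching a i d T) :
    (33 + 4 * κ) * T.trF.card + 21 + 4 * κ + arcPotential κ a (i.val + 1) ≤
      arcPotential κ a i.val := by
  have h1 : (T.trF.card : ℝ) ^ 2 + 2 * pairCount a i.val ≤ 2 * pairCount a (i.val + 1) := by
    exact_mod_cast hT.sq_card_le
  have hm : (1 : ℝ) ≤ m := by exact_mod_cast i.pos
  have hs : 1 ≤ Real.sqrt m := Real.one_le_sqrt.2 hm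
  set σ := Real.sqrt m with hσ
  set k : ℝ := (T.trF.card : ℝ)
  -- By `sq_card_le` the number of pairs grows by at least `k ^ 2 / 2`, and `k ≤ k ^ 2 / (2 * σ) + σ
  -- / 2`.
  have h2 : k ≤ (pairCount a (i.val + 1) - pairCount a i.val) / σ + σ / 2 := by
    rw [← sub_le_iff_le_add, le_div_iff₀ (by linarith)]
    nlinarith [sq_nonneg (k - σ)]
  have h3 := mul_le_mul_of_nonneg_left h2 (show 0 ≤ 33 + 4 * κ by linarith)
  rw [arcPotential, arcPotential]
  push_cast
  have e : (33 + 4 * κ) * ((pairCount a (i.val + 1) - pairCount a i.val) / σ + σ / 2) =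
    (33 + 4 * κ) / σ * (pairCount a (i.val + 1) - pairCount a i.val) + (33 + 4 * κ) / 2 * σ := by
    ring
  rw [e] at h3
  linarith

theorem arcPotential_nonneg {κ : ℝ} (hκ : 0 ≤ κ) {n : ℕ} (hn : n ≤ m) :
    0 ≤ arcPotential κ a n := by
  have h1 : (pairCount a n : ℝ) ≤ 2 * (m : ℝ) ^ 2 := by exact_mod_cast pairCount_le n
  have h2 : (n : ℝ) ≤ m := by exact_mod_cast hn
  have h3 : 0 ≤ 2 * (m : ℝ) ^ 2 - pairCount a n := by linarith
  have h4 : (0 : ℝ) ≤ m - n := by linarith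
  rw [arcPotential]
  positivity

/-- A running search is in debt for its traversed arcs and its potential may be negative. What its
end will release from the arc potential always covers this debt. -/
theorem SoftSearching.potential_ge {κ : ℝ} (hκ : 0 ≤ κ) {i : Fin m} {d : Data V m}
    {T : Soft V m} (hT : SoftSearching a i d T) :
    0 ≤ arcPotential κ a i.val + T.potential κ d := by
  have h1 := hT.arcPotential_le hκ
  have h2 : 0 ≤ arcPotential κ a (i.val + 1) := arcPotential_nonneg hκ i.isLt
  have h3 : 0 ≤ κ * (T.forwardPotential d + T.backwardPotential d : ℝ) := by positivity
  have h4 : (0 : ℝ) ≤ T.trF.card := by positivity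
  have h5 : (0 : ℝ) ≤ T.A.card := by positivity
  have h6 : (0 : ℝ) ≤ T.C.card := by positivity
  rw [Soft.potential]
  linarith

theorem Invariant.cost_le {κ : ℝ} (hκ : 0 ≤ κ) {c : Config V m (Soft V m)}
    (hc : Invariant a (SoftSearching a) c) : (c.cost : ℝ) ≤ c.potential κ a := by
  -- Without arcs there is no search, and `findFactor 0` is zero, so the logarithms play no role.
  rcases Nat.eq_zero_or_pos m with rfl | hm
  · have hs : c.search = none := by
      cases hs : c.search with
      | none => rfl
      | some T => obtain ⟨i, _⟩ := hc.busy T hs; exact i.elim0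
    have h1 := arcPotential_nonneg (a := a) hκ hc.bounded
    have h2 : 0 ≤ dataPotential a c.done c.data := by
      have : findFactor 0 = 0 := by simp [findFactor]
      rw [dataPotential, this, zero_mul]
      positivity
    rw [Config.potential, hs]
    simp only
    linarith
  rw [Config.potential]
  cases hs : c.search with
  | none =>
    have h1 := arcPotential_nonneg (a := a) hκ hc.bounded
    have h2 := dataPotential_nonneg (a := a) hm c.done c.data
    simp only
    linarith
  | some T =>
    obtain ⟨i, hi, hT⟩ := hc.busy T hs
    have h1 := hT.potential_ge hκ
    have h2 := dataPotential_nonneg (a := a) hm (c.done + 1) c.data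
    rw [hi] at h1
    simp only
    linarith

/-- The 79 is 58 from the data potential plus the 21 units per arc addition. The 5/2 is 2 from the
bound on `pairCount` plus 1/2 from the remainder in the inequality of means. -/
theorem potential_empty_le {κ : ℝ} (hκ : 0 ≤ κ) (o : List V) :
    (Config.empty o : Config V m (Soft V m)).potential κ a ≤
      m * ((79 + 4 * κ + 5 / 2 * (33 + 4 * κ)) * Real.sqrt m) := by
  have h1 := dataPotential_empty_le (a := a) o
  have h2 : arcPotential κ a 0 ≤ (21 + 4 * κ + 5 / 2 * (33 + 4 * κ)) * (m * Real.sqrt m) := by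
    rcases Nat.eq_zero_or_pos m with rfl | hm
    · simp [arcPotential]
    have hm : (1 : ℝ) ≤ m := by exact_mod_cast hm
    have hs : 1 ≤ Real.sqrt m := Real.one_le_sqrt.2 hm
    have hsq : Real.sqrt m * Real.sqrt m = m := Real.mul_self_sqrt (by linarith)
    have h3 : (33 + 4 * κ) / Real.sqrt m * (2 * (m : ℝ) ^ 2 - pairCount a 0) ≤
        (33 + 4 * κ) / Real.sqrt m * (2 * (m : ℝ) ^ 2) :=
      mul_le_mul_of_nonneg_left (by have : (0 : ℝ) ≤ pairCount a 0 := by positivity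
                                    linarith) (by positivity)
    have h4 : (33 + 4 * κ) / Real.sqrt m * (2 * (m : ℝ) ^ 2) =
        2 * (33 + 4 * κ) * (m * Real.sqrt m) := by
      rw [div_mul_eq_mul_div, div_eq_iff (by linarith)]
      linear_combination (-2 * (33 + 4 * κ) * m) * hsq
    have h5 : (m : ℝ) ≤ m * Real.sqrt m := le_mul_of_one_le_right (by linarith) hs
    have h6 := mul_le_mul_of_nonneg_left h5 (show 0 ≤ 21 + 4 * κ by linarith)
    rw [arcPotential]
    push_cast
    linarith
  rw [Config.potential]
  simp only [Config.empty, Nat.cast_zero]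
  linarith

/-- An examined arc costs 12 for its two finds. So case 5 costs 1 + 24 and adds at most 2 near
candidates, hence the 27, and `4 * κ` for the candidate potentials. Starting a search costs 1 + 12
and adds 2 near candidates, hence the 15. Discarding, moving or scanning a near candidate is paid by
the cardinality terms, and putting a loop aside costs 1 + 12 = 13. -/
theorem PlainStep.potential_le {κ : ℝ} (hκ : 0 ≤ κ) {c c' : Config V m (Soft V m)}
    (hc : Invariant a (SoftSearching a) c) (h : PlainStep a c c') :
    c'.potential κ a ≤ c.potential κ a := by
  cases h with
  | start _ h =>
    cases h with
    | quiet i hs hi h =>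
      have hd : Sound a c.done c.done c.data := correct_iff.1 (hc.idle hs)
      have h1 := hd.dataPotential_addArc i
      rw [hi] at h1
      have h2 : (pairCount a c.done : ℝ) ≤ pairCount a (c.done + 1) := by
        have := pairCount_add_card_le (a := a) (Nat.le_succ c.done) ∅ (by simp)
        simpa using this
      have h3 : arcPotential κ a (c.done + 1) + 21 ≤ arcPotential κ a c.done := by
        have h4 := mul_le_mul_of_nonneg_left h2
          (show 0 ≤ (33 + 4 * κ) / Real.sqrt m by positivity)
        have h5 : 0 ≤ (33 + 4 * κ) / 2 * Real.sqrt m := by positivity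
        rw [arcPotential, arcPotential]
        push_cast
        linarith
      simp only [Config.potential, hs]
      push_cast
      linarith
    | search i T hs hi h hT =>
      have hd : Sound a c.done c.done c.data := correct_iff.1 (hc.idle hs)
      have h1 := hd.dataPotential_addArc i
      rw [hi] at h1
      obtain ⟨s, _, _, _, rfl⟩ := hT
      have h2 : ∀ (p : V → ℤ) (x : V) (l s h : ℤ), (candPotential p {x} ∅ l s h : ℝ) ≤ 2 :=
        fun p x l s h => by exact_mod_cast candPotential_singleton x
      simp only [Config.potential, hs, Soft.potential, Soft.forwardPotential,
        Soft.backwardPotential, Search.start, Finset.card_singleton, Finset.card_empty]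
      push_cast
      have h3 := mul_le_mul_of_nonneg_left (add_le_add
        (h2 (c.data.addArc a i).pos (c.data.head a i) ((c.data.addArc a i).pos (c.data.head a i))
          ((c.data.addArc a i).pos s) ((c.data.addArc a i).pos (c.data.tail a i)))
        (h2 (fun x => -(c.data.addArc a i).pos x) (c.data.tail a i)
          (-(c.data.addArc a i).pos (c.data.tail a i))
          (-(c.data.addArc a i).pos s) (-(c.data.addArc a i).pos (c.data.head a i)))) hκ
      linarith
  | case2f T u z hs hu hz h =>
    have h1 : (candPotential c.data.pos (T.A.erase u) T.B (c.data.pos T.l) (c.data.pos T.s)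
      (c.data.pos T.h) : ℝ) ≤ candPotential c.data.pos T.A T.B (c.data.pos T.l) (c.data.pos T.s)
      (c.data.pos T.h) := by exact_mod_cast candPotential_erase u
    have h2 := mul_le_mul_of_nonneg_left h1 hκ
    have h3 : (T.A.card : ℝ) = (T.A.erase u).card + 1 := by
      exact_mod_cast (Finset.card_erase_add_one hu).symm
    simp only [Config.potential, Config.set, hs, Soft.potential, Soft.forwardPotential,
        Soft.backwardPotential, h3]
    push_cast
    linarith
  | case2b T u z hs hu hz h =>
    have h1 : (candPotential (fun x => -c.data.pos x) (T.C.erase z) T.D (-c.data.pos T.h)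
      (-c.data.pos T.s) (-c.data.pos T.l) : ℝ) ≤ candPotential (fun x => -c.data.pos x) T.C T.D
      (-c.data.pos T.h) (-c.data.pos T.s) (-c.data.pos T.l) := by
      exact_mod_cast candPotential_erase z
    have h2 := mul_le_mul_of_nonneg_left h1 hκ
    have h3 : (T.C.card : ℝ) = (T.C.erase z).card + 1 := by
      exact_mod_cast (Finset.card_erase_add_one hz).symm
    simp only [Config.potential, Config.set, hs, Soft.potential, Soft.forwardPotential,
        Soft.backwardPotential, h3]
    push_cast
    linarith
  | case3f T u z hs hu hz huh hlz hzu hsu =>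
    obtain ⟨i, hi, hT⟩ := hc.busy T hs
    have hlu : c.data.lt T.l u := lt_of_lt_of_le (b := c.data.order.idxOf z) hlz hzu
    have h1 : (candPotential c.data.pos (T.A.erase u) (insert u T.B) (c.data.pos T.l)
      (c.data.pos T.s) (c.data.pos T.h) : ℝ) ≤ candPotential c.data.pos T.A T.B (c.data.pos T.l)
      (c.data.pos T.s) (c.data.pos T.h) := by
      exact_mod_cast candPotential_move hu (Data.pos_lt.2 hlu) (Data.pos_le.2 hsu)
        (Data.pos_lt.2 huh)
    have h2 := mul_le_mul_of_nonneg_left h1 hκ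
    have h3 : (T.A.card : ℝ) = (T.A.erase u).card + 1 := by
      exact_mod_cast (Finset.card_erase_add_one hu).symm
    simp only [Config.potential, Config.set, hs, Soft.potential, Soft.forwardPotential,
        Soft.backwardPotential, h3]
    push_cast
    linarith
  | case3b T u z hs hu hz huh hlz hzu hzs =>
    have hzh : c.data.lt z T.h := lt_of_le_of_lt (b := c.data.order.idxOf u) hzu huh
    have h1 : (candPotential (fun x => -c.data.pos x) (T.C.erase z) (insert z T.D)
      (-c.data.pos T.h) (-c.data.pos T.s) (-c.data.pos T.l) : ℝ) ≤
      candPotential (fun x => -c.data.pos x) T.C T.D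
      (-c.data.pos T.h) (-c.data.pos T.s) (-c.data.pos T.l) := by
      exact_mod_cast candPotential_move hz (neg_lt_neg (Data.pos_lt.2 hzh))
        (neg_le_neg (Data.pos_le.2 hzs)) (neg_lt_neg (Data.pos_lt.2 hlz))
    have h2 := mul_le_mul_of_nonneg_left h1 hκ
    have h3 : (T.C.card : ℝ) = (T.C.erase z).card + 1 := by
      exact_mod_cast (Finset.card_erase_add_one hz).symm
    simp only [Config.potential, Config.set, hs, Soft.potential, Soft.forwardPotential,
        Soft.backwardPotential, h3]
    push_cast
    linarith
  | case4f T u z hs huz h =>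
    have h1 : (candPotential c.data.pos (T.A.erase u) T.B (c.data.pos T.l) (c.data.pos T.s)
      (c.data.pos T.h) : ℝ) ≤ candPotential c.data.pos T.A T.B (c.data.pos T.l) (c.data.pos T.s)
      (c.data.pos T.h) := by exact_mod_cast candPotential_erase u
    have h2 := mul_le_mul_of_nonneg_left h1 hκ
    have h3 : (T.A.card : ℝ) = (T.A.erase u).card + 1 := by
      exact_mod_cast (Finset.card_erase_add_one huz.1).symm
    simp only [Config.potential, Config.set, hs, Soft.potential, Soft.forwardPotential,
        Soft.backwardPotential, h3]
    push_cast
    linarith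
  | case4b T u z hs huz h =>
    have h1 : (candPotential (fun x => -c.data.pos x) (T.C.erase z) T.D (-c.data.pos T.h)
      (-c.data.pos T.s) (-c.data.pos T.l) : ℝ) ≤ candPotential (fun x => -c.data.pos x) T.C T.D
      (-c.data.pos T.h) (-c.data.pos T.s) (-c.data.pos T.l) := by
      exact_mod_cast candPotential_erase z
    have h2 := mul_le_mul_of_nonneg_left h1 hκ
    have h3 : (T.C.card : ℝ) = (T.C.erase z).card + 1 := by
      exact_mod_cast (Finset.card_erase_add_one huz.2.1).symm
    simp only [Config.potential, Config.set, hs, Soft.potential, Soft.forwardPotential,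
        Soft.backwardPotential, h3]
    push_cast
    linarith
  | asideF T u z e hs huz hz he he' hl =>
    obtain ⟨i, hi, hT⟩ := hc.busy T hs
    have hd := hT.base.sound
    have h1 := hd.dataPotential_examine i.pos (i.val + 1) [e]
    have hu := (hT.base.F u (hT.A_sub huz.1)).1
    have h2 : (liveCount a (i.val + 1) ((c.data.examine a [e]).dropOut u e) : ℝ) + 1 ≤
        liveCount a (i.val + 1) (c.data.examine a [e]) := by
      exact_mod_cast (hd.examine [e]).liveCount_dropOut (by rwa [hd.rep_examine]) he
    simp only [Config.potential, hs, ← hi]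
    rw [dataPotential] at h1 ⊢
    change _ + (_ + T.potential κ c.data) ≤ _
    change _ + (findFactor m * (logSize (c.data.examine a [e]).parent + Real.log (2 * m) *
      rootCount a (c.data.examine a [e]).parent) + _ + _) ≤ _
    simp only [List.length_singleton] at h1
    push_cast at h1 ⊢
    linarith
  | asideB T u z e hs huz hz he he' hl =>
    obtain ⟨i, hi, hT⟩ := hc.busy T hs
    have hd := hT.base.sound
    have h1 := hd.dataPotential_examine i.pos (i.val + 1) [e]
    have hu := (hT.base.R z (hT.C_sub huz.2.1)).1
    have h2 : (liveCount a (i.val + 1) ((c.data.examine a [e]).dropInc z e) : ℝ) + 1 ≤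
        liveCount a (i.val + 1) (c.data.examine a [e]) := by
      exact_mod_cast (hd.examine [e]).liveCount_dropInc (by rwa [hd.rep_examine]) he
    simp only [Config.potential, hs, ← hi]
    rw [dataPotential] at h1 ⊢
    change _ + (_ + T.potential κ c.data) ≤ _
    change _ + (findFactor m * (logSize (c.data.examine a [e]).parent + Real.log (2 * m) *
      rootCount a (c.data.examine a [e]).parent) + _ + _) ≤ _
    simp only [List.length_singleton] at h1
    push_cast at h1 ⊢
    linarith
  | case5 T u z e e' x y hs huz he heT hle he' heT' hle' hx hy =>
    obtain ⟨i, hi, hT⟩ := hc.busy T hs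
    have hd := hT.base.sound
    have h1 := hd.dataPotential_examine i.pos (i.val + 1) [e, e']
    simp only [List.length_cons, List.length_nil] at h1
    have h2 : (candPotential c.data.pos (if x ∈ T.F then T.A else insert x T.A) T.B
      (c.data.pos T.l) (c.data.pos T.s) (c.data.pos T.h) : ℝ) ≤
      candPotential c.data.pos T.A T.B (c.data.pos T.l) (c.data.pos T.s) (c.data.pos T.h) + 2 := by
      split_ifs
      · linarith
      · exact_mod_cast candPotential_insert x
    have h3 : (candPotential (fun x => -c.data.pos x) (if y ∈ T.R then T.C else insert y T.C) T.D
      (-c.data.pos T.h) (-c.data.pos T.s) (-c.data.pos T.l) : ℝ) ≤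
      candPotential (fun x => -c.data.pos x) T.C T.D
      (-c.data.pos T.h) (-c.data.pos T.s) (-c.data.pos T.l) + 2 := by
      split_ifs
      · linarith
      · exact_mod_cast candPotential_insert y
    have h4 : ((if x ∈ T.F then T.A else insert x T.A).card : ℝ) ≤ T.A.card + 1 := by
      split_ifs
      · linarith
      · exact_mod_cast Finset.card_insert_le _ _
    have h5 : ((if y ∈ T.R then T.C else insert y T.C).card : ℝ) ≤ T.C.card + 1 := by
      split_ifs
      · linarith
      · exact_mod_cast Finset.card_insert_le _ _
    have h6 := mul_le_mul_of_nonneg_left (add_le_add h2 h3) hκ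
    simp only [Config.potential, hs, ← hi, Soft.potential, Soft.forwardPotential,
      Soft.backwardPotential, Finset.card_insert_of_notMem heT]
    have h7 : (c.data.examine a [e, e']).pos = c.data.pos := rfl
    rw [h7]
    push_cast at h1 ⊢
    linarith
  | finish T i hs hi hend d' n h =>
    obtain ⟨j, hj, hT⟩ := hc.busy T hs
    obtain rfl : i = j := Fin.ext (hi.trans hj.symm)
    obtain ⟨h1, h2⟩ := hT.base.dataPotential_rebuild (hT.stopped hend) h
    have h3 := hT.arcPotential_le hκ
    -- Each side has at most `k + 1` vertices and exactly `k` arcs, and at most `2 * k + 3` vertices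
    -- are linked. These 6 units turn the debts 27 and 15 into the 33 and 21 of the arc potential.
    have h4 : T.toSearch.rebuildCost n ≤ 6 * T.trF.card + 6 := by
      have e1 := hT.F_card
      have e2 := hT.R_card
      have e3 := hT.trB_card
      rw [Search.rebuildCost]
      omega
    have h4' : (T.toSearch.rebuildCost n : ℝ) ≤ 6 * T.trF.card + 6 := by exact_mod_cast h4
    have h5 : 0 ≤ κ * (T.forwardPotential c.data + T.backwardPotential c.data : ℝ) := by
      positivity
    have h6 : (0 : ℝ) ≤ T.A.card := by positivity
    have h7 : (0 : ℝ) ≤ T.C.card := by positivity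
    rw [hi] at h1 h3
    simp only [Config.potential, hs, Soft.potential]
    push_cast
    linarith

/-- The time is `1 + T.B.card`, and the refilled `A` costs another `T.B.card` for the later removal
of its elements. Together this is at most `3 * T.B.card`, as `B` is not empty. The backward
candidates see only a change of thresholds. -/
theorem CanRefillF.potential_le {κ : ℝ} (hκ : 0 ≤ κ) {c : Config V m (Soft V m)} {T : Soft V m}
    {t : V} (hc : Invariant a (SoftSearching a) c) (h : CanRefillF c T) (ht : t ∈ T.B) :
    (refillF c T t).potential κ a + κ * T.B.card ≤ c.potential κ a + 3 * T.B.card +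
      κ * max (T.B.filter fun x => c.data.pos x < c.data.pos t).card
        (T.B.filter fun x => c.data.pos t < c.data.pos x).card := by
  obtain ⟨hs, _, hA, hB⟩ := h
  obtain ⟨i, hi, hT⟩ := hc.busy T hs
  have hpos : (1 : ℝ) ≤ T.B.card := by exact_mod_cast hB.card_pos
  have e : c.data.pos (if c.data.le t T.h then t else T.h) = min (c.data.pos t) (c.data.pos T.h) := by
    split_ifs with h
    · rw [min_eq_left (Data.pos_le.2 h)]
    · rw [min_eq_right]
      rw [← Data.pos_le] at h
      omega
  have h1 := candPotential_refill (p := c.data.pos) (B := T.B) (l := c.data.pos T.l)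
    (s := c.data.pos T.s) (h := c.data.pos T.h) t
  have h2 := candPotential_threshold (p := fun x => -c.data.pos x) (A := T.C) (B := T.D)
    (l := -c.data.pos T.h) (s := -c.data.pos T.s) (h := -c.data.pos T.l)
    (s' := -(min (c.data.pos t) (c.data.pos T.h))) (by omega) (by
      have := Data.pos_le.2 (hT.B_ge t ht)
      have := Data.pos_le.2 hT.s_le
      omega) (neg_le_neg (Data.pos_le.2 hT.l_le))
    fun z hz => neg_le_neg (Data.pos_le.2 (hT.D_le z hz))
  have h3 := mul_le_mul_of_nonneg_left (add_le_add ((Nat.cast_le (α := ℝ)).2 h1)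
    ((Nat.cast_le (α := ℝ)).2 h2)) hκ
  simp only [refillF, Config.potential, Config.set, hs, Soft.potential, Soft.forwardPotential,
    Soft.backwardPotential, e, hA, Finset.card_empty]
  push_cast at h3 ⊢
  linarith

/-- The mirror image of the forward case. Positions are integers so that the order can be reversed
by negating them. -/
theorem CanRefillB.potential_le {κ : ℝ} (hκ : 0 ≤ κ) {c : Config V m (Soft V m)} {T : Soft V m}
    {t : V} (hc : Invariant a (SoftSearching a) c) (h : CanRefillB c T) (ht : t ∈ T.D) :
    (refillB c T t).potential κ a + κ * T.D.card ≤ c.potential κ a + 3 * T.D.card +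
      κ * max (T.D.filter fun x => c.data.pos x < c.data.pos t).card
        (T.D.filter fun x => c.data.pos t < c.data.pos x).card := by
  obtain ⟨hs, _, hC, hD⟩ := h
  obtain ⟨i, hi, hT⟩ := hc.busy T hs
  have hpos : (1 : ℝ) ≤ T.D.card := by exact_mod_cast hD.card_pos
  have e : -c.data.pos (if c.data.le T.l t then t else T.l) =
      min (-c.data.pos t) (-c.data.pos T.l) := by
    split_ifs with h
    · rw [min_eq_left (neg_le_neg (Data.pos_le.2 h))]
    · rw [min_eq_right]
      rw [← Data.pos_le] at h
      omega
  have e' : c.data.pos (if c.data.le T.l t then t else T.l) =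
      -min (-c.data.pos t) (-c.data.pos T.l) := by omega
  have h1 := candPotential_refill (p := fun x => -c.data.pos x) (B := T.D) (l := -c.data.pos T.h)
    (s := -c.data.pos T.s) (h := -c.data.pos T.l) t
  have h2 := candPotential_threshold (p := c.data.pos) (A := T.A) (B := T.B)
    (l := c.data.pos T.l) (s := c.data.pos T.s) (h := c.data.pos T.h)
    (s' := -min (-c.data.pos t) (-c.data.pos T.l)) (by omega) (by
      have := Data.pos_le.2 (hT.D_le t ht)
      have := Data.pos_le.2 hT.l_le
      omega) (Data.pos_le.2 hT.s_le)
    fun z hz => Data.pos_le.2 (hT.B_ge z hz)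
  have h3 := mul_le_mul_of_nonneg_left (add_le_add ((Nat.cast_le (α := ℝ)).2 h1)
    ((Nat.cast_le (α := ℝ)).2 h2)) hκ
  simp only [neg_lt_neg_iff] at h3
  rw [max_comm] at h3
  simp only [refillB, Config.potential, Config.set, hs, Soft.potential, Soft.forwardPotential,
    Soft.backwardPotential, e', hC, Finset.card_empty, neg_neg]
  push_cast at h3 ⊢
  linarith

end Potential

/-! ### Time bounds, termination, and the expected time for random thresholds. -/

section Time

variable {V : Type u} [Fintype V] {m : ℕ} {a : Fin m → V × V}

/-- Few elements of `S` are less than an approximate median, and few are greater. -/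
theorem IsApproxMedian.max_le {ε : ℝ} {d : Data V m} {S : Finset V} {t : V}
    (h : IsApproxMedian ε d.order S t) :
    (max (S.filter fun x => d.pos x < d.pos t).card (S.filter fun x => d.pos t < d.pos x).card : ℝ) ≤
      (1 - ε) * S.card := by
  obtain ⟨_, h1, h2⟩ := h
  have e1 := Finset.card_filter_add_card_filter_not (s := S) fun x => d.order.idxOf x ≤ d.order.idxOf t
  have e2 := Finset.card_filter_add_card_filter_not (s := S) fun x => d.order.idxOf t ≤ d.order.idxOf x
  simp only [not_le] at e1 e2
  simp only [Data.pos_lt, Data.lt]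
  refine _root_.max_le ?_ ?_
  · have := (congrArg (Nat.cast (R := ℝ)) e2)
    push_cast at this
    linarith
  · have := (congrArg (Nat.cast (R := ℝ)) e1)
    push_cast at this
    linarith

/-- A refill from `g` vertices needs `3 * g` and releases at least `κ * ε * g`; this fixes `κ = 3 /
ε`. -/
theorem SoftStep.potential_le {ε : ℝ} (hε : 0 < ε) {rule : List V → Finset V → V → Prop}
    (hrule : ∀ o S t, t ∈ S → rule o S t → IsApproxMedian ε o S t) {c c' : Config V m (Soft V m)}
    (hc : Invariant a (SoftSearching a) c) (h : SoftStep a rule c c') :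
    c'.potential (3 / ε) a ≤ c.potential (3 / ε) a := by
  have hκ : 0 ≤ 3 / ε := by positivity
  have key : ∀ g M : ℝ, M ≤ (1 - ε) * g → 3 * g + 3 / ε * M ≤ 3 / ε * g := by
    intro g M hM
    have h1 := mul_le_mul_of_nonneg_left hM hκ
    have h2 : 3 / ε * ((1 - ε) * g) = 3 / ε * g - 3 * g := by field_simp
    linarith
  cases h with
  | plain _ h => exact h.potential_le hκ hc
  | case1f T t h ht hr =>
    have h1 := h.potential_le hκ hc ht
    have h2 := key _ _ (hrule _ _ _ ht hr).max_le
    push_cast at h1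
    linarith
  | case1b T t h ht hr =>
    have h1 := h.potential_le hκ hc ht
    have h2 := key _ _ (hrule _ _ _ ht hr).max_le
    push_cast at h1
    linarith

theorem SoftStep.cost_le {ε : ℝ} (hε : 0 < ε) {rule : List V → Finset V → V → Prop}
    (hrule : ∀ o S t, t ∈ S → rule o S t → IsApproxMedian ε o S t) {o : List V} (ho : o.Nodup)
    (ho' : ∀ x, x ∈ o) {c : Config V m (Soft V m)}
    (hc : ReflTransGen (SoftStep a rule) (Config.empty o) c) :
    (c.cost : ℝ) ≤ m * ((79 + 4 * (3 / ε) + 5 / 2 * (33 + 4 * (3 / ε))) * Real.sqrt m) := by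
  have hκ : 0 ≤ 3 / ε := by positivity
  have h : Invariant a (SoftSearching a) c ∧ c.potential (3 / ε) a ≤
      (Config.empty o : Config V m (Soft V m)).potential (3 / ε) a := by
    induction hc with
    | refl => exact ⟨invariant_empty ho ho', le_rfl⟩
    | tail _ h ih => exact ⟨h.invariant ih.1, (h.potential_le hε hrule ih.1).trans ih.2⟩
  exact (h.1.cost_le hκ).trans (h.2.trans (potential_empty_le hκ o))

theorem SoftStep.cost_lt {rule : List V → Finset V → V → Prop} {c c' : Config V m (Soft V m)}
    (h : SoftStep a rule c c') : c.cost < c'.cost := by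
  cases h with
  | plain _ h =>
    cases h with
    | start _ h => cases h <;> simp only <;> omega
    | finish => simp only [Search.rebuildCost]; omega
    | _ => simp only [Config.set]; omega
  | case1f => simp only [StrongMaintenance.refillF, Config.set]; omega
  | case1b => simp only [StrongMaintenance.refillB, Config.set]; omega

/-- Every element lies on both sides of itself, so any choice is an approximate median for an `ε`
that depends on the number of vertices. This gives every rule a time bound, which is all that
termination needs. The `+ 1` keeps the denominator positive even if `V` is empty. -/
theorem isApproxMedian_of_mem {o : List V} {S : Finset V} {t : V} (ht : t ∈ S) :
    IsApproxMedian (1 / (Fintype.card V + 1 : ℝ)) o S t := by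
  have hS : (S.card : ℝ) ≤ Fintype.card V + 1 := by
    have : S.card ≤ Fintype.card V + 1 := (Finset.card_le_univ S).trans (Nat.le_succ _)
    exact_mod_cast this
  have h1 : 1 / (Fintype.card V + 1 : ℝ) * S.card ≤ 1 := by
    rw [one_div_mul_eq_div, div_le_one (by positivity)]
    exact hS
  refine ⟨ht, h1.trans ?_, h1.trans ?_⟩
  · exact Nat.one_le_cast.2 (Finset.card_pos.2 ⟨t, Finset.mem_filter.2 ⟨ht, le_rfl⟩⟩)
  · exact Nat.one_le_cast.2 (Finset.card_pos.2 ⟨t, Finset.mem_filter.2 ⟨ht, le_rfl⟩⟩)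

/-- Each step takes at least one unit of time and the total time is bounded, so there are no
infinite runs. -/
theorem softStep_maintains {rule : List V → Finset V → V → Prop} {o : List V} (ho : o.Nodup)
    (ho' : ∀ x, x ∈ o)
    (hrule : ∀ (o : List V) (S : Finset V), S.Nonempty → ∃ t ∈ S, rule o S t) :
    Maintains a (SoftStep a rule) (Config.empty o) where
  terminates := by
    set ε := 1 / (Fintype.card V + 1 : ℝ) with hε'
    have hε : 0 < ε := by positivity
    obtain ⟨N, hN⟩ := exists_nat_ge
      ((m : ℝ) * ((79 + 4 * (3 / ε) + 5 / 2 * (33 + 4 * (3 / ε))) * Real.sqrt m))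
    have key : ∀ n (c : Config V m (Soft V m)), ReflTransGen (SoftStep a rule) (Config.empty o) c →
        N < c.cost + n → Acc (fun c' c => SoftStep a rule c c') c := by
      intro n
      induction n with
      | zero =>
        intro c hc hcn
        have h := (SoftStep.cost_le hε (fun _ _ _ ht _ => isApproxMedian_of_mem ht) ho ho' hc).trans hN
        have : c.cost ≤ N := by exact_mod_cast h
        omega
      | succ n ih =>
        intro c hc hcn
        refine ⟨c, fun c' h => ih c' (hc.tail h) ?_⟩
        have := h.cost_lt
        omega
    exact key (N + 1) _ .refl (by omega)
  progress c hc h := SoftStep.exists_step hrule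
    (SoftStep.invariant_of_reach (invariant_empty ho ho') hc) h
  bounded c hc := (SoftStep.invariant_of_reach (invariant_empty ho ho') hc).bounded
  correct c hc h := (SoftStep.invariant_of_reach (invariant_empty ho ho') hc).idle h

/-! ### Random thresholds -/

theorem tsum_pure_mul {α : Type u} (x : α) (W : α → ℝ≥0∞) : ∑' y, PMF.pure x y * W y = W x := by
  rw [tsum_eq_single x]
  · simp
  · intro y hy
    simp [PMF.pure_apply, hy]

theorem tsum_bind_mul {α β : Type u} (p : PMF α) (f : α → PMF β) (W : β → ℝ≥0∞) :
    ∑' y, p.bind f y * W y = ∑' x, p x * ∑' y, f x y * W y := by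
  simp only [PMF.bind_apply, ← ENNReal.tsum_mul_right, ← ENNReal.tsum_mul_left, mul_assoc]
  exact ENNReal.tsum_comm

theorem tsum_map_mul {α β : Type u} (p : PMF α) (f : α → β) (W : β → ℝ≥0∞) :
    ∑' y, p.map f y * W y = ∑' x, p x * W (f x) := by
  rw [← PMF.bind_pure_comp, tsum_bind_mul]
  simp only [Function.comp, tsum_pure_mul]

theorem tsum_uniform_mul {α : Type u} (S : Finset α) (hS : S.Nonempty) (W : α → ℝ≥0∞) :
    ∑' x, PMF.uniformOfFinset S hS x * W x = (S.card : ℝ≥0∞)⁻¹ * ∑ x ∈ S, W x := by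
  rw [tsum_eq_sum (s := S)]
  · rw [Finset.mul_sum]
    refine Finset.sum_congr rfl fun x hx => ?_
    rw [PMF.uniformOfFinset_apply_of_mem hS hx]
  · intro x hx
    rw [PMF.uniformOfFinset_apply_of_notMem hS hx, zero_mul]

/-- The potential of a configuration that satisfies the invariant. -/
def value (a : Fin m → V × V) (c : Config V m (Soft V m)) : ℝ≥0∞ :=
  if Invariant a (SoftSearching a) c then ENNReal.ofReal (c.potential 18 a) else ⊤

theorem cost_le_value (c : Config V m (Soft V m)) : (c.cost : ℝ≥0∞) ≤ value a c := by
  rw [value]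
  split_ifs with h
  · rw [← ENNReal.ofReal_natCast]
    exact ENNReal.ofReal_le_ofReal (h.cost_le (by norm_num))
  · exact le_top

/-- A uniformly random threshold does not increase the potential in expectation. -/
theorem average_le {p : V → ℤ} {S : Finset V} (hS : S.Nonempty) (hp : Set.InjOn p S)
    {W : V → ℝ≥0∞} {f : V → ℝ} {r : ℝ} (hW : ∀ t ∈ S, W t = ENNReal.ofReal (f t))
    (hf0 : ∀ t ∈ S, 0 ≤ f t)
    (hf : ∀ t ∈ S, f t + 18 * S.card ≤ r + 3 * S.card + 18 *
      max (S.filter fun x => p x < p t).card (S.filter fun x => p t < p x).card) :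
    ∑' t, PMF.uniformOfFinset S hS t * W t ≤ ENNReal.ofReal r := by
  have hg : (0 : ℝ) < S.card := by exact_mod_cast hS.card_pos
  rw [tsum_uniform_mul, Finset.sum_congr rfl hW]
  have h0 : ((S.card : ℝ≥0∞))⁻¹ = ENNReal.ofReal ((S.card : ℝ)⁻¹) := by
    rw [ENNReal.ofReal_inv_of_pos hg, ENNReal.ofReal_natCast]
  set M : V → ℕ := fun t =>
    max (S.filter fun x => p x < p t).card (S.filter fun x => p t < p x).card with hM
  have h1 : ((S.card : ℝ)) ^ 2 ≤ 6 * ∑ t ∈ S, ((S.card : ℝ) - M t) := by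
    have h2 : ((∑ t ∈ S, (S.card - M t) : ℕ) : ℝ) = ∑ t ∈ S, ((S.card : ℝ) - M t) := by
      rw [Nat.cast_sum]
      refine Finset.sum_congr rfl fun t _ => ?_
      rw [Nat.cast_sub]
      exact max_le (Finset.card_le_card (Finset.filter_subset _ _))
        (Finset.card_le_card (Finset.filter_subset _ _))
    rw [← h2]
    exact_mod_cast sum_rank_le hp
  have h3 : ∀ t ∈ S, f t ≤ r + 3 * S.card - 18 * ((S.card : ℝ) - M t) := fun t ht => by
    have := hf t ht
    simp only [hM]
    push_cast at this ⊢
    linarith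
  -- Here `κ = 18 = 3 * 6`: the mean of `S.card - M t` is at least `S.card / 6`, so the mean release
  -- covers `3 * S.card`.
  have h4 : ∑ t ∈ S, (r + 3 * S.card - 18 * ((S.card : ℝ) - M t)) ≤ S.card * r := by
    rw [Finset.sum_sub_distrib, ← Finset.mul_sum, Finset.sum_const, nsmul_eq_mul]
    nlinarith
  rw [← ENNReal.ofReal_sum_of_nonneg hf0, h0, ← ENNReal.ofReal_mul (by positivity)]
  refine ENNReal.ofReal_le_ofReal ?_
  rw [inv_mul_le_iff₀ hg]
  exact (Finset.sum_le_sum h3).trans h4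

/-- The potential is a supermartingale. It is infinite where the invariant fails, so the inequality
holds at every configuration without any assumption of reachability. -/
theorem Draw.value_le {c : Config V m (Soft V m)} {P : PMF (Config V m (Soft V m))}
    (h : Draw a c P) : ∑' c', P c' * value a c' ≤ value a c := by
  by_cases hc : Invariant a (SoftSearching a) c
  · cases h with
    | halt _ => rw [tsum_pure_mul]
    | plain c' h =>
      rw [tsum_pure_mul, value, value, if_pos hc, if_pos (h.invariant hc)]
      exact ENNReal.ofReal_le_ofReal (h.potential_le (by norm_num) hc)
    | case1f T h =>
      obtain ⟨i, hi, hT⟩ := hc.busy T h.1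
      rw [tsum_map_mul, value, if_pos hc]
      refine average_le (p := c.data.pos) h.2.2.2 (fun x hx y hy hxy => ?_)
        (f := fun t => (refillF c T t).potential 18 a) (fun t ht => ?_)
        (fun t ht => (Nat.cast_nonneg _).trans ((h.invariant hc ht).cost_le (by norm_num)))
        fun t ht => ?_
      · exact (List.idxOf_inj (hT.root_F (hT.B_sub hx))).1 (Int.ofNat_inj.1 hxy)
      · rw [value, if_pos (h.invariant hc ht)]
      · exact h.potential_le (by norm_num) hc ht
    | case1b T h =>
      obtain ⟨i, hi, hT⟩ := hc.busy T h.1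
      rw [tsum_map_mul, value, if_pos hc]
      refine average_le (p := c.data.pos) h.2.2.2 (fun x hx y hy hxy => ?_)
        (f := fun t => (refillB c T t).potential 18 a) (fun t ht => ?_)
        (fun t ht => (Nat.cast_nonneg _).trans ((h.invariant hc ht).cost_le (by norm_num)))
        fun t ht => ?_
      · exact (List.idxOf_inj (hT.root_R (hT.D_sub hx))).1 (Int.ofNat_inj.1 hxy)
      · rw [value, if_pos (h.invariant hc ht)]
      · exact h.potential_le (by norm_num) hc ht
  · rw [value, if_neg hc]
    exact le_top

/-- Because the expected potential cannot rise at any configuration, it cannot rise along the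
history either, even if the remaining choices depend on the whole past. It dominates the time spent.
-/
theorem expectedCost_le {o : List V} (ho : o.Nodup) (ho' : ∀ x, x ∈ o)
    {K : Config V m (Soft V m) → List (Config V m (Soft V m)) → PMF (Config V m (Soft V m))}
    (hK : ∀ c H, Draw a c (K c H)) (n : ℕ) :
    expectedCost K (Config.empty o) n ≤
      ENNReal.ofReal (m * ((79 + 4 * 18 + 5 / 2 * (33 + 4 * 18)) * Real.sqrt m)) := by
  have key : ∀ n, ∑' H, history K (Config.empty o) n H * value a H.1 ≤
      value a (Config.empty o : Config V m (Soft V m)) := by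
    intro n
    induction n with
    | zero =>
      rw [history, tsum_pure_mul (W := fun H : Config V m (Soft V m) × List (Config V m (Soft V m)) =>
        value a H.1)]
    | succ n ih =>
      refine le_trans ?_ ih
      rw [history, tsum_bind_mul]
      refine ENNReal.tsum_le_tsum fun H => mul_le_mul_right ?_ _
      rw [tsum_map_mul]
      exact (hK H.1 H.2).value_le
  refine le_trans (ENNReal.tsum_le_tsum fun H => mul_le_mul_right (cost_le_value H.1) _)
    ((key n).trans ?_)
  rw [value, if_pos (invariant_empty ho ho')]
  exact ENNReal.ofReal_le_ofReal (potential_empty_le (by norm_num) o)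

end Time

end

end StrongMaintenance

theorem mainTheorem8 :
    -- the general method is correct
    (∀ (V : Type u) [Fintype V] (m : ℕ) (a : Fin m → V × V) (o : List V),
      o.Nodup → (∀ x, x ∈ o) →
      StrongMaintenance.Maintains a (StrongMaintenance.GeneralStep a)
        (StrongMaintenance.Config.empty o) ∧
      ∀ (c : StrongMaintenance.Config V m (StrongMaintenance.Search V m))
        (S : StrongMaintenance.Search V m) (i : Fin m) (s : V) (X Y : Finset V),
        Relation.ReflTransGen (StrongMaintenance.GeneralStep a)
          (StrongMaintenance.Config.empty o) c →
        c.search = some S → i.val = c.done → S.Stop c.data s →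
        (∀ x, x ∈ X ↔ x ∈ S.F ∧ c.data.lt x s) → (∀ y, y ∈ Y ↔ y ∈ S.R ∧ c.data.lt s y) →
        StrongMaintenance.Detects a i c.data S X Y s) ∧
    -- compatible search with a soft threshold is correct, however the thresholds are chosen
    (∀ (V : Type u) [Fintype V] (m : ℕ) (a : Fin m → V × V) (o : List V)
      (rule : List V → Finset V → V → Prop),
      o.Nodup → (∀ x, x ∈ o) →
      (∀ (o' : List V) (S : Finset V), S.Nonempty → ∃ t ∈ S, rule o' S t) →
      StrongMaintenance.Maintains a (StrongMaintenance.SoftStep a rule)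
        (StrongMaintenance.Config.empty o) ∧
      ∀ (c : StrongMaintenance.Config V m (StrongMaintenance.Soft V m))
        (T : StrongMaintenance.Soft V m) (i : Fin m),
        Relation.ReflTransGen (StrongMaintenance.SoftStep a rule)
          (StrongMaintenance.Config.empty o) c →
        c.search = some T → i.val = c.done → T.Stop →
        StrongMaintenance.Detects a i c.data T.toSearch (T.finalX c.data) (T.finalY c.data)
          T.final) ∧
    -- time for approximate medians: `O(m ^ (1 / 2))` amortized over the `m` arc additions
    (∀ ε : ℝ, 0 < ε → ∃ K : ℝ,
      ∀ (V : Type u) [Fintype V] (m : ℕ) (a : Fin m → V × V) (o : List V),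
      o.Nodup → (∀ x, x ∈ o) →
      ∀ c : StrongMaintenance.Config V m (StrongMaintenance.Soft V m),
        Relation.ReflTransGen
          (StrongMaintenance.SoftStep a (StrongMaintenance.IsApproxMedian ε))
          (StrongMaintenance.Config.empty o) c →
        (c.cost : ℝ) ≤ m * (K * Real.sqrt m)) ∧
    -- expected time for random soft thresholds
    (∃ K : ℝ,
      ∀ (V : Type u) [Fintype V] (m : ℕ) (a : Fin m → V × V) (o : List V),
      o.Nodup → (∀ x, x ∈ o) →
      ∀ P : StrongMaintenance.Config V m (StrongMaintenance.Soft V m) →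
          List (StrongMaintenance.Config V m (StrongMaintenance.Soft V m)) →
          PMF (StrongMaintenance.Config V m (StrongMaintenance.Soft V m)),
        (∀ c H, StrongMaintenance.Draw a c (P c H)) →
        ∀ n : ℕ, StrongMaintenance.expectedCost P (StrongMaintenance.Config.empty o) n ≤
          ENNReal.ofReal (m * (K * Real.sqrt m))) := by
  refine ⟨fun V _ m a o ho ho' => ⟨StrongMaintenance.generalStep_maintains ho ho',
      fun c S i s X Y hc hs hi hend hX hY =>
        StrongMaintenance.generalStep_detects ho ho' hc hs hi hend hX hY⟩,
    fun V _ m a o rule ho ho' hrule => ⟨StrongMaintenance.softStep_maintains ho ho' hrule,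
      fun c T i hc hs hi hend => StrongMaintenance.softStep_detects ho ho' hc hs hi hend⟩,
    fun ε hε => ⟨79 + 4 * (3 / ε) + 5 / 2 * (33 + 4 * (3 / ε)), fun V _ m a o ho ho' c hc =>
      StrongMaintenance.SoftStep.cost_le hε (fun _ _ _ _ h => h) ho ho' hc⟩,
    79 + 4 * 18 + 5 / 2 * (33 + 4 * 18), fun V _ m a o ho ho' P hP n =>
      StrongMaintenance.expectedCost_le ho ho' hP n⟩
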